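/- Let $p\ge 1$, $q\ge 2$, $n=p+q-2>2$, $\varepsilon_i=1$ for $1\le i\le p-1$, $\varepsilon_i=-1$ for $p\le i\le n$, and $\lambda\in\mathbb C$. Notation. Let $G=SO_o(p,q)$ be the identity component of the group preserving $2x_0x_{n+1}+\sum_{i=1}^n\varepsilon_ix_i^2$ on $\mathbb R^{n+2}$, $G'=SO_o(p,q-1)$ the subgroup of $G$ fixing $e_n$, $P\subset G$ the isotropy group of the line $\mathbb R e_0$, and $P'=P\cap G'$. An element $h\in P$ acts on $e_0$ by a scalar $\epsilon a$ with $\epsilon\in\{\pm1\}$, $a>0$, and has a middle block $m\in SO(p-1,q-1)$ (for $h\in P'$: $m'\in SO(p-1,q-2)$). Let $\mathbb C_\mu$ be the character $h\mapsto a^\mu$, $\mathrm{sgn}$ the character $h\mapsto\epsilon$, and $\mathrm{Ind}$ the unnormalized smoothly induced representation $\{F: F(gh)=h^{-1}F(g)\}$. Let $\mathfrak n_\pm\cong\mathbb C^n$ be the nilradicals of $\mathfrak p$ and of its opposite, $\mathfrak n_+'=\mathfrak n_+\cap\mathfrak g'$ (all Lie algebras complexified). Sections are restricted to $N_-\cong\mathbb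 R^{p-1,q-1}$ (coordinates $x_1,\dots,x_n$), respectively to $N'_-=\{x_n=0\}\cong\mathbb R^{p-1,q-2}$ (non-compact picture); $d\pi^G_\lambda$, $d\pi^{G'}_\mu$ are the infinitesimal representations on $C^\infty(\mathbb R^{p-1,q-1})$, $C^\infty(\mathbb R^{p-1,q-2})$ obtained from $\mathrm{Ind}_P^G(\mathbb C_\lambda)$, $\mathrm{Ind}_{P'}^{G'}(\mathbb C_\mu)$. An operator in the non-compact picture is called $G'$-equivariant from $\mathrm{Ind}_P^G(V)$ to $\mathrm{Ind}_{P'}^{G'}(V')$ if it comes from a $G'$-equivariant linear map between these spaces. The generalized Verma module $M(-\lambda)=U(\mathfrak g)\otimes_{U(\mathfrak p)}\mathbb C_{-\lambda}$ is paired with $C^\infty(\mathbb R^n)$ by $\langle u\otimes 1,f\rangle=(d\pi_\lambda^G(u^{\circ})f)(0)$, where $u\mapsto u^\circ$ is the antiautomorphism with $X^\circ=-X$; for a polynomial $w(\xi)$, $\varphi(w)\in M(-\lambda)$ denotes the vector with $\langle\varphi(w),e^{i\langle x,\xi\rangle}\rangle=w(\xi)$. A singular vector is a vector annihilated by $\mathfrak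 n'_+$. Put $|\xi'|^2=\sum_{i<n}\varepsilon_i\xi_i^2$, $\square'=\sum_{i<n}\varepsilon_i\partial_{x_i}^2$, and let $\mathcal H^j(\mathbb R^{p-1,q-1})$, $\mathcal H^j(\mathbb R^{p-1,q-2})$ be the spaces of homogeneous polynomials of degree $j$ killed by $\sum_{i\le n}\varepsilon_i\partial_i^2$, resp. by $\sum_{i<n}\varepsilon_i\partial_i^2$. For $N\ge0$ and $0\le j\le N$ let $$a_j(\lambda)=\frac{(-2)^{N-j}N!}{j!(2N-2j)!}\prod_{k=j}^{N-1}(2\lambda-4N+2k+n+1),\qquad b_j(\lambda)=\frac{(-2)^{N-j}N!}{j!(2N-2j+1)!}\prod_{k=j}^{N-1}(2\lambda-4N+2k+n-1)$$ (so $a_N=b_N=1$), $$D_{2N}(\lambda)=\sum_{j=0}^N a_j(-\lambda)(-\square')^j\partial_{x_n}^{2N-2j},\qquad D_{2N+1}(\lambda)=\sum_{j=0}^N b_j(-\lambda)(-\square')^j\partial_{x_n}^{2N-2j+1},$$ and $\mathscr D_K(\lambda)f=(D_K(\lambda)f)|_{x_n=0}$. With $\alpha=\lambda-\frac{n-1}2$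 and the Gegenbauer polynomial $C_K^\alpha$ let $w_{K,-\lambda}(\xi)$ be the polynomial obtained, for $K=2N$ resp. $K=2N+1$, from $\frac{N!}{(\alpha)_N}$ resp. $\frac{N!}{2(\alpha)_{N+1}}$ times $\xi_n^K\,\mathcal C_K^\alpha(|\xi'|^2/\xi_n^2)$, where $\mathcal C_K^\alpha(x^2)=x^KC_K^\alpha(x^{-1})$ (the coefficients of this product are polynomials in $\alpha$, so that it is defined for all $\alpha$). (1) For every $K\in\mathbb N$, $D_K(\lambda)$ is a differential operator of order $K$; $\varphi(w_{K,-\lambda})$ is a singular vector in $M(-\lambda)$ and induces $\mathscr D_K(\lambda): C^\infty(\mathbb R^{p-1,q-1})\to C^\infty(\mathbb R^{p-1,q-2})$, in the sense that $(\mathscr D_K(\lambda)f)(0)=i^K\langle\varphi(w_{K,-\lambda}),f\rangle$; $\mathscr D_K(\lambda)$ is $G'$-equivariant from $\mathrm{Ind}_P^G(\mathrm{sgn}^\delta\otimes\mathbb C_\lambda)$ to $\mathrm{Ind}_{P'}^{G'}(\mathrm{sgn}^{\delta+K}\otimes\mathbb C_{\lambda+K})$ for every $\delta\in\{0,1\}$;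 and $$\mathscr D_K(\lambda)\,d\pi^G_\lambda(X)=d\pi^{G'}_{\lambda+K}(X)\,\mathscr D_K(\lambda)\qquad(X\in\mathfrak g').$$ (2) Suppose that $-\lambda\in\mathbb N$ and $1\le j\le|\lambda|+1$. Let $B_j:C^\infty(\mathbb R^{p-1,q-2})\to C^\infty(\mathbb R^{p-1,q-2})\otimes\mathcal H^j(\mathbb R^{p-1,q-2})$ be the first BGG operator of order $j$, corresponding to the $G'$-module of symmetric traceless powers of order $j-1$ of the defining representation $\mathbb C^{n+1}$: $B_j\sigma$ is the symmetric trace-free part of the $j$-fold gradient $\nabla_{a_1}\cdots\nabla_{a_j}\sigma$. It is $G'$-equivariant from $\mathrm{Ind}_{P'}^{G'}(\mathrm{sgn}^\delta\otimes\mathbb C_{1-j})$ to $\mathrm{Ind}_{P'}^{G'}(\mathrm{sgn}^{\delta+j}\otimes\mathcal H^j(\mathbb R^{p-1,q-2})\otimes\mathbb C_1)$ for every $\delta$, and it annihilates the image of that $G'$-module in $C^\infty(\mathbb R^{p-1,q-2})$, i.e. the functions $x'\mapsto Q(\exp(x')e_0)$ with $Q$ a homogeneous polynomial of degree $j-1$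 on $\mathbb R^{n+1}=e_n^{\perp}$. The composition $$\mathscr D_j=B_j\circ\mathscr D_{|\lambda|+1-j}(\lambda):C^\infty(\mathbb R^{p-1,q-1})\to C^\infty(\mathbb R^{p-1,q-2})\otimes\mathcal H^j(\mathbb R^{p-1,q-2})$$ (for $j=|\lambda|+1$: restriction to $x_n=0$ followed by $B_j$) is $G'$-equivariant from $\mathrm{Ind}_P^G(\mathrm{sgn}^\delta\otimes\mathbb C_\lambda)$ to $\mathrm{Ind}_{P'}^{G'}(\mathrm{sgn}^{\delta+|\lambda|+1}\otimes\mathcal H^j(\mathbb R^{p-1,q-2})\otimes\mathbb C_1)$ for every $\delta$. It is induced by the space $\varphi(H'_j)$ of singular vectors of $M(-\lambda)$, where $H'_j\subset\mathcal H^{|\lambda|+1}(\mathbb R^{p-1,q-1})$ is the $O(p-1,q-2)$-summand isomorphic to $\mathcal H^j(\mathbb R^{p-1,q-2})$: there is an injective $O(p-1,q-2)$-equivariant linear map $\iota:\mathcal H^j(\mathbb R^{p-1,q-2})\to\mathcal H^{|\lambda|+1}(\mathbb R^{p-1,q-1})$ (with image $H'_j$) such that, for all $h$, $\varphi(\iota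 h)$ is a singular vector and $h(\partial)\big[(\mathscr D_jf)(0)\big]=j!\,i^{|\lambda|+1}\langle\varphi(\iota h),f\rangle$ for all $f\in C^\infty(\mathbb R^{p-1,q-1})$. -/

import Mathlib

open scoped ContDiff Matrix

noncomputable section

namespace ConfCov

/-! ## The quadratic form, the groups, the unipotent charts -/

/-- Indices of the coordinates `x_0 ; x_1, …, x_n ; x_{n+1}` of `ℝ^{n+2}`:
`i0` is the index `0`, `im i` the middle indices, `i1` the index `n+1`. -/
abbrev Idx (n : ℕ) : Type := Unit ⊕ Fin n ⊕ Unit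

abbrev i0 {n : ℕ} : Idx n := Sum.inl ()
abbrev im {n : ℕ} (i : Fin n) : Idx n := Sum.inr (Sum.inl i)
abbrev i1 {n : ℕ} : Idx n := Sum.inr (Sum.inr ())

/-- The signs `ε_1, …, ε_n`: the first `p - 1` of them are `1`, the others are `-1`. -/
def sgn (p n : ℕ) : Fin n → ℝ := fun i => if (i : ℕ) + 1 < p then 1 else -1

/-- `|X|² = ∑ ε_i x_i²`. -/
def normSq {n : ℕ} (ε : Fin n → ℝ) (X : Fin n → ℝ) : ℝ := ∑ i, ε i * X i ^ 2

/-- The matrix of the quadratic form `2 x_0 x_{n+1} + ∑ ε_i x_i²`. -/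
def quadMat {n : ℕ} (ε : Fin n → ℝ) : Matrix (Idx n) (Idx n) ℝ := fun a b =>
  match a, b with
  | .inl _, .inr (.inr _) => 1
  | .inr (.inr _), .inl _ => 1
  | .inr (.inl i), .inr (.inl j) => if i = j then ε i else 0
  | _, _ => 0

/-- `exp X ∈ N_-` for `X ∈ 𝔫_-(ℝ) = ℝⁿ`. -/
def nbar {n : ℕ} (ε : Fin n → ℝ) (X : Fin n → ℝ) : Matrix (Idx n) (Idx n) ℝ := fun a b =>
  match a, b with
  | .inl _, .inl _ => 1
  | .inr (.inl i), .inl _ => X i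
  | .inr (.inl i), .inr (.inl j) => if i = j then 1 else 0
  | .inr (.inr _), .inl _ => -(normSq ε X) / 2
  | .inr (.inr _), .inr (.inl j) => -(ε j * X j)
  | .inr (.inr _), .inr (.inr _) => 1
  | _, _ => 0

/-- The element of `𝔫_+` with coordinates `Z = (z_1, …, z_n)`. -/
def nplus {n : ℕ} (ε : Fin n → ℝ) (Z : Fin n → ℂ) : Matrix (Idx n) (Idx n) ℂ := fun a b =>
  match a, b with
  | .inl _, .inr (.inl j) => Z j
  | .inr (.inl i), .inr (.inr _) => -((ε i : ℂ) * Z i)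
  | _, _ => 0

lemma nbar_mul {n : ℕ} (ε X Y : Fin n → ℝ) : nbar ε X * nbar ε Y = nbar ε (X + Y) := by
  ext a b
  rcases a with a | a | a <;> rcases b with b | b | b <;>
    simp [Matrix.mul_apply, nbar, Fintype.sum_sum_type, normSq, ite_mul, mul_ite]
  · have h : ∑ i, ε i * (X i + Y i) ^ 2 =
        ∑ i, ε i * X i ^ 2 + 2 * ∑ i, ε i * X i * Y i + ∑ i, ε i * Y i ^ 2 := by
      rw [Finset.mul_sum, ← Finset.sum_add_distrib, ← Finset.sum_add_distrib]
      exact Finset.sum_congr rfl fun i _ => by ring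
    rw [h]; ring
  · ring

lemma nbar_zero {n : ℕ} (ε : Fin n → ℝ) : nbar ε 0 = 1 := by
  ext a b
  rcases a with a | a | a <;> rcases b with b | b | b <;>
    simp [nbar, normSq, Matrix.one_apply]

lemma nbar_quad {n : ℕ} (ε X : Fin n → ℝ) :
    (nbar ε X)ᵀ * quadMat ε * nbar ε X = quadMat ε := by
  ext a b
  rcases a with a | a | a <;> rcases b with b | b | b <;>
    simp [Matrix.mul_apply, nbar, quadMat, Fintype.sum_sum_type, normSq, ite_mul, mul_ite]
  · have : ∑ x, X x * ε x * X x = ∑ i, ε i * X i ^ 2 :=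
      Finset.sum_congr rfl fun i _ => by ring
    rw [this]; ring
  · ring

/-- `exp X ∈ N_-` as an invertible matrix. -/
def nbarGL {n : ℕ} (ε X : Fin n → ℝ) : GL (Idx n) ℝ where
  val := nbar ε X
  inv := nbar ε (-X)
  val_inv := by rw [nbar_mul, add_neg_cancel, nbar_zero]
  inv_val := by rw [nbar_mul, neg_add_cancel, nbar_zero]

/-- The orthogonal group `O(p,q)` of the quadratic form `2 x_0 x_{n+1} + ∑ ε_i x_i²`. -/
def orth {n : ℕ} (ε : Fin n → ℝ) : Subgroup (GL (Idx n) ℝ) where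
  carrier := {g | (g : Matrix (Idx n) (Idx n) ℝ)ᵀ * quadMat ε * g = quadMat ε}
  mul_mem' := by
    intro a b ha hb
    simp only [Set.mem_ofPred_eq, Units.val_mul, Matrix.transpose_mul] at *
    calc _ = (b : Matrix (Idx n) (Idx n) ℝ)ᵀ *
          ((a : Matrix (Idx n) (Idx n) ℝ)ᵀ * quadMat ε * a) * b := by simp only [Matrix.mul_assoc]
      _ = _ := by rw [ha, hb]
  one_mem' := by simp
  inv_mem' := by
    intro a ha
    simp only [Set.mem_ofPred_eq] at *
    have h1 : (a : Matrix (Idx n) (Idx n) ℝ) * (a⁻¹ : GL (Idx n) ℝ).1 = 1 := by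
      rw [← Units.val_mul, mul_inv_cancel, Units.val_one]
    generalize (a⁻¹ : GL (Idx n) ℝ).1 = b at *
    calc bᵀ * quadMat ε * b = bᵀ * ((a : Matrix (Idx n) (Idx n) ℝ)ᵀ * quadMat ε * a) * b := by
          rw [ha]
      _ = ((a : Matrix (Idx n) (Idx n) ℝ) * b)ᵀ * quadMat ε *
          ((a : Matrix (Idx n) (Idx n) ℝ) * b) := by
            simp only [Matrix.mul_assoc, Matrix.transpose_mul]
      _ = _ := by rw [h1]; simp

/-- `G = SO_o(p,q)`: the identity component of `O(p,q)`. -/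
def grpG {n : ℕ} (ε : Fin n → ℝ) : Subgroup (GL (Idx n) ℝ) :=
  (Subgroup.connectedComponentOfOne (orth ε)).map (orth ε).subtype

/-- `G' = SO_o(p,q-1)`, realized as the subgroup of `G` that fixes the basis vector `e_n`
(here `n = m + 1`). -/
def grpG' {m : ℕ} (ε : Fin (m + 1) → ℝ) : Subgroup (GL (Idx (m + 1)) ℝ) :=
  grpG ε ⊓
  { carrier := {g | (g : Matrix (Idx (m + 1)) (Idx (m + 1)) ℝ) *ᵥ
      Pi.single (im (Fin.last m)) 1 = Pi.single (im (Fin.last m)) 1}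
    mul_mem' := by
      intro a b ha hb
      simp only [Set.mem_ofPred_eq, Units.val_mul] at *
      rw [← Matrix.mulVec_mulVec, hb, ha]
    one_mem' := Matrix.one_mulVec _
    inv_mem' := by
      intro a ha
      simp only [Set.mem_ofPred_eq] at *
      conv_lhs => rw [← ha]
      rw [Matrix.mulVec_mulVec, ← Units.val_mul, inv_mul_cancel, Units.val_one,
        Matrix.one_mulVec] }

lemma nbarGL_mem {n : ℕ} (ε X : Fin n → ℝ) : nbarGL ε X ∈ grpG ε := by
  have hO : ∀ Y, nbarGL ε Y ∈ orth ε := fun Y => nbar_quad ε Y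
  have hc : ∀ Y : ℝ → Fin n → ℝ, Continuous Y → Continuous fun t => nbar ε (Y t) := by
    intro Y hY
    refine continuous_matrix fun a b => ?_
    have hY' : ∀ i, Continuous fun t => Y t i := fun i => (continuous_apply i).comp hY
    rcases a with a | a | a <;> rcases b with b | b | b <;> simp only [nbar, normSq] <;> fun_prop
  have hcont : Continuous fun t : ℝ => (⟨nbarGL ε (t • X), hO _⟩ : orth ε) := by
    refine Continuous.subtype_mk (Units.continuous_iff.2 ⟨?_, ?_⟩) _
    · exact hc (fun t => t • X) (by fun_prop)
    · exact hc (fun t => -(t • X)) (by fun_prop)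
  refine ⟨⟨nbarGL ε X, hO X⟩, ?_, rfl⟩
  have h := (isPreconnected_univ.image _ hcont.continuousOn).subset_connectedComponent
    (x := (1 : orth ε)) ⟨0, trivial, by
      apply Subtype.ext; apply Units.ext
      simpa [nbarGL] using nbar_zero ε⟩
  exact h ⟨1, trivial, by simp⟩

/-- The inclusion `ℝ^{n-1} → ℝⁿ`, `x' ↦ (x', 0)`. -/
def incl {m : ℕ} (x : Fin m → ℝ) : Fin (m + 1) → ℝ := Fin.snoc x 0

lemma nbarGL_mem' {m : ℕ} (ε : Fin (m + 1) → ℝ) (x : Fin m → ℝ) :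
    nbarGL ε (incl x) ∈ grpG' ε := by
  refine ⟨nbarGL_mem ε _, ?_⟩
  change nbar ε (incl x) *ᵥ Pi.single (im (Fin.last m)) 1 = Pi.single (im (Fin.last m)) 1
  ext a
  rcases a with a | a | a <;>
    simp [nbar, incl, Matrix.col, Pi.single_apply]

/-! ## Induced representations -/

section Induced

variable {n : ℕ} {E : Type*} [AddCommGroup E] [Module ℂ E]

/-- A complex function on a subgroup `H ⊆ GL` is smooth: near every point of `H` it is the
restriction of a smooth function of the matrix entries. -/
def SmoothOnGrp (H : Subgroup (GL (Idx n) ℝ)) (F : H → ℂ) : Prop :=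
  ∀ g₀ : H, ∃ U : Set (Idx n → Idx n → ℝ), IsOpen U ∧ (fun a b => g₀.1.1 a b) ∈ U ∧
    ∃ Φ : (Idx n → Idx n → ℝ) → ℂ, ContDiffOn ℝ ∞ Φ U ∧
      ∀ g : H, (fun a b => g.1.1 a b) ∈ U → F g = Φ (fun a b => g.1.1 a b)

/-- `g` stabilizes the line spanned by `e_0`. -/
def StabLine (g : GL (Idx n) ℝ) : Prop := ∀ a : Idx n, a ≠ i0 → g.1 a i0 = 0

/-- The unnormalized induced representation `Ind_{P_H}^H(W)`, where `P_H ⊆ H` is the isotropy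
subgroup of the line `ℝ e_0`, `W ⊆ E`, and `r p : E → E` is the action of `p⁻¹`: the smooth
functions `F : H → W` with `F(gp) = p⁻¹ · F(g)`. -/
def Ind (H : Subgroup (GL (Idx n) ℝ)) (W : Submodule ℂ E) (r : GL (Idx n) ℝ → E →ₗ[ℂ] E) :
    Submodule ℂ (H → E) where
  carrier := {F | (∀ g, F g ∈ W) ∧ (∀ l : Module.Dual ℂ E, SmoothOnGrp H fun g => l (F g)) ∧
    ∀ g p : H, StabLine p.1 → F (g * p) = r p.1 (F g)}
  zero_mem' := by
    refine ⟨fun g => W.zero_mem, fun l g₀ => ⟨Set.univ, isOpen_univ, trivial, 0, ?_, ?_⟩, ?_⟩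
    · exact contDiffOn_const
    · simp
    · simp
  add_mem' := by
    rintro F F' ⟨h1, h2, h3⟩ ⟨h1', h2', h3'⟩
    refine ⟨fun g => W.add_mem (h1 g) (h1' g), fun l g₀ => ?_, fun g p hp => ?_⟩
    · obtain ⟨U, hU, hg, Φ, hΦ, e⟩ := h2 l g₀
      obtain ⟨U', hU', hg', Φ', hΦ', e'⟩ := h2' l g₀
      refine ⟨U ∩ U', hU.inter hU', ⟨hg, hg'⟩, Φ + Φ',
        (hΦ.mono Set.inter_subset_left).add (hΦ'.mono Set.inter_subset_right), fun g hh => ?_⟩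
      simp [e g hh.1, e' g hh.2]
    · simp [h3 g p hp, h3' g p hp]
  smul_mem' := by
    rintro c F ⟨h1, h2, h3⟩
    refine ⟨fun g => W.smul_mem c (h1 g), fun l g₀ => ?_, fun g p hp => ?_⟩
    · obtain ⟨U, hU, hg, Φ, hΦ, e⟩ := h2 l g₀
      refine ⟨U, hU, hg, fun x => c * Φ x, contDiffOn_const.mul hΦ, fun g hh => ?_⟩
      simp [e g hh]
    · simp [h3 g p hp]

/-- The representation of `H` on `Ind_{P_H}^H(W)` by left translations,
`(h · F)(g) = F(h⁻¹ g)`. -/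
def translate {H : Subgroup (GL (Idx n) ℝ)} {W : Submodule ℂ E} {r : GL (Idx n) ℝ → E →ₗ[ℂ] E}
    (h : H) (F : Ind H W r) : Ind H W r :=
  ⟨fun g => F.1 (h⁻¹ * g), by
    obtain ⟨F, h1, h2, h3⟩ := F
    refine ⟨fun g => h1 _, fun l g₀ => ?_, fun g p hp => ?_⟩
    · obtain ⟨U, hU, hg, Φ, hΦ, e⟩ := h2 l (h⁻¹ * g₀)
      have hL : ContDiff ℝ ∞ fun (x : Idx n → Idx n → ℝ) a b =>
          ∑ c, ((h⁻¹ : H).1.1 a c) * x c b := by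
        refine contDiff_pi.2 fun a => contDiff_pi.2 fun b => ?_
        fun_prop
      refine ⟨_, hU.preimage hL.continuous, ?_, _, hΦ.comp hL.contDiffOn fun x hx => hx,
        fun g hh => ?_⟩
      · exact hg
      · exact e (h⁻¹ * g) hh
    · have := h3 (h⁻¹ * g) p hp
      rw [mul_assoc] at this
      exact this⟩

/-- The multiplier `(sgn c)^δ |c|^{-μ}`: for `p ∈ P` with `p e_0 = c e_0`, i.e. `c = ε(m) a`, it is
the action of `p⁻¹` on the one-dimensional representation `sgn^δ ⊗ ℂ_μ`,
`p ↦ ε(m)^δ a^μ`. -/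
def chi (μ : ℂ) (δ : ℕ) (c : ℝ) : ℂ := ((Real.sign c : ℝ) : ℂ) ^ δ * ((|c| : ℝ) : ℂ) ^ (-μ)

/-- `Ind_{P_H}^H(sgn^δ ⊗ ℂ_μ)`. -/
abbrev IndLine (H : Subgroup (GL (Idx n) ℝ)) (μ : ℂ) (δ : ℕ) : Submodule ℂ (H → ℂ) :=
  Ind H ⊤ fun p => chi μ δ (p.1 i0 i0) • LinearMap.id

end Induced

/-! ## Polynomials -/

open MvPolynomial

/-- The operator `∑ ε_i ∂²/∂ξ_i²` on polynomials. -/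
def boxPoly {n : ℕ} (ε : Fin n → ℝ) (P : MvPolynomial (Fin n) ℂ) : MvPolynomial (Fin n) ℂ :=
  ∑ i, (ε i : ℂ) • pderiv i (pderiv i P)

/-- The space `𝓗^j` of harmonic polynomials, homogeneous of degree `j`. -/
def Harm {n : ℕ} (ε : Fin n → ℝ) (j : ℕ) : Submodule ℂ (MvPolynomial (Fin n) ℂ) where
  carrier := {P | P.IsHomogeneous j ∧ boxPoly ε P = 0}
  zero_mem' := ⟨isHomogeneous_zero _ _ _, by simp [boxPoly]⟩
  add_mem' := by
    rintro P Q ⟨h1, h2⟩ ⟨h1', h2'⟩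
    refine ⟨h1.add h1', ?_⟩
    simp only [boxPoly, map_add, smul_add, Finset.sum_add_distrib] at *
    rw [h2, h2', add_zero]
  smul_mem' := by
    rintro c P ⟨h1, h2⟩
    refine ⟨(homogeneousSubmodule (Fin n) ℂ j).smul_mem c h1, ?_⟩
    simp only [boxPoly, Derivation.map_smul] at *
    simp only [smul_comm _ c, ← Finset.smul_sum, h2, smul_zero]

/-- The linear substitution `P ↦ P(A ·)`. -/
def substPoly {n : ℕ} (A : Matrix (Fin n) (Fin n) ℝ) :
    MvPolynomial (Fin n) ℂ →ₐ[ℂ] MvPolynomial (Fin n) ℂ :=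
  aeval fun i => ∑ k, C (A i k : ℂ) * X k

/-- `|X|² = ∑ ε_i X_i²` as a polynomial. -/
def normSqPoly {n : ℕ} (ε : Fin n → ℝ) : MvPolynomial (Fin n) ℂ :=
  ∑ i, C (ε i : ℂ) * X i ^ 2

/-- The bilinear pairing `h(∂)T` of polynomials of the same degree. -/
def pairPoly {n : ℕ} (h T : MvPolynomial (Fin n) ℂ) : ℂ :=
  ∑ α ∈ h.support, ((∏ i, (α i).factorial : ℕ) : ℂ) * coeff α h * coeff α T

/-- The block `m' ∈ SO(p-1,q-2)` of an element `p ∈ P' = P ∩ G'`. -/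
def blockM' {m : ℕ} (g : GL (Idx (m + 1)) ℝ) : Matrix (Fin m) (Fin m) ℝ := fun i j =>
  g.1 (im i.castSucc) (im j.castSucc)

/-- The action of `p⁻¹`, `p ∈ P'`, on `sgn^δ ⊗ 𝓗^j(ℝ^{p-1,q-2}) ⊗ ℂ_μ`, where `SO(p-1,q-2)` acts
naturally on `𝓗^j(ℝ^{p-1,q-2})`: `h ↦ (sgn c)^δ |c|^{-μ} h(m' ·)`. -/
abbrev actHarm {m : ℕ} (μ : ℂ) (δ : ℕ) (p : GL (Idx (m + 1)) ℝ) :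
    MvPolynomial (Fin m) ℂ →ₗ[ℂ] MvPolynomial (Fin m) ℂ :=
  chi μ δ (p.1 i0 i0) • (substPoly (blockM' p)).toLinearMap

/-! ## Differential operators on `C^∞(ℝⁿ)` -/

/-- `∂/∂x_i`. -/
def pd {n : ℕ} (i : Fin n) (f : (Fin n → ℝ) → ℂ) : (Fin n → ℝ) → ℂ :=
  fun x => fderiv ℝ f x (Pi.single i 1)

/-- `∂^α` for a multi-index `α`. -/
def pdMulti {n : ℕ} (α : Fin n → ℕ) (f : (Fin n → ℝ) → ℂ) : (Fin n → ℝ) → ℂ :=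
  (List.finRange n).foldr (fun i u => (pd i)^[α i] u) f

/-- The constant coefficient operator `P(∂/∂x)`. -/
def polyOp {n : ℕ} (P : MvPolynomial (Fin n) ℂ) (f : (Fin n → ℝ) → ℂ) : (Fin n → ℝ) → ℂ :=
  fun x => ∑ α ∈ P.support, coeff α P * pdMulti α f x

/-- The operator `□' = ∑_{i<n} ε_i ∂²/∂x_i²` on functions of `x ∈ ℝⁿ`, `n = m + 1`. -/
def box' {m : ℕ} (ε : Fin (m + 1) → ℝ) (f : (Fin (m + 1) → ℝ) → ℂ) : (Fin (m + 1) → ℝ) → ℂ :=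
  fun x => ∑ i : Fin m, (ε i.castSucc : ℂ) * pd i.castSucc (pd i.castSucc f) x

/-- The coefficients `a_j(λ) = a_j^{N,n}(λ)`. -/
def aCoef (n N j : ℕ) (lam : ℂ) : ℂ :=
  (-2) ^ (N - j) * (N.factorial : ℂ) / ((j.factorial : ℂ) * ((2 * N - 2 * j).factorial : ℂ)) *
    ∏ k ∈ Finset.Ico j N, (2 * lam - 4 * N + 2 * k + n + 1)

/-- The coefficients `b_j(λ) = b_j^{N,n}(λ)`. -/
def bCoef (n N j : ℕ) (lam : ℂ) : ℂ :=
  (-2) ^ (N - j) * (N.factorial : ℂ) / ((j.factorial : ℂ) * ((2 * N - 2 * j + 1).factorial : ℂ)) *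
    ∏ k ∈ Finset.Ico j N, (2 * lam - 4 * N + 2 * k + n - 1)

/-- `D_{2N}(λ) = ∑_j a_j(-λ) (-□')^j (∂/∂x_n)^{2N-2j}`. -/
def Deven {m : ℕ} (ε : Fin (m + 1) → ℝ) (N : ℕ) (lam : ℂ) (f : (Fin (m + 1) → ℝ) → ℂ) :
    (Fin (m + 1) → ℝ) → ℂ :=
  fun x => ∑ j ∈ Finset.range (N + 1), aCoef (m + 1) N j (-lam) *
    ((fun u => -box' ε u)^[j] ((pd (Fin.last m))^[2 * N - 2 * j] f)) x

/-- `D_{2N+1}(λ) = ∑_j b_j(-λ) (-□')^j (∂/∂x_n)^{2N-2j+1}`. -/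
def Dodd {m : ℕ} (ε : Fin (m + 1) → ℝ) (N : ℕ) (lam : ℂ) (f : (Fin (m + 1) → ℝ) → ℂ) :
    (Fin (m + 1) → ℝ) → ℂ :=
  fun x => ∑ j ∈ Finset.range (N + 1), bCoef (m + 1) N j (-lam) *
    ((fun u => -box' ε u)^[j] ((pd (Fin.last m))^[2 * N - 2 * j + 1] f)) x

/-- Restriction to `x_n = 0`. -/
def restr {m : ℕ} (f : (Fin (m + 1) → ℝ) → ℂ) : (Fin m → ℝ) → ℂ := fun x => f (incl x)

/-- `D_K(λ)` for an arbitrary `K`. -/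
def juhlD {m : ℕ} (ε : Fin (m + 1) → ℝ) (K : ℕ) (lam : ℂ) (f : (Fin (m + 1) → ℝ) → ℂ) :
    (Fin (m + 1) → ℝ) → ℂ :=
  if K % 2 = 0 then Deven ε (K / 2) lam f else Dodd ε (K / 2) lam f

/-- `D` is a constant coefficient differential operator of order (exactly) `K` on `C^∞(ℝⁿ)`. -/
def IsDiffOpOfOrder {n : ℕ} (K : ℕ) (D : ((Fin n → ℝ) → ℂ) → (Fin n → ℝ) → ℂ) : Prop :=
  ∃ P : MvPolynomial (Fin n) ℂ, P ≠ 0 ∧ P.totalDegree = K ∧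
    ∀ f, ContDiff ℝ ∞ f → D f = polyOp P f

/-! ## The infinitesimal representation in the non-compact picture -/

/-- `(π_{μ}(g⁻¹) f)(x)` in the non-compact picture: write `g · exp x = exp x̃ · p` with `p ∈ P`;
with `c = (g · exp x)_{00} = p_{00}` the coordinates of `x̃` are `(g · exp x)_{i0} / c`, and
the value is `p⁻¹ · f(x̃)`. -/
def pull {n : ℕ} (ε : Fin n → ℝ) (μ : ℂ) (g : Matrix (Idx n) (Idx n) ℝ)
    (f : (Fin n → ℝ) → ℂ) (x : Fin n → ℝ) : ℂ :=
  chi μ 0 ((g * nbar ε x) i0 i0) *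
    f fun i => (g * nbar ε x) (im i) i0 / (g * nbar ε x) i0 i0

/-- `dπ_μ(A) f` for a real matrix `A`: the derivative of `π_μ(exp(tA)) f` at `t = 0`. -/
def dpiR {n : ℕ} (ε : Fin n → ℝ) (μ : ℂ) (A : Matrix (Idx n) (Idx n) ℝ)
    (f : (Fin n → ℝ) → ℂ) : (Fin n → ℝ) → ℂ :=
  fun x => deriv (fun t : ℝ => pull ε μ (NormedSpace.exp (-(t • A))) f x) 0

/-- The complex linear extension of `dπ_μ` to the complexified Lie algebra. -/
def dpi {n : ℕ} (ε : Fin n → ℝ) (μ : ℂ) (A : Matrix (Idx n) (Idx n) ℂ)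
    (f : (Fin n → ℝ) → ℂ) : (Fin n → ℝ) → ℂ :=
  fun x => dpiR ε μ (A.map Complex.re) f x + Complex.I * dpiR ε μ (A.map Complex.im) f x

attribute [local instance] LieRing.ofAssociativeRing

/-- The complexified Lie algebra `𝔤 = 𝔰𝔬(p,q) ⊗ ℂ`. -/
abbrev lieG {n : ℕ} (ε : Fin n → ℝ) : LieSubalgebra ℂ (Matrix (Idx n) (Idx n) ℂ) :=
  skewAdjointMatricesLieSubalgebra ((quadMat ε).map Complex.ofReal)

/-- `A ∈ 𝔤` belongs to `𝔤'`, i.e. it annihilates `e_n`. -/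
def InG' {m : ℕ} (A : Matrix (Idx (m + 1)) (Idx (m + 1)) ℂ) : Prop :=
  ∀ a, A a (im (Fin.last m)) = 0

/-- An element of `𝔤'` as a matrix of size `n + 1`, acting on the span of
`e_0, …, e_{n-1}, e_{n+1}`. -/
def toSmall {m : ℕ} (A : Matrix (Idx (m + 1)) (Idx (m + 1)) ℂ) : Matrix (Idx m) (Idx m) ℂ :=
  A.submatrix (Sum.map id (Sum.map Fin.castSucc id)) (Sum.map id (Sum.map Fin.castSucc id))

/-- `𝓓 dπ^G_λ(A) = dπ^{G'}_ν(A) 𝓓` for all `A ∈ 𝔤'`. -/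
def InfIntertwines {m : ℕ} (ε : Fin (m + 1) → ℝ) (lam ν : ℂ)
    (D : ((Fin (m + 1) → ℝ) → ℂ) → (Fin m → ℝ) → ℂ) : Prop :=
  ∀ A ∈ lieG ε, InG' A → ∀ f, ContDiff ℝ ∞ f →
    D (dpi ε lam A f) = dpi (fun i => ε i.castSucc) ν (toSmall A) (D f)

/-! ## Equivariance for the group `G'` -/

/-- `β : Ind_P^G(sgn^δ ⊗ ℂ_λ) → C^∞(ℝⁿ)`, restriction to `N_-`. -/
def beta {n : ℕ} {ε : Fin n → ℝ} {lam : ℂ} {δ : ℕ} (F : IndLine (grpG ε) lam δ) :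
    (Fin n → ℝ) → ℂ :=
  fun x => F.1 ⟨nbarGL ε x, nbarGL_mem ε x⟩

/-- `β'`, restriction of sections over `G'` to `N'_-`. -/
def beta' {m : ℕ} {ε : Fin (m + 1) → ℝ} {E : Type*} [AddCommGroup E] [Module ℂ E]
    {W : Submodule ℂ E} {r : GL (Idx (m + 1)) ℝ → E →ₗ[ℂ] E} (F : Ind (grpG' ε) W r) :
    (Fin m → ℝ) → E :=
  fun x => F.1 ⟨nbarGL ε (incl x), nbarGL_mem' ε x⟩

/-- An element of `G'` as an element of `G`. -/
def inclG {m : ℕ} {ε : Fin (m + 1) → ℝ} (g : grpG' ε) : grpG ε := ⟨g.1, g.2.1⟩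

/-- The operator `𝓓`, given in the non-compact picture, is (the restriction of) a `G'`-equivariant
operator `Ind_P^G(sgn^δ ⊗ ℂ_λ) → Ind_{P'}^{G'}(W)`. -/
def GrpEquivariant {m : ℕ} (ε : Fin (m + 1) → ℝ) (lam : ℂ) (δ : ℕ)
    {E : Type*} [AddCommGroup E] [Module ℂ E]
    (W : Submodule ℂ E) (r : GL (Idx (m + 1)) ℝ → E →ₗ[ℂ] E)
    (D : ((Fin (m + 1) → ℝ) → ℂ) → (Fin m → ℝ) → E) : Prop :=
  ∃ T : IndLine (grpG ε) lam δ →ₗ[ℂ] Ind (grpG' ε) W r,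
    (∀ (g : grpG' ε) F, T (translate (inclG g) F) = translate g (T F)) ∧
    ∀ F, beta' (T F) = D (beta F)

/-- The same for an operator `B` between sections over `G'/P'`, from
`Ind_{P'}^{G'}(sgn^δ ⊗ ℂ_ν)` to `Ind_{P'}^{G'}(W)`. -/
def GrpEquivariant' {m : ℕ} (ε : Fin (m + 1) → ℝ) (ν : ℂ) (δ : ℕ)
    {E : Type*} [AddCommGroup E] [Module ℂ E]
    (W : Submodule ℂ E) (r : GL (Idx (m + 1)) ℝ → E →ₗ[ℂ] E)
    (B : ((Fin m → ℝ) → ℂ) → (Fin m → ℝ) → E) : Prop :=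
  ∃ T : IndLine (grpG' ε) ν δ →ₗ[ℂ] Ind (grpG' ε) W r,
    (∀ (g : grpG' ε) F, T (translate g F) = translate g (T F)) ∧
    ∀ F, beta' (T F) = B (beta' F)

/-! ## Generalized Verma modules and singular vectors -/

/-- The left ideal of `U(𝔤)` generated by `Y - μ(Y)`, `Y ∈ 𝔭`, where `μ` denotes the character
`Y ↦ μ Y_{00}` of the stabilizer `𝔭` of the line spanned by `e_0`. -/
def vermaIdeal {n : ℕ} (ε : Fin n → ℝ) (μ : ℂ) :
    Submodule (UniversalEnvelopingAlgebra ℂ (lieG ε)) (UniversalEnvelopingAlgebra ℂ (lieG ε)) :=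
  Submodule.span _ {u | ∃ Y : lieG ε, (∀ a : Idx n, a ≠ i0 → Y.1 a i0 = 0) ∧
    u = UniversalEnvelopingAlgebra.ι ℂ Y - algebraMap ℂ _ (μ * Y.1 i0 i0)}

/-- The generalized Verma module `M_𝔭^𝔤(μ) = U(𝔤) ⊗_{U(𝔭)} ℂ_μ`. -/
abbrev Verma {n : ℕ} (ε : Fin n → ℝ) (μ : ℂ) : Type :=
  UniversalEnvelopingAlgebra ℂ (lieG ε) ⧸ vermaIdeal ε μ

/-- The pairing of `M_𝔭^𝔤(ℂ_λ^∨) = M_𝔭^𝔤(-λ)` with `C^∞(ℝⁿ)`: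
`⟨u ⊗ 1, f⟩ = (dπ_λ(u°) f)(0)`, where `°` is the antiautomorphism of `U(𝔤)` with `X° = -X`. On
a product, `(X_1 ⋯ X_r)° = (-1)^r X_r ⋯ X_1`, so that `X_1` acts first on `f`. -/
def IsVermaPairing {n : ℕ} (ε : Fin n → ℝ) (lam : ℂ)
    (φ : Verma ε (-lam) →ₗ[ℂ] (((Fin n → ℝ) → ℂ) → ℂ)) : Prop :=
  ∀ (L : List (lieG ε)) (f : (Fin n → ℝ) → ℂ), ContDiff ℝ ∞ f →
    φ (Submodule.Quotient.mk ((L.map (UniversalEnvelopingAlgebra.ι ℂ)).prod)) f =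
      (-1) ^ L.length * (L.foldl (fun u A => dpi ε lam A.1 u) f) 0

/-- `s ∈ M_𝔭^𝔤(μ)^{𝔫'_+}`: `s` is annihilated by `𝔫'_+ = 𝔫_+ ∩ 𝔤'`. -/
def IsSingular {m : ℕ} (ε : Fin (m + 1) → ℝ) (μ : ℂ) (s : Verma ε μ) : Prop :=
  ∀ (Y : lieG ε) (Z : Fin (m + 1) → ℂ), Z (Fin.last m) = 0 → Y.1 = nplus ε Z →
    UniversalEnvelopingAlgebra.ι ℂ Y • s = 0

/-- `s` is the vector `φ(w)` that corresponds to the polynomial `w` in the F-method: the Fourier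
transform `ξ ↦ ⟨s, e^{i⟨x,ξ⟩}⟩` of the distribution defined by `s` is `w`. -/
def HasSymbol {n : ℕ} {ε : Fin n → ℝ} {lam : ℂ}
    (φ : Verma ε (-lam) →ₗ[ℂ] (((Fin n → ℝ) → ℂ) → ℂ)) (s : Verma ε (-lam))
    (w : MvPolynomial (Fin n) ℂ) : Prop :=
  ∀ ξ : Fin n → ℝ, φ s (fun x => Complex.exp (Complex.I * ∑ i, (x i : ℂ) * (ξ i : ℂ))) =
    eval (fun i => (ξ i : ℂ)) w

/-- The coefficient of `t^k` in the polynomial `𝒞̃_K^α(-t)` attached to the renormalized Gegenbauer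
polynomial `(α)_{[(K+1)/2]}⁻¹ C_K^α`; the quotient `Γ(K-k+α) / Γ(α+[(K+1)/2])` is written as
a product, so that it makes sense for every `α`. -/
def gegenCoef (K : ℕ) (α : ℂ) (k : ℕ) : ℂ :=
  (∏ i ∈ Finset.Ico ((K + 1) / 2) (K - k), (α + i)) * 2 ^ (K - 2 * k) /
    ((k.factorial : ℂ) * ((K - 2 * k).factorial : ℂ))

/-- The polynomial `w_{K,λ}`: with `α = -λ - (n-1)/2` and `t = ε_n |ξ'|² / ξ_n²` it is
`N! ξ_n^K 𝒞̃_K^α(-t)` for `K = 2N`, and one half of this for `K = 2N + 1`. -/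
def wPoly {m : ℕ} (ε : Fin (m + 1) → ℝ) (K : ℕ) (lam : ℂ) : MvPolynomial (Fin (m + 1)) ℂ :=
  C (((K / 2).factorial : ℂ) / (if K % 2 = 0 then 1 else 2)) *
    ∑ k ∈ Finset.range (K / 2 + 1), C (gegenCoef K (-lam - (m : ℂ) / 2) k) *
      (C (ε (Fin.last m) : ℂ) *
        rename Fin.castSucc (normSqPoly fun i : Fin m => ε i.castSucc)) ^ k *
      X (Fin.last m) ^ (K - 2 * k)

/-! ## First BGG operators -/

/-- The `j`-fold gradient `∇_{a_1} ⋯ ∇_{a_j} σ` at `x`, as the homogeneous polynomial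
`X ↦ ∑ ∂_{a_1} ⋯ ∂_{a_j} σ(x) X_{a_1} ⋯ X_{a_j}`. -/
def gradPoly {m : ℕ} (j : ℕ) (σ : (Fin m → ℝ) → ℂ) (x : Fin m → ℝ) : MvPolynomial (Fin m) ℂ :=
  ∑ a : Fin j → Fin m,
    C ((List.ofFn a).foldr (fun i u => pd i u) σ x) * ∏ k, X (a k)

/-- `T` is the trace-free part of the symmetric tensor (homogeneous polynomial) `S`. -/
def IsTraceFreePart {m : ℕ} (ε : Fin m → ℝ) (j : ℕ) (S T : MvPolynomial (Fin m) ℂ) : Prop :=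
  T ∈ Harm ε j ∧ ∃ Q, S = T + normSqPoly ε * Q

/-- `B` is, in the non-compact picture, the first BGG operator of order `j ≥ 1`, attached to the
`G'`-module of symmetric traceless powers of order `j - 1` of the defining representation `ℂ^{n+1}`:
* `B σ` is the symmetric trace-free part of the `j`-fold gradient of `σ`, and it is smooth;
* `B` is `G'`-equivariant from `Ind(ℂ_{1-j})` to `Ind(𝓗^j ⊗ ℂ_1)` (up to signs on the
  non-identity component of `M'`);
* `B` annihilates the image of that `G'`-module in `C^∞(ℝ^{n-1})`; this image consists of the
  functions `x' ↦ P(exp(x') e_0)`, where `P` is a homogeneous polynomial of degree `j - 1` on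
  the ambient space (only its harmonic part matters on the null cone). -/
def IsFirstBGG {m : ℕ} (ε : Fin (m + 1) → ℝ) (j : ℕ)
    (B : ((Fin m → ℝ) → ℂ) → (Fin m → ℝ) → MvPolynomial (Fin m) ℂ) : Prop :=
  (∀ σ, ContDiff ℝ ∞ σ → ∀ x,
    IsTraceFreePart (fun i => ε i.castSucc) j (gradPoly j σ x) (B σ x)) ∧
  (∀ σ, ContDiff ℝ ∞ σ → ∀ α, ContDiff ℝ ∞ fun x => coeff α (B σ x)) ∧
  (∀ δ : ℕ, GrpEquivariant' ε (1 - j) δ (Harm (fun i => ε i.castSucc) j)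
    (actHarm 1 (δ + j)) B) ∧
  ∀ P : MvPolynomial (Idx m) ℂ, P.IsHomogeneous (j - 1) →
    B (fun x => eval (fun a => (nbar (fun i => ε i.castSucc) x a i0 : ℂ)) P) = 0

/-- `O(p-1,q-2)`: the matrices that preserve `∑ ε_i X_i²`. -/
def OrthSmall {m : ℕ} (ε : Fin m → ℝ) (k : Matrix (Fin m) (Fin m) ℝ) : Prop :=
  kᵀ * Matrix.diagonal ε * k = Matrix.diagonal ε

/-- `k ↦ k ⊕ 1`, from `O(p-1,q-2)` to `O(p-1,q-1)`. -/
def extendOne {m : ℕ} (k : Matrix (Fin m) (Fin m) ℝ) : Matrix (Fin (m + 1)) (Fin (m + 1)) ℝ :=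
  fun i j => Fin.lastCases (motive := fun _ => ℝ)
    (Fin.lastCases (motive := fun _ => ℝ) 1 (fun _ => 0) j)
    (fun i' => Fin.lastCases (motive := fun _ => ℝ) 0 (fun j' => k i' j') j) i

/-- `ι` embeds `𝓗^j(ℝ^{p-1,q-2})` into `𝓗^d(ℝ^{p-1,q-1})` equivariantly for `O(p-1,q-2)`; its
image is the summand `𝓗^j(ℝ^{p-1,q-2})` of the (multiplicity-free) restriction. -/
def IsSummandEmbedding {m : ℕ} (ε : Fin (m + 1) → ℝ) (j d : ℕ)
    (ι : Harm (fun i => ε i.castSucc) j →ₗ[ℂ] Harm ε d) : Prop :=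
  Function.Injective ι ∧
  ∀ k, OrthSmall (fun i => ε i.castSucc) k → ∀ h h' : Harm (fun i => ε i.castSucc) j,
    h'.1 = substPoly k h.1 → (ι h').1 = substPoly (extendOne k) (ι h).1

/-! ## The two parts of the result as predicates -/

/-- `𝓓 = restr ∘ D` is the operator of degree `K` induced by the singular vector `φ(w_{K,-λ})`:
`D` is a differential operator of order `K`; `𝓓` maps `C^∞(ℝⁿ)` to `C^∞(ℝ^{n-1})`;
`φ(w_{K,-λ})` is a singular vector and `(𝓓 f)(0) = i^K ⟨φ(w_{K,-λ}), f⟩`;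
`𝓓` is `G'`-equivariant, from `Ind_P^G(sgn^δ ⊗ ℂ_λ)` to
`Ind_{P'}^{G'}(sgn^{δ+K} ⊗ ℂ_{λ+K})`; and it intertwines `dπ^G_λ` and `dπ^{G'}_{λ+K}`. -/
def IsCovariantFamilyMember {m : ℕ} (ε : Fin (m + 1) → ℝ) (lam : ℂ)
    (φ : Verma ε (-lam) →ₗ[ℂ] (((Fin (m + 1) → ℝ) → ℂ) → ℂ)) (K : ℕ)
    (D : ((Fin (m + 1) → ℝ) → ℂ) → (Fin (m + 1) → ℝ) → ℂ) : Prop :=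
  IsDiffOpOfOrder K D ∧
  (∀ f, ContDiff ℝ ∞ f → ContDiff ℝ ∞ (restr (D f))) ∧
  (∃ s : Verma ε (-lam), IsSingular ε (-lam) s ∧ HasSymbol φ s (wPoly ε K (-lam)) ∧
    ∀ f, ContDiff ℝ ∞ f → restr (D f) 0 = Complex.I ^ K * φ s f) ∧
  (∀ δ : ℕ, GrpEquivariant ε lam δ (⊤ : Submodule ℂ ℂ)
    (fun p => chi (lam + K) (δ + K) (p.1 i0 i0) • LinearMap.id) fun f => restr (D f)) ∧
  InfIntertwines ε lam (lam + K) fun f => restr (D f)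

/-- For `λ = -ℓ` and `1 ≤ j ≤ ℓ + 1`: the operator `𝓓_j = B ∘ 𝓓_{ℓ+1-j}(λ)`, with `B` the
first BGG operator of order `j`, is `G'`-equivariant and is induced by the space `φ(H'_j)` of
singular vectors. -/
def IsBGGMember {m : ℕ} (ε : Fin (m + 1) → ℝ) (lam : ℂ)
    (φ : Verma ε (-lam) →ₗ[ℂ] (((Fin (m + 1) → ℝ) → ℂ) → ℂ)) (l j : ℕ)
    (B : ((Fin m → ℝ) → ℂ) → (Fin m → ℝ) → MvPolynomial (Fin m) ℂ) : Prop :=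
  (∀ δ : ℕ, GrpEquivariant ε lam δ (Harm (fun i => ε i.castSucc) j)
    (actHarm 1 (δ + l + 1))
    fun f => B (restr (juhlD ε (l + 1 - j) lam f))) ∧
  ∃ ι : Harm (fun i => ε i.castSucc) j →ₗ[ℂ] Harm ε (l + 1),
    IsSummandEmbedding ε j (l + 1) ι ∧
    ∀ h : Harm (fun i => ε i.castSucc) j, ∃ s : Verma ε (-lam),
      IsSingular ε (-lam) s ∧ HasSymbol φ s (ι h).1 ∧
      ∀ f, ContDiff ℝ ∞ f → pairPoly h.1 (B (restr (juhlD ε (l + 1 - j) lam f)) 0) =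
        (j.factorial : ℂ) * Complex.I ^ (l + 1) * φ s f

end ConfCov

end

open scoped ContDiff Matrix

noncomputable section

namespace ConfCov

open MvPolynomial

attribute [local instance] LieRing.ofAssociativeRing

variable {n m k : ℕ}

/-! ## Evaluation of polynomials at commuting elements of an algebra -/

section CommutingEval

variable {σ A : Type*} [Ring A] [Algebra ℂ A]

/-! The proof is the F-method, with its equations solved by hand. The generators of `𝔫_-` act on
functions by `-∂_i`, so a vector of `M(-λ)` is a polynomial `P` in them and pairs with `f` to
`(P(∂)f)(0)` (`polyVec_surjective`, `vermaDual_polyVec`, `vermaDual_injective`). Whether a vector is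
singular can therefore be tested on functions. The `k`-th generator of `𝔫_+` acts by `sctC`: `f ↦ λ
x_k f + x_k E f - ε_k (|x|²/2) ∂_k f`, with `E` the Euler operator. Moving `w(∂)`, with `w`
homogeneous of degree `K`, across it (`dOp_sctC`) produces the same operator with `λ + K` for `λ`,
rotation terms with a factor `x_i`, and the constant coefficient operator with symbol `fPoly`,
namely `(λ + K - 1) ∂_k w - ½ ε_k ξ_k □w`. At the origin only the last one survives, so `φ(w)` is
singular as soon as `fPoly` vanishes for all `k < n`.

Two kinds of solutions occur. If `w` involves `ξ'` only through `|ξ'|²`, then `∂_k w = ε_k ξ_k g`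
for `k < n`, the rotation terms with `i < n` vanish, and all equations reduce to `□w = 2(λ + K - 1)
g`. On coefficients this is the two-term recursion of the Gegenbauer polynomials, which `w_{K,-λ}`
satisfies (`wCoef_succ`, `boxL_wPoly`). If `λ + K = 1`, every harmonic `w` of degree `K` is a
solution, both terms being zero (`fPoly_harm`). The two are linked by `rename_mul_wPoly_mem_harm`:
if `λ + K = 1 - j` and `h(ξ')` is harmonic of degree `j`, then `□(h w_{K,-λ}) = (2(λ + K - 1) + 2j)
h g = 0`. Hence `h ↦ h w_{K,-λ}` embeds `𝓗^j(ℝ^{p-1,q-2})` into `𝓗^{j+K}(ℝ^{p-1,q-1})`, and `h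
w_{K,-λ}` is the symbol of `B_j ∘ 𝓓_K(λ)` paired with `h`.

For the group, an operator is given by its value `op` at the base point and is put on sections by `g
↦ op(x ↦ F(g exp x))` (`CellData.opInd`). Left translations then commute with it by construction,
and only the law under right multiplication by `P'` is at stake. By the Langlands decomposition this
splits in two. Along `N'_+` the derivative of `t ↦ op(x ↦ F(g n(tz) exp x))` vanishes for every `t`,
which is the infinitesimal condition above. The Levi factor acts by the linear substitutions `x ↦
c⁻¹ m' x`, and homogeneity of degree `K` turns `c⁻¹` into the shift from `(λ, δ)` to `(λ + K, δ +
K)` (`chi_mul_pow`). No connectedness of `P'` is involved.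

The operator `B_j` is the harmonic projection of the gradient. The pairing `h(∂)T` is non-degenerate
on harmonic polynomials, so `B_j` is governed by the scalar operators `h(∂)` with `h` harmonic
(`pairL_bggOp`). These are covered by the second kind of solutions with `λ = 1 - j` and `K = j`, and
they annihilate the polynomials coming from the finite-dimensional module (`dOp_eq_zero_of_harm`).
-/

lemma isMulCommutative_adjoin_range (a : σ → A) (h : ∀ i j, a i * a j = a j * a i) :
    IsMulCommutative (Algebra.adjoin ℂ (Set.range a)) :=
  Algebra.isMulCommutative_adjoin ℂ (by rintro _ ⟨i, rfl⟩ _ ⟨j, rfl⟩; exact h i j)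

/-- Evaluation of a polynomial at a family of commuting elements. -/
def commEval (a : σ → A) (h : ∀ i j, a i * a j = a j * a i) : MvPolynomial σ ℂ →ₐ[ℂ] A :=
  -- The subalgebra generated by commuting elements is commutative, so the universal property of the
  -- polynomial ring applies inside it.
  haveI := isMulCommutative_adjoin_range a h
  letI : CommRing (Algebra.adjoin ℂ (Set.range a)) :=
    { (inferInstance : Ring (Algebra.adjoin ℂ (Set.range a))) with
      mul_comm := fun x y => mul_comm' x y }
  (Algebra.adjoin ℂ (Set.range a)).val.comp
    (aeval (R := ℂ) (S₁ := Algebra.adjoin ℂ (Set.range a))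
      fun i => ⟨a i, Algebra.subset_adjoin ⟨i, rfl⟩⟩)

@[simp] lemma commEval_X (a : σ → A) (h : ∀ i j, a i * a j = a j * a i) (i : σ) :
    commEval a h (X i) = a i := by
  simp [commEval]

end CommutingEval

/-! ## The algebra of smooth functions -/

/-- The algebra `C^∞(ℝⁿ)`. -/
def Cinf (n : ℕ) : Subalgebra ℂ ((Fin n → ℝ) → ℂ) where
  carrier := {f | ContDiff ℝ ∞ f}
  mul_mem' := by
    intro f g hf hg
    rw [Set.mem_ofPred_eq] at *
    exact hf.mul hg
  add_mem' := by
    intro f g hf hg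
    rw [Set.mem_ofPred_eq] at *
    exact hf.add hg
  algebraMap_mem' := by
    intro c
    rw [Set.mem_ofPred_eq]
    exact contDiff_const

lemma mem_Cinf {n : ℕ} {f : (Fin n → ℝ) → ℂ} : f ∈ Cinf n ↔ ContDiff ℝ ∞ f := Iff.rfl

lemma smooth_Cinf (f : Cinf n) : ContDiff ℝ ∞ f.1 := mem_Cinf.1 f.2

lemma diffAt_Cinf (f : Cinf n) (x : Fin n → ℝ) : DifferentiableAt ℝ f.1 x :=
  (smooth_Cinf f).differentiable (by simp) x

lemma contDiff_pd {f : (Fin n → ℝ) → ℂ} (hf : ContDiff ℝ ∞ f) (i : Fin n) :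
    ContDiff ℝ ∞ (pd i f) := by
  have : ContDiff ℝ ∞ (fderiv ℝ f) := hf.fderiv_right (by simp)
  exact this.clm_apply contDiff_const

/-- `∂/∂x_i` as a derivation of `C^∞(ℝⁿ)`. -/
def pdC (i : Fin n) : Derivation ℂ (Cinf n) (Cinf n) where
  toFun f := ⟨pd i f.1, mem_Cinf.2 (contDiff_pd (smooth_Cinf f) i)⟩
  map_add' f g := by
    ext x
    simp [pd, fderiv_add (diffAt_Cinf f x) (diffAt_Cinf g x)]
  map_smul' c f := by
    ext x
    simp [pd, fderiv_const_smul (diffAt_Cinf f x)]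
  map_one_eq_zero' := by
    ext x
    change fderiv ℝ (fun _ => (1 : ℂ)) x _ = 0
    simp
  leibniz' f g := by
    ext x
    change fderiv ℝ (fun y => f.1 y * g.1 y) x _ = _
    rw [fderiv_fun_mul (diffAt_Cinf f x) (diffAt_Cinf g x)]
    simp [pd]

@[simp] lemma pdC_coe (i : Fin n) (f : Cinf n) : (pdC i f).1 = pd i f.1 := rfl

lemma pdC_comm (i j : Fin n) (f : Cinf n) : pdC i (pdC j f) = pdC j (pdC i f) := by
  ext x
  have hs : IsSymmSndFDerivAt ℝ f.1 x :=
    (smooth_Cinf f).contDiffAt.isSymmSndFDerivAt (by simpa using (mod_cast le_top : ((2 : ℕ∞) : WithTop ℕ∞) ≤ ((⊤ : ℕ∞) : WithTop ℕ∞)))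
  have key : ∀ a b : Fin n, pd a (pd b f.1) x =
      fderiv ℝ (fderiv ℝ f.1) x (Pi.single a 1) (Pi.single b 1) := by
    intro a b
    have hd : DifferentiableAt ℝ (fderiv ℝ f.1) x :=
      (((smooth_Cinf f).fderiv_right (m := ∞) (by simp)).differentiable (by simp)) x
    unfold pd
    rw [fderiv_clm_apply hd (differentiableAt_const _)]
    simp
  simp only [pdC_coe, key]
  exact hs _ _

lemma pdC_toLinearMap_comm (i j : Fin n) :
    ((pdC i : Cinf n →ₗ[ℂ] Cinf n) : Module.End ℂ (Cinf n)) * (pdC j : Cinf n →ₗ[ℂ] Cinf n) =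
      (pdC j : Cinf n →ₗ[ℂ] Cinf n) * (pdC i : Cinf n →ₗ[ℂ] Cinf n) :=
  LinearMap.ext fun f => pdC_comm i j f

/-- The constant coefficient operator `P(∂/∂x)` on `C^∞(ℝⁿ)`. -/
def dOp : MvPolynomial (Fin n) ℂ →ₐ[ℂ] Module.End ℂ (Cinf n) :=
  commEval (fun i => ((pdC i : Cinf n →ₗ[ℂ] Cinf n) : Module.End ℂ (Cinf n)))
    pdC_toLinearMap_comm

@[simp] lemma dOp_X (i : Fin n) (f : Cinf n) : dOp (X i) f = pdC i f := by
  simp [dOp]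

lemma dOp_X_mul (i : Fin n) (P : MvPolynomial (Fin n) ℂ) (f : Cinf n) :
    dOp (X i * P) f = pdC i (dOp P f) := by simp

lemma dOp_mul_X (P : MvPolynomial (Fin n) ℂ) (i : Fin n) (f : Cinf n) :
    dOp (P * X i) f = dOp P (pdC i f) := by simp

lemma dOp_C (a : ℂ) (f : Cinf n) : dOp (C a) f = a • f := by
  have : (C a : MvPolynomial (Fin n) ℂ) = algebraMap ℂ _ a := rfl
  rw [this, AlgHom.commutes]; rfl

lemma dOp_C_mul (a : ℂ) (P : MvPolynomial (Fin n) ℂ) (f : Cinf n) :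
    dOp (C a * P) f = a • dOp P f := by
  rw [map_mul, Module.End.mul_apply, dOp_C]

lemma dOp_pdC (P : MvPolynomial (Fin n) ℂ) (i : Fin n) (f : Cinf n) :
    dOp P (pdC i f) = pdC i (dOp P f) := by
  rw [← dOp_mul_X, mul_comm, dOp_X_mul]

/-- The coordinate function `x_i`. -/
def xC (i : Fin n) : Cinf n :=
  ⟨fun x => (x i : ℂ), mem_Cinf.2 (Complex.ofRealCLM.contDiff.comp (contDiff_apply ℝ ℝ i))⟩

@[simp] lemma xC_apply (i : Fin n) (x : Fin n → ℝ) : (xC i).1 x = x i := rfl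

lemma pdC_xC (i j : Fin n) : pdC i (xC j) = if i = j then 1 else 0 := by
  ext x
  have h : HasFDerivAt (fun x : Fin n → ℝ => (x j : ℂ))
      (Complex.ofRealCLM.comp (ContinuousLinearMap.proj (R := ℝ) (φ := fun _ : Fin n => ℝ) j)) x :=
    (Complex.ofRealCLM.comp
      (ContinuousLinearMap.proj (R := ℝ) (φ := fun _ : Fin n => ℝ) j)).hasFDerivAt
  change fderiv ℝ (fun x : Fin n → ℝ => (x j : ℂ)) x _ = _
  rw [h.fderiv]
  by_cases hij : i = j
  · subst hij; simp
  · have : j ≠ i := fun h => hij h.symm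
    simp [hij, this]

/-- `w(∂) x_i = x_i w(∂) + (∂w/∂ξ_i)(∂)`. -/
lemma dOp_xC_mul (w : MvPolynomial (Fin n) ℂ) (i : Fin n) (f : Cinf n) :
    dOp w (xC i * f) = xC i * dOp w f + dOp (pderiv i w) f := by
  induction w using MvPolynomial.induction_on generalizing f with
  | C a => simp
  | add p q hp hq => simp only [map_add, LinearMap.add_apply, hp, hq, mul_add]; abel
  | mul_X p j hp =>
    rw [dOp_mul_X, Derivation.leibniz, pdC_xC, Derivation.leibniz, pderiv_X]
    simp only [smul_eq_mul, map_add, LinearMap.add_apply, hp, dOp_mul_X]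
    by_cases hij : j = i
    · subst hij
      simp only [Pi.single_eq_same, if_true, mul_one, dOp_pdC, mul_comm (X j) (pderiv j p),
        dOp_mul_X]
      abel
    · have h' : Pi.single (M := fun _ => MvPolynomial (Fin n) ℂ) i 1 j = 0 := by simp [hij]
      simp only [h', hij, if_false, mul_zero, map_zero, LinearMap.zero_apply, add_zero, zero_add,
        mul_comm (X j) (pderiv i p), dOp_mul_X]

/-! ## Exponentials -/

/-- The function `x ↦ e^{i⟨x,ξ⟩}`. -/
def expC (ξ : Fin n → ℝ) : Cinf n :=
  ⟨fun x => Complex.exp (Complex.I * ∑ i, (x i : ℂ) * (ξ i : ℂ)), by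
    refine mem_Cinf.2 (contDiff_const.mul (ContDiff.sum fun i _ => ?_)).cexp
    exact (Complex.ofRealCLM.contDiff.comp (contDiff_apply ℝ ℝ i)).mul contDiff_const⟩

lemma pdC_expC (ξ : Fin n → ℝ) (j : Fin n) :
    pdC j (expC ξ) = (Complex.I * ξ j) • expC ξ := by
  ext x
  let Λ : (Fin n → ℝ) →L[ℝ] ℂ := ∑ i, ((ξ i : ℂ)) • (Complex.ofRealCLM.comp
    (ContinuousLinearMap.proj (R := ℝ) (φ := fun _ : Fin n => ℝ) i))
  have hΛ : ∀ y, Λ y = ∑ i, (y i : ℂ) * (ξ i : ℂ) := by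
    intro y; simp [Λ, mul_comm]
  have h : HasFDerivAt (fun x : Fin n → ℝ => Complex.exp (Complex.I * Λ x))
      (Complex.exp (Complex.I * Λ x) • (Complex.I • Λ)) x :=
    (Λ.hasFDerivAt.const_mul Complex.I).cexp
  simp only [hΛ] at h
  change fderiv ℝ (fun x : Fin n → ℝ =>
    Complex.exp (Complex.I * ∑ i, (x i : ℂ) * (ξ i : ℂ))) x _ = _
  rw [h.fderiv]
  have hj : Λ (Pi.single j 1) = ξ j := by
    rw [hΛ, Finset.sum_eq_single j] <;> simp +contextual
  simp only [smul_apply, hj]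
  simp [expC]
  ring

lemma dOp_expC (w : MvPolynomial (Fin n) ℂ) (ξ : Fin n → ℝ) :
    dOp w (expC ξ) = eval (fun i => Complex.I * (ξ i : ℂ)) w • expC ξ := by
  induction w using MvPolynomial.induction_on with
  | C a => simp
  | add p q hp hq => simp only [map_add, LinearMap.add_apply, hp, hq, add_smul]
  | mul_X p j hp => rw [dOp_mul_X, pdC_expC, map_smul, hp, smul_smul]; simp [mul_comm]

lemma expC_zero (ξ : Fin n → ℝ) : (expC ξ).1 0 = 1 := by simp [expC]

/-- Each coordinate runs through the infinite set `iℝ`. This is what makes a vector of the Verma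
module recoverable from its pairing with exponentials. -/
lemma eq_zero_of_eval_I_mul (w : MvPolynomial (Fin n) ℂ)
    (h : ∀ ξ : Fin n → ℝ, eval (fun i => Complex.I * (ξ i : ℂ)) w = 0) : w = 0 := by
  refine funext_set (fun _ => Set.range fun t : ℝ => Complex.I * (t : ℂ)) (fun _ => ?_) ?_
  · exact Set.infinite_range_of_injective fun a b hab => by simpa using hab
  · intro x hx
    have : ∀ i, ∃ t : ℝ, Complex.I * (t : ℂ) = x i := fun i => hx i trivial
    choose ξ hξ using this
    have := h ξ
    simp only [hξ] at this
    simpa using this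

/-! ## Constant coefficient operators, written out -/

lemma foldr_pd_coe (α : Fin n → ℕ) (l : List (Fin n)) (f : Cinf n) :
    l.foldr (fun i u => (pd i)^[α i] u) f.1 =
      (dOp (l.map fun i => (X i : MvPolynomial (Fin n) ℂ) ^ α i).prod f).1 := by
  induction l with
  | nil => simp
  | cons i l ih =>
    have hp : ∀ (e : ℕ) (g : Cinf n), (pd i)^[e] g.1 = (dOp (X i ^ e) g).1 := by
      intro e g
      induction e with
      | zero => simp
      | succ e ihe => rw [Function.iterate_succ_apply', ihe, pow_succ', dOp_X_mul]; rfl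
    rw [List.foldr_cons, ih, hp, List.map_cons, List.prod_cons, map_mul (dOp (n := n))]; rfl

lemma polyOp_coe (P : MvPolynomial (Fin n) ℂ) (f : Cinf n) : polyOp P f.1 = (dOp P f).1 := by
  have h1 : ∀ α : Fin n →₀ ℕ, pdMulti α f.1 = (dOp (monomial α 1) f).1 := by
    intro α
    rw [pdMulti, foldr_pd_coe, monomial_eq, C_1, one_mul, Finsupp.prod_fintype _ _ (by simp),
      ← List.ofFn_eq_map, List.prod_ofFn]
  funext x
  simp only [polyOp, h1]
  conv_rhs => rw [P.as_sum]
  rw [map_sum, LinearMap.sum_apply]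
  have : ∀ s : Finset (Fin n →₀ ℕ), ((∑ α ∈ s, dOp (monomial α (coeff α P)) f : Cinf n) :
      (Fin n → ℝ) → ℂ) x = ∑ α ∈ s, (dOp (monomial α (coeff α P)) f).1 x := by
    intro s; simp
  rw [this]
  refine Finset.sum_congr rfl fun α _ => ?_
  have e : monomial α (coeff α P) = C (coeff α P) * monomial α 1 := by simp [C_mul_monomial]
  rw [e, dOp_C_mul]; rfl

/-! ## Linear changes of variables -/

/-- `f ↦ f ∘ L` for a matrix `L`. -/
def compC (L : Matrix (Fin n) (Fin n) ℝ) (f : Cinf n) : Cinf n :=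
  ⟨fun x => f.1 (L *ᵥ x), mem_Cinf.2
    ((smooth_Cinf f).comp (Matrix.mulVecLin L).toContinuousLinearMap.contDiff)⟩

lemma pdC_compC (L : Matrix (Fin n) (Fin n) ℝ) (f : Cinf n) (i : Fin n) :
    pdC i (compC L f) = ∑ k, (L k i : ℂ) • compC L (pdC k f) := by
  ext x
  have h : HasFDerivAt (fun x => f.1 (L *ᵥ x))
      ((fderiv ℝ f.1 (L *ᵥ x)).comp (Matrix.mulVecLin L).toContinuousLinearMap) x :=
    (diffAt_Cinf f _).hasFDerivAt.comp x
      (Matrix.mulVecLin L).toContinuousLinearMap.hasFDerivAt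
  change fderiv ℝ (fun x => f.1 (L *ᵥ x)) x _ = _
  rw [h.fderiv]
  have e : L *ᵥ Pi.single i 1 = ∑ k, L k i • Pi.single k (1 : ℝ) := by
    ext a; simp [Pi.single_apply]
  simp [e, compC, pd]

/-- Symbols live on the dual space, hence the transpose: `∂_i (f ∘ L) = ∑_k L_{ki} (∂_k f) ∘ L`. -/
lemma dOp_compC (L : Matrix (Fin n) (Fin n) ℝ) (w : MvPolynomial (Fin n) ℂ) (f : Cinf n) :
    dOp w (compC L f) = compC L (dOp (substPoly Lᵀ w) f) := by
  induction w using MvPolynomial.induction_on generalizing f with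
  | C a => simp [substPoly]; rfl
  | add p q hp hq => simp only [map_add, LinearMap.add_apply, hp, hq]; rfl
  | mul_X p j hp =>
    rw [dOp_mul_X, pdC_compC, map_sum]
    have hX : substPoly Lᵀ (X j) = ∑ k, C (L k j : ℂ) * X k := by simp [substPoly]
    simp only [map_smul, hp, map_mul (substPoly Lᵀ), hX, Finset.mul_sum, map_sum,
      LinearMap.sum_apply]
    ext x
    simp [compC, mul_left_comm _ (C _)]

/-! ## The infinitesimal action -/

/-- As `c(0) = 1`, the multiplier is `c^{-λ}` near `0` and the sign character does not enter the
derivative. This one computation serves both the infinitesimal action on `C^∞(ℝⁿ)` and right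
translation by `N'_+`. -/
lemma hasDerivAt_chi_mul (lam : ℂ) (δ : ℕ) {c : ℝ → ℝ} {c' : ℝ} {y : ℝ → Fin n → ℝ}
    {y' : Fin n → ℝ} {f : (Fin n → ℝ) → ℂ} (hf : DifferentiableAt ℝ f (y 0))
    (hc : HasDerivAt c c' 0) (hc0 : c 0 = 1) (hy : HasDerivAt y y' 0) :
    HasDerivAt (fun s => chi lam δ (c s) * f (y s))
      (-lam * c' * f (y 0) + ∑ i, (y' i : ℂ) * pd i f (y 0)) 0 := by
  have hpos : ∀ᶠ s in nhds (0 : ℝ), 0 < c s :=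
    hc.continuousAt.eventually (lt_mem_nhds (by rw [hc0]; exact one_pos))
  have h1 : HasDerivAt (fun s => ((c s : ℝ) : ℂ) ^ (-lam)) (-lam * c') 0 := by
    have h0 : HasDerivAt (fun z : ℂ => z ^ (-lam)) (-lam) ((c 0 : ℝ) : ℂ) := by
      rw [hc0]
      simpa using (hasDerivAt_id ((1 : ℝ) : ℂ)).cpow_const (c := -lam) (by simp)
    exact HasDerivAt.comp (h₂ := fun z : ℂ => z ^ (-lam)) (h := fun s => ((c s : ℝ) : ℂ))
      (0 : ℝ) h0 hc.ofReal_comp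
  have h2 : HasDerivAt (fun s => f (y s)) (∑ i, (y' i : ℂ) * pd i f (y 0)) 0 := by
    have := hf.hasFDerivAt.comp_hasDerivAt (0 : ℝ) hy
    have e : y' = ∑ i, y' i • Pi.single i (1 : ℝ) := by
      ext a; simp [Pi.single_apply]
    have e2 : fderiv ℝ f (y 0) y' = ∑ i, (y' i : ℂ) * pd i f (y 0) := by
      conv_lhs => rw [e]
      simp [pd]
    rwa [e2] at this
  have h3 := (h1.mul h2)
  refine (h3.congr_of_eventuallyEq ?_).congr_deriv ?_
  · filter_upwards [hpos] with s hs
    simp [chi, Real.sign_of_pos hs, abs_of_pos hs]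
  · simp [hc0]

/-- The components of the column `exp(x) e_0`. -/
def vC (ε : Fin n → ℝ) : Idx n → Cinf n
  | .inl _ => 1
  | .inr (.inl i) => xC i
  | .inr (.inr _) => -((1 / 2 : ℂ) • ∑ i, (ε i : ℂ) • (xC i * xC i))

lemma sum_Cinf_apply {ι : Type*} (s : Finset ι) (F : ι → Cinf n) (x : Fin n → ℝ) :
    (∑ i ∈ s, F i : Cinf n).1 x = ∑ i ∈ s, (F i).1 x := by
  simp

lemma vC_apply (ε : Fin n → ℝ) (a : Idx n) (x : Fin n → ℝ) :
    (vC ε a).1 x = (nbar ε x a i0 : ℂ) := by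
  rcases a with a | a | a
  · simp [vC, nbar]
  · simp [vC, nbar, xC]
  · simp [vC, nbar, normSq, xC, pow_two]
    ring

/-- The components of `A exp(x) e_0`. -/
def avC (ε : Fin n → ℝ) (A : Matrix (Idx n) (Idx n) ℂ) (a : Idx n) : Cinf n :=
  ∑ b, A a b • vC ε b

/-- The vector field part of the infinitesimal action. -/
def fieldC (ε : Fin n → ℝ) (A : Matrix (Idx n) (Idx n) ℂ) : Derivation ℂ (Cinf n) (Cinf n) :=
  ∑ i, (xC i * avC ε A i0 - avC ε A (im i)) • pdC i

/-- `dπ_λ(A)` on `C^∞(ℝⁿ)`. -/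
def dpiC (ε : Fin n → ℝ) (lam : ℂ) (A : Matrix (Idx n) (Idx n) ℂ) : Module.End ℂ (Cinf n) :=
  LinearMap.mulLeft ℂ (lam • avC ε A i0) + (fieldC ε A : Cinf n →ₗ[ℂ] Cinf n)

lemma derivation_sum_apply {ι : Type*} (s : Finset ι) (D : ι → Derivation ℂ (Cinf n) (Cinf n))
    (f : Cinf n) : (∑ i ∈ s, D i) f = ∑ i ∈ s, D i f := by
  rw [← Derivation.coeFnAddMonoidHom_apply, map_sum, Finset.sum_apply]; rfl

lemma fieldC_apply (ε : Fin n → ℝ) (A : Matrix (Idx n) (Idx n) ℂ) (f : Cinf n) :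
    fieldC ε A f = ∑ i, (xC i * avC ε A i0 - avC ε A (im i)) * pdC i f := by
  rw [fieldC, derivation_sum_apply]; rfl

lemma dpiC_apply (ε : Fin n → ℝ) (lam : ℂ) (A : Matrix (Idx n) (Idx n) ℂ) (f : Cinf n) :
    dpiC ε lam A f = lam • avC ε A i0 * f + fieldC ε A f := rfl

lemma hasDerivAt_exp_mul_entry {ι : Type*} [Fintype ι] [DecidableEq ι] (A B : Matrix ι ι ℝ)
    (a b : ι) :
    HasDerivAt (fun t : ℝ => (NormedSpace.exp (-(t • A)) * B) a b) (-(A * B) a b) 0 := by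
  let _ : NormedRing (Matrix ι ι ℝ) := Matrix.linftyOpNormedRing
  let _ : NormedAlgebra ℝ (Matrix ι ι ℝ) := Matrix.linftyOpNormedAlgebra
  have hE : HasDerivAt (fun t : ℝ => NormedSpace.exp (t • (-A))) (-A) 0 := by
    refine (hasDerivAt_exp_smul_const (𝕂 := ℝ) (-A) 0).congr_deriv ?_
    rw [zero_smul, NormedSpace.exp_zero, one_mul]
  have h := ((LinearMap.toContinuousLinearMap (Matrix.entryLinearMap ℝ ℝ a b)).hasFDerivAt
    (x := NormedSpace.exp ((0 : ℝ) • (-A)) * B)).comp_hasDerivAt (0 : ℝ) (hE.mul_const B)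
  have e : (fun t : ℝ => (NormedSpace.exp (-(t • A)) * B) a b) =
      fun t : ℝ => (NormedSpace.exp (t • (-A)) * B) a b := by
    simp only [smul_neg]
  rw [e]
  refine HasDerivAt.congr_deriv (f' := _) h ?_
  change (-A * B) a b = _
  rw [neg_mul]; rfl

lemma dpiR_eq (ε : Fin n → ℝ) (lam : ℂ) (A : Matrix (Idx n) (Idx n) ℝ) (f : Cinf n)
    (x : Fin n → ℝ) :
    dpiR ε lam A f.1 x = lam * ((A * nbar ε x) i0 i0 : ℝ) * f.1 x +
      ∑ i, (((x i * (A * nbar ε x) i0 i0 - (A * nbar ε x) (im i) i0 : ℝ)) : ℂ) * pd i f.1 x := by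
  have hent : ∀ a : Idx n, HasDerivAt (fun t : ℝ => (NormedSpace.exp (-(t • A)) * nbar ε x) a i0)
      (-(A * nbar ε x) a i0) 0 := fun a => hasDerivAt_exp_mul_entry A _ a i0
  have h0 : ∀ a, (NormedSpace.exp (-((0:ℝ) • A)) * nbar ε x) a i0 = nbar ε x a i0 := by simp
  have hy : HasDerivAt (fun t : ℝ => fun i => (NormedSpace.exp (-(t • A)) * nbar ε x) (im i) i0 /
      (NormedSpace.exp (-(t • A)) * nbar ε x) i0 i0)
      (fun i => x i * (A * nbar ε x) i0 i0 - (A * nbar ε x) (im i) i0) 0 := by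
    rw [hasDerivAt_pi]
    intro i
    have := (hent (im i)).div (hent i0) (by rw [h0]; simp [nbar])
    refine this.congr_deriv ?_
    simp only [h0]
    simp [nbar]
    ring
  have hx : (fun i => (NormedSpace.exp (-((0:ℝ) • A)) * nbar ε x) (im i) i0 /
      (NormedSpace.exp (-((0:ℝ) • A)) * nbar ε x) i0 i0) = x := by
    funext i; simp only [h0]; simp [nbar]
  have key := hasDerivAt_chi_mul lam 0 (f := f.1) (diffAt_Cinf f _) (hent i0)
    (by rw [h0]; simp [nbar]) hy
  rw [hx] at key
  unfold dpiR pull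
  rw [key.deriv]
  simp

lemma avC_apply (ε : Fin n → ℝ) (A : Matrix (Idx n) (Idx n) ℂ) (a : Idx n) (x : Fin n → ℝ) :
    (avC ε A a).1 x = ((A.map Complex.re * nbar ε x) a i0 : ℝ) +
      Complex.I * ((A.map Complex.im * nbar ε x) a i0 : ℝ) := by
  simp only [avC, sum_Cinf_apply, Matrix.mul_apply, Complex.ofReal_sum, Finset.mul_sum,
    ← Finset.sum_add_distrib]
  refine Finset.sum_congr rfl fun b _ => ?_
  have e : (A a b • vC ε b : Cinf n).1 x = A a b * (vC ε b).1 x := rfl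
  rw [e, vC_apply]
  conv_lhs => rw [← Complex.re_add_im (A a b)]
  simp only [Matrix.map_apply, Complex.ofReal_mul]
  ring

lemma dpi_coe (ε : Fin n → ℝ) (lam : ℂ) (A : Matrix (Idx n) (Idx n) ℂ) (f : Cinf n) :
    dpi ε lam A f.1 = (dpiC ε lam A f).1 := by
  funext x
  have e1 : (dpiC ε lam A f).1 x = lam * (avC ε A i0).1 x * f.1 x +
      ∑ i, ((x i : ℂ) * (avC ε A i0).1 x - (avC ε A (im i)).1 x) * pd i f.1 x := by
    rw [dpiC_apply, fieldC_apply]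
    change lam * (avC ε A i0).1 x * f.1 x + (∑ i, _ : Cinf n).1 x = _
    rw [sum_Cinf_apply]; rfl
  rw [e1, dpi, dpiR_eq, dpiR_eq]
  simp only [avC_apply, mul_add, Finset.mul_sum]
  have : ∀ a b c d : ℂ, (a + b) + (c + d) = (a + c) + (b + d) := fun a b c d => by ring
  rw [this, ← Finset.sum_add_distrib]
  congr 1
  · ring
  · refine Finset.sum_congr rfl fun i _ => ?_
    push_cast
    ring

/-! ## The Lie algebra `𝔰𝔬(p,q)` in coordinates -/

lemma quadMat_mul_i0 (ε : Fin n → ℝ) (A : Matrix (Idx n) (Idx n) ℂ) (b : Idx n) :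
    ((quadMat ε).map Complex.ofReal * A) i0 b = A i1 b := by
  simp [Matrix.mul_apply, quadMat, Fintype.sum_sum_type]

lemma quadMat_mul_i1 (ε : Fin n → ℝ) (A : Matrix (Idx n) (Idx n) ℂ) (b : Idx n) :
    ((quadMat ε).map Complex.ofReal * A) i1 b = A i0 b := by
  simp [Matrix.mul_apply, quadMat, Fintype.sum_sum_type]

lemma quadMat_mul_im (ε : Fin n → ℝ) (A : Matrix (Idx n) (Idx n) ℂ) (i : Fin n) (b : Idx n) :
    ((quadMat ε).map Complex.ofReal * A) (im i) b = ε i * A (im i) b := by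
  simp [Matrix.mul_apply, quadMat, Fintype.sum_sum_type, apply_ite Complex.ofReal]

lemma quadMat_transpose (ε : Fin n → ℝ) : (quadMat ε)ᵀ = quadMat ε := by
  ext a b
  rcases a with a | a | a <;> rcases b with b | b | b <;> simp [quadMat]
  by_cases h : a = b
  · subst h; simp
  · have : b ≠ a := fun h' => h h'.symm
    simp [h, this]

/-- Because the form is symmetric, skew-adjointness of `A` is antisymmetry of the matrix (form times
`A`), from which the relations between entries are read off. -/
lemma mem_lieG_iff {ε : Fin n → ℝ} {A : Matrix (Idx n) (Idx n) ℂ} :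
    A ∈ lieG ε ↔ ∀ a b, ((quadMat ε).map Complex.ofReal * A) a b =
      -((quadMat ε).map Complex.ofReal * A) b a := by
  rw [mem_skewAdjointMatricesLieSubalgebra, mem_skewAdjointMatricesSubmodule,
    Matrix.IsSkewAdjoint, Matrix.IsAdjointPair, Matrix.mul_neg]
  have e : Aᵀ * (quadMat ε).map Complex.ofReal = ((quadMat ε).map Complex.ofReal * A)ᵀ := by
    rw [Matrix.transpose_mul, ← Matrix.transpose_map, quadMat_transpose]
  rw [e, ← Matrix.ext_iff]
  exact ⟨fun h a b => by simpa using h b a, fun h a b => by simpa using h b a⟩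

section Entries

variable {ε : Fin n → ℝ} {A : Matrix (Idx n) (Idx n) ℂ}

lemma lieG_i1_i0 (hA : A ∈ lieG ε) : A i1 i0 = 0 := by
  have := mem_lieG_iff.1 hA i0 i0
  rw [quadMat_mul_i0] at this
  exact self_eq_neg.1 this

lemma lieG_i0_i1 (hA : A ∈ lieG ε) : A i0 i1 = 0 := by
  have := mem_lieG_iff.1 hA i1 i1
  rw [quadMat_mul_i1] at this
  exact self_eq_neg.1 this

lemma lieG_i0_im (hA : A ∈ lieG ε) (j : Fin n) : A i0 (im j) = -(ε j * A (im j) i1) := by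
  have := mem_lieG_iff.1 hA i1 (im j)
  rwa [quadMat_mul_i1, quadMat_mul_im] at this

lemma lieG_im_im (hA : A ∈ lieG ε) (i j : Fin n) : ε i * A (im i) (im j) = -(ε j * A (im j) (im i)) := by
  have := mem_lieG_iff.1 hA (im i) (im j)
  rwa [quadMat_mul_im, quadMat_mul_im] at this

lemma sum_Idx {M : Type*} [AddCommMonoid M] (F : Idx n → M) :
    ∑ a, F a = F i0 + ((∑ i, F (im i)) + F i1) := by
  simp [Fintype.sum_sum_type]

/-- `⟨v, A v⟩ = 0` for `v = exp(x) e_0`. -/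
lemma vC_avC (hA : A ∈ lieG ε) : vC ε i1 * avC ε A i0 + avC ε A i1 +
    ∑ i, (ε i : ℂ) • (xC i * avC ε A (im i)) = 0 := by
  -- An antisymmetric matrix is contracted with the symmetric `v_a v_b`.
  have hS : ∑ a, ∑ b, ((quadMat ε).map Complex.ofReal * A) a b • (vC ε a * vC ε b) = 0 := by
    have h2 : ∀ S : Cinf n, S = -S → S = 0 := fun S h => by
      have : S = (1 / 2 : ℂ) • (S + S) := by module
      rw [this]; nth_rewrite 2 [h]; simp
    refine h2 _ ?_
    conv_lhs => rw [Finset.sum_comm]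
    rw [← Finset.sum_neg_distrib]
    refine Finset.sum_congr rfl fun a _ => ?_
    rw [← Finset.sum_neg_distrib]
    refine Finset.sum_congr rfl fun b _ => ?_
    rw [mem_lieG_iff.1 hA b a, neg_smul, mul_comm (vC ε b)]
  have key : ∀ a, ∑ b, ((quadMat ε).map Complex.ofReal * A) a b • (vC ε a * vC ε b) =
      vC ε a * ∑ b, ((quadMat ε).map Complex.ofReal * A) a b • vC ε b := by
    intro a; simp only [Finset.mul_sum, mul_smul_comm]
  simp only [key] at hS
  rw [sum_Idx] at hS
  have e0 : (∑ b, ((quadMat ε).map Complex.ofReal * A) i0 b • vC ε b) = avC ε A i1 :=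
    Finset.sum_congr rfl fun b _ => by rw [quadMat_mul_i0]
  have e1 : (∑ b, ((quadMat ε).map Complex.ofReal * A) i1 b • vC ε b) = avC ε A i0 :=
    Finset.sum_congr rfl fun b _ => by rw [quadMat_mul_i1]
  have ei : ∀ i, (∑ b, ((quadMat ε).map Complex.ofReal * A) (im i) b • vC ε b) =
      (ε i : ℂ) • avC ε A (im i) := fun i => by
    rw [avC, Finset.smul_sum]
    exact Finset.sum_congr rfl fun b _ => by rw [quadMat_mul_im, mul_smul]
  have hv0 : vC ε (i0 : Idx n) = 1 := rfl
  have hvi : ∀ i, vC ε (im i) = xC i := fun i => rfl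
  simp only [e0, e1, ei, hv0, hvi, mul_smul_comm] at hS
  rw [← hS]
  ring

lemma fieldC_xC (ε : Fin n → ℝ) (A : Matrix (Idx n) (Idx n) ℂ) (i : Fin n) :
    fieldC ε A (xC i) = xC i * avC ε A i0 - avC ε A (im i) := by
  rw [fieldC_apply, Finset.sum_eq_single i]
  · simp [pdC_xC]
  · intro j _ hj; simp [pdC_xC, hj]
  · simp

/-- `ξ_A v = (A v)_0 v - A v` for `v = exp(x) e_0`. -/
lemma fieldC_vC (hA : A ∈ lieG ε) (a : Idx n) : fieldC ε A (vC ε a) = avC ε A i0 * vC ε a - avC ε A a := by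
  rcases a with a | i | a
  · simp [vC]
  · change fieldC ε A (xC i) = avC ε A i0 * xC i - _
    rw [fieldC_xC, mul_comm]
  -- The last component of `v` is `-|x|²/2` and not a coordinate. Its derivative along the field is
  -- `-∑ ε_i x_i ξ_A(x_i)`, and `⟨v, A v⟩ = 0` brings this to the required form.
  · have h := vC_avC hA
    have e : fieldC ε A (vC ε i1) = -∑ i, (ε i : ℂ) • (xC i * fieldC ε A (xC i)) := by
      change fieldC ε A (-((1 / 2 : ℂ) • ∑ i, (ε i : ℂ) • (xC i * xC i))) = _
      rw [map_neg, Derivation.map_smul, map_sum, Finset.smul_sum]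
      congr 1
      refine Finset.sum_congr rfl fun i _ => ?_
      rw [Derivation.map_smul, Derivation.leibniz, smul_eq_mul]
      module
    have e2 : ∑ i, (ε i : ℂ) • (xC i * fieldC ε A (xC i)) =
        (∑ i, (ε i : ℂ) • (xC i * xC i)) * avC ε A i0 -
          ∑ i, (ε i : ℂ) • (xC i * avC ε A (im i)) := by
      rw [Finset.sum_mul, ← Finset.sum_sub_distrib]
      refine Finset.sum_congr rfl fun i _ => ?_
      rw [fieldC_xC, mul_sub, smul_sub, smul_mul_assoc, mul_assoc]
    have e3 : ∑ i, (ε i : ℂ) • (xC i * xC i) = -((2 : ℂ) • vC ε i1) := by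
      simp only [vC]; module
    have e4 := eq_neg_of_add_eq_zero_right h
    change fieldC ε A (vC ε i1) = _ * vC ε i1 - avC ε A i1
    rw [e, e2, e3, e4]
    simp only [Algebra.smul_def, map_ofNat]
    ring

/-- The components of `B v` are linear in `v`, so the formula for `ξ_A v` applies to each of them.
The order `B * A` reflects that differentiating functions reverses products. -/
lemma fieldC_avC (hA : A ∈ lieG ε) (B : Matrix (Idx n) (Idx n) ℂ) (a : Idx n) :
    fieldC ε A (avC ε B a) = avC ε A i0 * avC ε B a - avC ε (B * A) a := by
  have e : avC ε (B * A) a = ∑ b, B a b • avC ε A b := by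
    simp only [avC, Matrix.mul_apply, Finset.sum_smul, Finset.smul_sum, smul_smul]
    exact Finset.sum_comm
  rw [e, avC, map_sum, Finset.mul_sum, ← Finset.sum_sub_distrib]
  refine Finset.sum_congr rfl fun b _ => ?_
  rw [Derivation.map_smul, fieldC_vC hA, smul_sub, mul_smul_comm]

end Entries

/-! ### Commutation relations: `dπ_λ` is a representation -/

lemma avC_sub (ε : Fin n → ℝ) (A B : Matrix (Idx n) (Idx n) ℂ) (a : Idx n) :
    avC ε (A - B) a = avC ε A a - avC ε B a := by
  simp [avC, sub_smul, Finset.sum_sub_distrib]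

/-- The second order parts of the two composites agree because partial derivatives commute; the
first order parts are computed by `fieldC_avC`. -/
lemma fieldC_commutator {ε : Fin n → ℝ} {A B : Matrix (Idx n) (Idx n) ℂ} (hA : A ∈ lieG ε)
    (hB : B ∈ lieG ε) (f : Cinf n) :
    fieldC ε A (fieldC ε B f) - fieldC ε B (fieldC ε A f) = fieldC ε (A * B - B * A) f := by
  have key : ∀ {A B : Matrix (Idx n) (Idx n) ℂ} (hA : A ∈ lieG ε),
      fieldC ε A (fieldC ε B f) =
      ∑ j, ((xC j * avC ε A i0 - avC ε A (im j)) * avC ε B i0 +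
        xC j * (avC ε A i0 * avC ε B i0 - avC ε (B * A) i0) -
        (avC ε A i0 * avC ε B (im j) - avC ε (B * A) (im j))) * pdC j f +
      ∑ j, ∑ i, (xC j * avC ε B i0 - avC ε B (im j)) * (xC i * avC ε A i0 - avC ε A (im i)) *
        pdC i (pdC j f) := by
    intro A B hA
    rw [fieldC_apply ε B f, map_sum, ← Finset.sum_add_distrib]
    refine Finset.sum_congr rfl fun j _ => ?_
    rw [Derivation.leibniz, map_sub, Derivation.leibniz, fieldC_avC hA, fieldC_avC hA,
      fieldC_xC, fieldC_apply ε A (pdC j f)]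
    simp only [smul_eq_mul, Finset.mul_sum, mul_assoc]
    ring
  rw [key hA, key hB, fieldC_apply]
  have hsym : ∑ j, ∑ i, (xC j * avC ε B i0 - avC ε B (im j)) *
        (xC i * avC ε A i0 - avC ε A (im i)) * pdC i (pdC j f) =
      ∑ j, ∑ i, (xC j * avC ε A i0 - avC ε A (im j)) *
        (xC i * avC ε B i0 - avC ε B (im i)) * pdC i (pdC j f) := by
    rw [Finset.sum_comm]
    refine Finset.sum_congr rfl fun i _ => Finset.sum_congr rfl fun j _ => ?_
    rw [pdC_comm i j]; ring
  rw [hsym, add_sub_add_right_eq_sub, ← Finset.sum_sub_distrib]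
  refine Finset.sum_congr rfl fun j _ => ?_
  rw [avC_sub, avC_sub]
  ring

/-- The multiplication parts contribute `λ(ξ_A (Bv)_0 - ξ_B (Av)_0)`. The products `(Av)_0 (Bv)_0`
cancel and `λ((AB - BA)v)_0` is left. -/
lemma dpiC_commutator {ε : Fin n → ℝ} (lam : ℂ) {A B : Matrix (Idx n) (Idx n) ℂ}
    (hA : A ∈ lieG ε) (hB : B ∈ lieG ε) (f : Cinf n) :
    dpiC ε lam A (dpiC ε lam B f) - dpiC ε lam B (dpiC ε lam A f) =
      dpiC ε lam (A * B - B * A) f := by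
  rw [dpiC_apply _ _ (A * B - B * A), ← fieldC_commutator hA hB]
  simp only [dpiC_apply, map_add, Derivation.leibniz, Derivation.map_smul, smul_eq_mul,
    fieldC_avC hA, fieldC_avC hB, avC_sub]
  simp only [Algebra.smul_def]
  ring

lemma avC_add (ε : Fin n → ℝ) (A B : Matrix (Idx n) (Idx n) ℂ) (a : Idx n) :
    avC ε (A + B) a = avC ε A a + avC ε B a := by
  simp only [avC, Matrix.add_apply, add_smul, Finset.sum_add_distrib]

lemma avC_smul (ε : Fin n → ℝ) (c : ℂ) (A : Matrix (Idx n) (Idx n) ℂ) (a : Idx n) :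
    avC ε (c • A) a = c • avC ε A a := by
  simp only [avC, Matrix.smul_apply, smul_eq_mul, mul_smul, Finset.smul_sum]

/-- `dπ_λ` as a representation of `𝔤` on `C^∞(ℝⁿ)`. -/
def dpiRep (ε : Fin n → ℝ) (lam : ℂ) : lieG ε →ₗ⁅ℂ⁆ Module.End ℂ (Cinf n) where
  toFun A := dpiC ε lam A.1
  map_add' A B := by
    ext1 f
    change dpiC ε lam (A.1 + B.1) f = dpiC ε lam A.1 f + dpiC ε lam B.1 f
    have h : ∀ i, (xC i * (avC ε A.1 i0 + avC ε B.1 i0) - (avC ε A.1 (im i) + avC ε B.1 (im i))) *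
        pdC i f = (xC i * avC ε A.1 i0 - avC ε A.1 (im i)) * pdC i f +
          (xC i * avC ε B.1 i0 - avC ε B.1 (im i)) * pdC i f := fun i => by ring
    simp only [dpiC_apply, fieldC_apply, avC_add, h, Finset.sum_add_distrib, smul_add, add_mul]
    abel
  map_smul' c A := by
    ext1 f
    change dpiC ε lam (c • A.1) f = c • dpiC ε lam A.1 f
    have h : ∀ i, (xC i * (c • avC ε A.1 i0) - c • avC ε A.1 (im i)) * pdC i f =
        c • ((xC i * avC ε A.1 i0 - avC ε A.1 (im i)) * pdC i f) := fun i => by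
      simp only [Algebra.smul_def]; ring
    simp only [dpiC_apply, fieldC_apply, avC_smul, h, ← Finset.smul_sum, smul_add,
      smul_mul_assoc, smul_comm lam c]
  map_lie' {A B} := by
    ext1 f
    exact (dpiC_commutator lam A.2 B.2 f).symm

/-! ## The pairing of the generalized Verma module with functions -/

/-- The representation of `𝔤` on the dual space of `C^∞(ℝⁿ)`. -/
def dualRep (ε : Fin n → ℝ) (lam : ℂ) :
    lieG ε →ₗ⁅ℂ⁆ Module.End ℂ (Module.Dual ℂ (Cinf n)) where
  toFun A := -Module.Dual.transpose (R := ℂ) (dpiRep ε lam A)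
  map_add' A B := by
    ext ψ f
    simp
    abel
  map_smul' c A := by
    ext ψ f
    simp
  map_lie' {A B} := by
    ext ψ f
    have h : dpiRep ε lam ⁅A, B⁆ = ⁅dpiRep ε lam A, dpiRep ε lam B⁆ := LieHom.map_lie _ _ _
    rw [h]
    simp [Ring.lie_def, Module.Dual.transpose_apply]

/-- Evaluation at the origin. -/
def deltaC (n : ℕ) : Module.Dual ℂ (Cinf n) where
  toFun f := f.1 0
  map_add' _ _ := rfl
  map_smul' _ _ := rfl

@[simp] lemma deltaC_apply (f : Cinf n) : deltaC n f = f.1 0 := rfl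

/-- The action of `U(𝔤)` on the dual space of `C^∞(ℝⁿ)`. -/
def dualAction (ε : Fin n → ℝ) (lam : ℂ) :
    UniversalEnvelopingAlgebra ℂ (lieG ε) →ₐ[ℂ] Module.End ℂ (Module.Dual ℂ (Cinf n)) :=
  UniversalEnvelopingAlgebra.lift ℂ (dualRep ε lam)

lemma dualAction_ι (ε : Fin n → ℝ) (lam : ℂ) (A : lieG ε) (ψ : Module.Dual ℂ (Cinf n))
    (f : Cinf n) :
    dualAction ε lam (UniversalEnvelopingAlgebra.ι ℂ A) ψ f = -ψ (dpiC ε lam A.1 f) := by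
  rw [dualAction, UniversalEnvelopingAlgebra.lift_ι_apply]
  rfl

lemma avC_zero_apply (ε : Fin n → ℝ) (A : Matrix (Idx n) (Idx n) ℂ) (a : Idx n) :
    (avC ε A a).1 0 = A a i0 := by
  rw [avC, sum_Cinf_apply, Finset.sum_eq_single i0]
  · change A a i0 * 1 = _
    simp
  · intro b _ hb
    change A a b * (vC ε b).1 0 = 0
    rw [vC_apply, nbar_zero, Matrix.one_apply_ne hb]
    simp
  · simp

lemma dpiC_zero_apply (ε : Fin n → ℝ) (lam : ℂ) (A : Matrix (Idx n) (Idx n) ℂ) (f : Cinf n) :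
    (dpiC ε lam A f).1 0 = lam * A i0 i0 * f.1 0 - ∑ i, A (im i) i0 * pd i f.1 0 := by
  rw [dpiC_apply, fieldC_apply]
  change lam * (avC ε A i0).1 0 * f.1 0 + (∑ i, _ : Cinf n).1 0 = _
  rw [sum_Cinf_apply, avC_zero_apply, sub_eq_add_neg, ← Finset.sum_neg_distrib]
  congr 1
  refine Finset.sum_congr rfl fun i _ => ?_
  change (((0 : ℝ) : ℂ) * _ - (avC ε A (im i)).1 0) * pd i f.1 0 = _
  rw [avC_zero_apply, avC_zero_apply, Complex.ofReal_zero]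
  ring

/-- At the origin the vector field of `Y ∈ 𝔭` vanishes, so `Y` acts on the delta functional by the
scalar `-λ Y_{00}`. The generators of the left ideal thus annihilate it, and `u ↦ u · δ` descends to
the Verma module. -/
lemma dualAction_delta_of_mem (ε : Fin n → ℝ) (lam : ℂ)
    {u : UniversalEnvelopingAlgebra ℂ (lieG ε)} (hu : u ∈ vermaIdeal ε (-lam)) :
    dualAction ε lam u (deltaC n) = 0 := by
  induction hu using Submodule.span_induction with
  | mem u h =>
    obtain ⟨Y, hY, rfl⟩ := h
    ext f
    rw [map_sub, LinearMap.sub_apply, LinearMap.sub_apply, dualAction_ι, AlgHom.commutes,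
      deltaC_apply, dpiC_zero_apply]
    have : ∀ i, Y.1 (im i) i0 = 0 := fun i => hY _ (by simp)
    simp [this, Module.algebraMap_end_apply]
    ring
  | zero => simp
  | add a b _ _ ha hb => rw [map_add, LinearMap.add_apply, ha, hb, add_zero]
  | smul a b _ hb => rw [smul_eq_mul, map_mul, Module.End.mul_apply, hb, map_zero]

/-- The pairing as a map from the Verma module to the dual of `C^∞(ℝⁿ)`. -/
def vermaDual (ε : Fin n → ℝ) (lam : ℂ) : Verma ε (-lam) →ₗ[ℂ] Module.Dual ℂ (Cinf n) :=
  (((vermaIdeal ε (-lam)).restrictScalars ℂ).liftQ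
    ((LinearMap.applyₗ (deltaC n)).comp (dualAction ε lam).toLinearMap)
      fun _ hu => dualAction_delta_of_mem ε lam hu).comp
    (Submodule.Quotient.restrictScalarsEquiv ℂ (vermaIdeal ε (-lam))).symm.toLinearMap

lemma vermaDual_mk (ε : Fin n → ℝ) (lam : ℂ) (u : UniversalEnvelopingAlgebra ℂ (lieG ε)) :
    vermaDual ε lam (Submodule.Quotient.mk u) = dualAction ε lam u (deltaC n) := rfl

lemma vermaDual_ι_smul (ε : Fin n → ℝ) (lam : ℂ) (A : lieG ε) (s : Verma ε (-lam)) (f : Cinf n) :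
    vermaDual ε lam (UniversalEnvelopingAlgebra.ι ℂ A • s) f =
      -vermaDual ε lam s (dpiC ε lam A.1 f) := by
  obtain ⟨u, rfl⟩ := Submodule.Quotient.mk_surjective _ s
  rw [← Submodule.Quotient.mk_smul, vermaDual_mk, vermaDual_mk, smul_eq_mul, map_mul,
    Module.End.mul_apply, dualAction_ι]

open Classical in
/-- A functional on `C^∞(ℝⁿ)`, extended by `0` to all functions. -/
def extendDual (n : ℕ) : Module.Dual ℂ (Cinf n) →ₗ[ℂ] (((Fin n → ℝ) → ℂ) → ℂ) where
  toFun ψ f := if hf : ContDiff ℝ ∞ f then ψ ⟨f, mem_Cinf.2 hf⟩ else 0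
  map_add' ψ ψ' := by
    funext f
    by_cases hf : ContDiff ℝ ∞ f <;> simp [hf]
  map_smul' c ψ := by
    funext f
    by_cases hf : ContDiff ℝ ∞ f <;> simp [hf]

/-- The pairing of the Verma module with functions. -/
def vermaPairing (ε : Fin n → ℝ) (lam : ℂ) :
    Verma ε (-lam) →ₗ[ℂ] (((Fin n → ℝ) → ℂ) → ℂ) :=
  (extendDual n).comp (vermaDual ε lam)

lemma vermaPairing_coe (ε : Fin n → ℝ) (lam : ℂ) (s : Verma ε (-lam)) (f : Cinf n) :
    vermaPairing ε lam s f.1 = vermaDual ε lam s f := by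
  have hf : ContDiff ℝ ∞ f.1 := smooth_Cinf f
  simp [vermaPairing, extendDual, hf]

lemma dualAction_list (ε : Fin n → ℝ) (lam : ℂ) (L : List (lieG ε))
    (ψ : Module.Dual ℂ (Cinf n)) (f : Cinf n) :
    dualAction ε lam (L.map (UniversalEnvelopingAlgebra.ι ℂ)).prod ψ f =
      (-1) ^ L.length * ψ (L.foldl (fun u A => dpiC ε lam A.1 u) f) := by
  induction L generalizing f with
  | nil => simp
  | cons A L ih =>
    rw [List.map_cons, List.prod_cons, map_mul, Module.End.mul_apply, dualAction_ι, ih,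
      List.foldl_cons, List.length_cons, pow_succ]
    ring

lemma isVermaPairing_vermaPairing (ε : Fin n → ℝ) (lam : ℂ) :
    IsVermaPairing ε lam (vermaPairing ε lam) := by
  intro L f hf
  have h := vermaPairing_coe ε lam
    (Submodule.Quotient.mk ((L.map (UniversalEnvelopingAlgebra.ι ℂ)).prod)) ⟨f, mem_Cinf.2 hf⟩
  refine h.trans ?_
  rw [vermaDual_mk, dualAction_list, deltaC_apply]
  congr 1
  have : ∀ (L : List (lieG ε)) (g : Cinf n),
      (L.foldl (fun u A => dpiC ε lam A.1 u) g).1 = L.foldl (fun u A => dpi ε lam A.1 u) g.1 := by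
    intro L
    induction L with
    | nil => intro g; rfl
    | cons A L ih => intro g; rw [List.foldl_cons, List.foldl_cons, ih, dpi_coe]
  rw [this]

/-! ## Vectors of the Verma module as polynomials -/

lemma forall_Idx {p : Idx n → Prop} : (∀ a, p a) ↔ p i0 ∧ (∀ i, p (im i)) ∧ p i1 := by
  refine ⟨fun h => ⟨h _, fun i => h _, h _⟩, fun h a => ?_⟩
  rcases a with a | a | a
  exacts [h.1, h.2.1 a, h.2.2]

/-- The element of `𝔫_-` that maps `e_0` to `e_j`. -/
def nminus (ε : Fin n → ℝ) (j : Fin n) : Matrix (Idx n) (Idx n) ℂ :=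
  Matrix.single (im j) i0 1 - (ε j : ℂ) • Matrix.single i1 (im j) 1

lemma nminus_mem (ε : Fin n → ℝ) (j : Fin n) : nminus ε j ∈ lieG ε := by
  rw [mem_lieG_iff]
  simp only [forall_Idx, quadMat_mul_i0, quadMat_mul_i1, quadMat_mul_im]
  simp [nminus, Matrix.single_apply]
  constructor <;> intro i <;> by_cases h : j = i
  · subst h; simp
  · simp [h]
  · subst h; simp
  · simp [h]

/-- The element of `𝔫_-` that maps `e_0` to `e_j`, in `𝔤`. -/
def nminusL (ε : Fin n → ℝ) (j : Fin n) : lieG ε := ⟨nminus ε j, nminus_mem ε j⟩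

lemma nminus_comm (ε : Fin n → ℝ) (i j : Fin n) :
    nminus ε i * nminus ε j = nminus ε j * nminus ε i := by
  have h : ∀ i j, nminus ε i * nminus ε j =
      if i = j then -((ε i : ℂ) • Matrix.single i1 i0 1) else 0 := by
    intro i j
    by_cases hij : i = j
    · subst hij
      simp [nminus, sub_mul, mul_sub]
    · simp [nminus, sub_mul, mul_sub, hij, Matrix.single_mul_single_of_ne]
  rw [h, h]
  by_cases hij : i = j
  · subst hij; rfl
  · have : j ≠ i := fun h => hij h.symm
    simp [hij, this]

lemma ι_nminusL_comm (ε : Fin n → ℝ) (i j : Fin n) :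
    UniversalEnvelopingAlgebra.ι ℂ (nminusL ε i) * UniversalEnvelopingAlgebra.ι ℂ (nminusL ε j) =
      UniversalEnvelopingAlgebra.ι ℂ (nminusL ε j) *
        UniversalEnvelopingAlgebra.ι ℂ (nminusL ε i) := by
  have h0 : ⁅nminusL ε i, nminusL ε j⁆ = 0 := by
    apply Subtype.ext
    change nminus ε i * nminus ε j - nminus ε j * nminus ε i = 0
    rw [nminus_comm, sub_self]
  have h := LieHom.map_lie (UniversalEnvelopingAlgebra.ι ℂ (L := lieG ε))
    (nminusL ε i) (nminusL ε j)
  rw [h0, map_zero, Ring.lie_def] at h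
  exact sub_eq_zero.1 h.symm

/-- A polynomial as an element of `U(𝔫_-)`. -/
def polyU (ε : Fin n → ℝ) :
    MvPolynomial (Fin n) ℂ →ₐ[ℂ] UniversalEnvelopingAlgebra ℂ (lieG ε) :=
  commEval _ (ι_nminusL_comm ε)

/-- A polynomial as a vector of the Verma module. -/
def polyVec (ε : Fin n → ℝ) (lam : ℂ) : MvPolynomial (Fin n) ℂ →ₗ[ℂ] Verma ε (-lam) :=
  ((vermaIdeal ε (-lam)).mkQ.restrictScalars ℂ).comp (polyU ε).toLinearMap

lemma polyVec_X_mul (ε : Fin n → ℝ) (lam : ℂ) (i : Fin n) (P : MvPolynomial (Fin n) ℂ) :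
    polyVec ε lam (X i * P) = UniversalEnvelopingAlgebra.ι ℂ (nminusL ε i) • polyVec ε lam P := by
  change Submodule.Quotient.mk (polyU ε (X i * P)) = _ • Submodule.Quotient.mk (polyU ε P)
  rw [map_mul, ← Submodule.Quotient.mk_smul, smul_eq_mul, polyU, commEval_X]

lemma dpiC_nminus (ε : Fin n → ℝ) (lam : ℂ) (i : Fin n) (f : Cinf n) :
    dpiC ε lam (nminus ε i) f = -pdC i f := by
  have h0 : avC ε (nminus ε i) i0 = 0 := by
    simp [avC, nminus]
  have hj : ∀ j, avC ε (nminus ε i) (im j) = if i = j then 1 else 0 := by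
    intro j
    by_cases h : i = j
    · subst h; simp [avC, nminus, Matrix.single_apply, vC]
    · simp [avC, nminus, h]
  rw [dpiC_apply, fieldC_apply, h0, Finset.sum_eq_single i]
  · rw [hj, if_pos rfl, smul_zero]; ring
  · intro j _ h
    have h' : i ≠ j := fun h' => h h'.symm
    simp [hj, h']
  · simp

lemma polyVec_C (ε : Fin n → ℝ) (lam : ℂ) (a : ℂ) :
    polyVec ε lam (C a) = a • Submodule.Quotient.mk 1 := by
  have e : (C a : MvPolynomial (Fin n) ℂ) = a • 1 := by simp [smul_eq_C_mul]
  rw [e, map_smul]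
  simp [polyVec]

/-- Two signs cancel: the one in `X° = -X` and the one in `dπ_λ(n_i) = -∂_i`. -/
lemma vermaDual_polyVec (ε : Fin n → ℝ) (lam : ℂ) (P : MvPolynomial (Fin n) ℂ) (f : Cinf n) :
    vermaDual ε lam (polyVec ε lam P) f = (dOp P f).1 0 := by
  induction P using MvPolynomial.induction_on generalizing f with
  | C a =>
    rw [polyVec_C, map_smul, vermaDual_mk, map_one, dOp_C]
    rfl
  | add p q hp hq => simp only [map_add, LinearMap.add_apply, hp, hq]; rfl
  | mul_X p j hp =>
    rw [mul_comm, polyVec_X_mul, vermaDual_ι_smul, mul_comm, dOp_mul_X]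
    change -vermaDual ε lam (polyVec ε lam p) (dpiC ε lam (nminus ε j) f) = _
    rw [dpiC_nminus, map_neg, neg_neg, hp]

/-- After its `𝔫_-` part is subtracted, `A` stabilizes the line of `e_0` and acts on the canonical
generator by its character. -/
lemma ι_smul_mk_one (ε : Fin n → ℝ) (lam : ℂ) (A : lieG ε) :
    UniversalEnvelopingAlgebra.ι ℂ A • (Submodule.Quotient.mk 1 : Verma ε (-lam)) =
      polyVec ε lam (C (-lam * A.1 i0 i0) + ∑ j, C (A.1 (im j) i0) * X j) := by
  have hY : ∀ a : Idx n, a ≠ i0 → (A - ∑ j, A.1 (im j) i0 • nminusL ε j).1 a i0 = 0 := by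
    intro a ha
    have e : (A - ∑ j, A.1 (im j) i0 • nminusL ε j).1 =
        A.1 - ∑ j, A.1 (im j) i0 • nminus ε j := by
      simp [nminusL]
    rw [e, Matrix.sub_apply, Matrix.sum_apply]
    rcases a with a | a | a
    · exact absurd rfl ha
    · simp [nminus, Matrix.single_apply]
    · simp [nminus, lieG_i1_i0 A.2]
  have h00 : (A - ∑ j, A.1 (im j) i0 • nminusL ε j).1 i0 i0 = A.1 i0 i0 := by
    simp [nminusL, nminus, Matrix.sum_apply]
  have h := (Submodule.Quotient.eq (vermaIdeal ε (-lam))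
    (x := UniversalEnvelopingAlgebra.ι ℂ (A - ∑ j, A.1 (im j) i0 • nminusL ε j))
    (y := algebraMap ℂ _ (-lam * A.1 i0 i0))).2
      (Submodule.subset_span ⟨_, hY, by rw [h00]⟩)
  have hp : polyU ε (C (-lam * A.1 i0 i0) + ∑ j, C (A.1 (im j) i0) * X j) =
      algebraMap ℂ _ (-lam * A.1 i0 i0) +
        ∑ j, A.1 (im j) i0 • UniversalEnvelopingAlgebra.ι ℂ (nminusL ε j) := by
    have hC : ∀ a : ℂ, (C a : MvPolynomial (Fin n) ℂ) = algebraMap ℂ _ a := fun _ => rfl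
    rw [map_add, hC, AlgHom.commutes, map_sum]
    congr 1
    refine Finset.sum_congr rfl fun j _ => ?_
    rw [C_mul', map_smul, polyU, commEval_X]
  change _ = Submodule.Quotient.mk (polyU ε _)
  rw [hp, Submodule.Quotient.mk_add, ← h, ← Submodule.Quotient.mk_add, ← Submodule.Quotient.mk_smul,
    smul_eq_mul, mul_one]
  congr 1
  rw [map_sub, map_sum]
  simp only [map_smul]
  abel

/-- `A` is commuted past one generator of `𝔫_-` at a time. The commutator is a new element of `𝔤`,
so the induction has to run over all `A` simultaneously. -/
lemma ι_smul_polyVec_mem (ε : Fin n → ℝ) (lam : ℂ) (A : lieG ε) (P : MvPolynomial (Fin n) ℂ) :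
    UniversalEnvelopingAlgebra.ι ℂ A • polyVec ε lam P ∈ LinearMap.range (polyVec ε lam) := by
  induction P using MvPolynomial.induction_on generalizing A with
  | C a =>
    have h1 : UniversalEnvelopingAlgebra.ι ℂ A • (Submodule.Quotient.mk 1 : Verma ε (-lam)) ∈
        LinearMap.range (polyVec ε lam) := by
      rw [ι_smul_mk_one]
      exact ⟨_, rfl⟩
    have h2 := Submodule.smul_mem _ a h1
    rw [polyVec_C, smul_comm]
    exact h2
  | add p q hp hq => rw [map_add, smul_add]; exact add_mem (hp A) (hq A)
  | mul_X p j hp =>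
    have hX : ∀ s ∈ LinearMap.range (polyVec ε lam),
        UniversalEnvelopingAlgebra.ι ℂ (nminusL ε j) • s ∈ LinearMap.range (polyVec ε lam) := by
      rintro _ ⟨Q, rfl⟩
      exact ⟨X j * Q, polyVec_X_mul ε lam j Q⟩
    have h := LieHom.map_lie (UniversalEnvelopingAlgebra.ι ℂ (L := lieG ε)) A (nminusL ε j)
    rw [Ring.lie_def] at h
    have e : UniversalEnvelopingAlgebra.ι ℂ A * UniversalEnvelopingAlgebra.ι ℂ (nminusL ε j) =
      UniversalEnvelopingAlgebra.ι ℂ (nminusL ε j) * UniversalEnvelopingAlgebra.ι ℂ A +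
        UniversalEnvelopingAlgebra.ι ℂ ⁅A, nminusL ε j⁆ := by rw [h]; abel
    rw [mul_comm, polyVec_X_mul, smul_smul, e, add_smul, mul_smul]
    exact add_mem (hX _ (hp A)) (hp _)

/-- This is the spanning half of the Poincaré–Birkhoff–Witt theorem for `M(-λ)`: the span of
`U(𝔫_-)` applied to the canonical generator is stable under `𝔤`, hence under `U(𝔤)`. -/
lemma polyVec_surjective (ε : Fin n → ℝ) (lam : ℂ) : Function.Surjective (polyVec ε lam) := by
  let S : Subalgebra ℂ (UniversalEnvelopingAlgebra ℂ (lieG ε)) :=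
    { carrier := {u | ∀ s ∈ LinearMap.range (polyVec ε lam),
        u • s ∈ LinearMap.range (polyVec ε lam)}
      mul_mem' := by
        intro a b ha hb
        rw [Set.mem_ofPred_eq] at *
        intro s hs
        rw [mul_smul]
        exact ha _ (hb _ hs)
      add_mem' := by
        intro a b ha hb
        rw [Set.mem_ofPred_eq] at *
        intro s hs
        rw [add_smul]
        exact add_mem (ha s hs) (hb s hs)
      algebraMap_mem' := by
        intro c
        rw [Set.mem_ofPred_eq]
        intro s hs
        rw [algebraMap_smul]
        exact Submodule.smul_mem _ c hs }
  have hS : ∀ u, u ∈ S ↔ ∀ s ∈ LinearMap.range (polyVec ε lam),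
      u • s ∈ LinearMap.range (polyVec ε lam) := fun u => Iff.rfl
  let ιS : lieG ε →ₗ⁅ℂ⁆ S :=
    { toFun := fun A => ⟨UniversalEnvelopingAlgebra.ι ℂ A, (hS _).2 (by
        rintro _ ⟨P, rfl⟩
        exact ι_smul_polyVec_mem ε lam A P)⟩
      map_add' := fun A B => Subtype.ext (map_add _ A B)
      map_smul' := fun c A => Subtype.ext (map_smul _ c A)
      map_lie' := fun {A B} => Subtype.ext (LieHom.map_lie _ A B) }
  -- The stabilizer `S` of the range is a subalgebra containing `𝔤`. By the universal property the
  -- identity of `U(𝔤)` factors through `S`, so `S` is everything.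
  have hid : S.val.comp (UniversalEnvelopingAlgebra.lift ℂ ιS) = AlgHom.id ℂ _ := by
    apply UniversalEnvelopingAlgebra.hom_ext
    ext A
    change ((UniversalEnvelopingAlgebra.lift ℂ ιS (UniversalEnvelopingAlgebra.ι ℂ A) : S) :
      UniversalEnvelopingAlgebra ℂ (lieG ε)) = UniversalEnvelopingAlgebra.ι ℂ A
    rw [UniversalEnvelopingAlgebra.lift_ι_apply]
    rfl
  have key : ∀ u : UniversalEnvelopingAlgebra ℂ (lieG ε), ∀ s ∈ LinearMap.range (polyVec ε lam),
      u • s ∈ LinearMap.range (polyVec ε lam) := by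
    intro u
    have hu : S.val (UniversalEnvelopingAlgebra.lift ℂ ιS u) = u := DFunLike.congr_fun hid u
    rw [← hS, ← hu]
    exact (UniversalEnvelopingAlgebra.lift ℂ ιS u).2
  intro s
  obtain ⟨u, rfl⟩ := Submodule.Quotient.mk_surjective _ s
  have h := key u _ ⟨C 1, polyVec_C ε lam 1⟩
  rwa [one_smul, ← Submodule.Quotient.mk_smul, smul_eq_mul, mul_one] at h

/-- Pairing `P` with `e^{i⟨x,ξ⟩}` gives `P(iξ)`, which determines `P`. In particular the Fourier
transform determines the vector. -/
lemma vermaDual_injective (ε : Fin n → ℝ) (lam : ℂ) : Function.Injective (vermaDual ε lam) := by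
  rw [injective_iff_map_eq_zero]
  intro s hs
  obtain ⟨P, rfl⟩ := polyVec_surjective ε lam s
  have : P = 0 := eq_zero_of_eval_I_mul P fun ξ => by
    have h := vermaDual_polyVec ε lam P (expC ξ)
    rw [hs, dOp_expC] at h
    change 0 = _ * (expC ξ).1 0 at h
    rw [expC_zero, mul_one] at h
    exact h.symm
  rw [this, map_zero]

/-! ### Symbols of homogeneous vectors and the test for singularity -/

lemma sum_eq_of_isHomogeneous {w : MvPolynomial (Fin n) ℂ} {d : ℕ} (hw : w.IsHomogeneous d)
    {α : Fin n →₀ ℕ} (hα : α ∈ w.support) : ∑ i, α i = d := by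
  have h := hw (mem_support_iff.1 hα)
  rw [Finsupp.weight_apply, Finsupp.sum_fintype _ _ (by simp)] at h
  simpa using h

lemma eval_mul_of_isHomogeneous {w : MvPolynomial (Fin n) ℂ} {d : ℕ} (hw : w.IsHomogeneous d)
    (c : ℂ) (x : Fin n → ℂ) : eval (fun i => c * x i) w = c ^ d * eval x w := by
  rw [eval_eq', eval_eq', Finset.mul_sum]
  refine Finset.sum_congr rfl fun α hα => ?_
  simp only [mul_pow, Finset.prod_mul_distrib, Finset.prod_pow_eq_pow_sum,
    sum_eq_of_isHomogeneous hw hα]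
  ring

/-- The vector `φ(w)` for a homogeneous polynomial `w` of degree `d`. -/
def symbVec (ε : Fin n → ℝ) (lam : ℂ) (d : ℕ) (w : MvPolynomial (Fin n) ℂ) : Verma ε (-lam) :=
  -- The scalar compensates `w(∂) e^{i⟨x,ξ⟩} = i^d w(ξ) e^{i⟨x,ξ⟩}`.
  (-Complex.I) ^ d • polyVec ε lam w

lemma vermaPairing_symbVec (ε : Fin n → ℝ) (lam : ℂ) (d : ℕ) (w : MvPolynomial (Fin n) ℂ)
    (f : Cinf n) :
    (dOp w f).1 0 = Complex.I ^ d * vermaPairing ε lam (symbVec ε lam d w) f.1 := by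
  rw [vermaPairing_coe, symbVec, map_smul, LinearMap.smul_apply, vermaDual_polyVec, smul_eq_mul,
    ← mul_assoc, ← mul_pow]
  simp

lemma hasSymbol_symbVec (ε : Fin n → ℝ) (lam : ℂ) (d : ℕ) {w : MvPolynomial (Fin n) ℂ}
    (hw : w.IsHomogeneous d) : HasSymbol (vermaPairing ε lam) (symbVec ε lam d w) w := by
  intro ξ
  have h := vermaPairing_coe ε lam (symbVec ε lam d w) (expC ξ)
  refine h.trans ?_
  rw [symbVec, map_smul, LinearMap.smul_apply, vermaDual_polyVec, smul_eq_mul, dOp_expC]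
  change _ * (_ * (expC ξ).1 0) = _
  have e : eval (fun i => Complex.I * (ξ i : ℂ)) w =
      Complex.I ^ d * eval (fun i => (ξ i : ℂ)) w := eval_mul_of_isHomogeneous hw _ _
  rw [expC_zero, mul_one, e, ← mul_assoc, ← mul_pow]
  simp

/-- By `vermaDual_injective`, being annihilated by `𝔫'_+` can be tested on functions. -/
lemma isSingular_symbVec {ε : Fin (m + 1) → ℝ} {lam : ℂ} {d : ℕ}
    {w : MvPolynomial (Fin (m + 1)) ℂ}
    (h : ∀ Z : Fin (m + 1) → ℂ, Z (Fin.last m) = 0 → ∀ f,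
      (dOp w (dpiC ε lam (nplus ε Z) f)).1 0 = 0) :
    IsSingular ε (-lam) (symbVec ε lam d w) := by
  intro Y Z hZ hY
  apply vermaDual_injective ε lam
  ext f
  rw [vermaDual_ι_smul, hY, symbVec, map_smul, LinearMap.smul_apply, vermaDual_polyVec, h Z hZ]
  simp

/-! ## The polynomial Laplacian -/

/-- `∑ ε_i ∂²/∂ξ_i²` as a linear map. -/
def boxL (ε : Fin n → ℝ) : MvPolynomial (Fin n) ℂ →ₗ[ℂ] MvPolynomial (Fin n) ℂ where
  toFun := boxPoly ε
  map_add' P Q := by simp [boxPoly, Finset.sum_add_distrib]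
  map_smul' c P := by
    simp only [boxPoly, Derivation.map_smul, smul_comm _ c, Finset.smul_sum, RingHom.id_apply]

lemma boxL_apply (ε : Fin n → ℝ) (P : MvPolynomial (Fin n) ℂ) :
    boxL ε P = ∑ i, (ε i : ℂ) • pderiv i (pderiv i P) := rfl

lemma boxL_mul (ε : Fin n → ℝ) (P Q : MvPolynomial (Fin n) ℂ) :
    boxL ε (P * Q) = P * boxL ε Q + Q * boxL ε P +
      (2 : ℂ) • ∑ i, (ε i : ℂ) • (pderiv i P * pderiv i Q) := by
  simp only [boxL_apply, Finset.mul_sum, Finset.smul_sum, ← Finset.sum_add_distrib]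
  refine Finset.sum_congr rfl fun i _ => ?_
  simp only [Derivation.leibniz, map_add, smul_eq_mul, smul_eq_C_mul, map_ofNat]
  ring

lemma pderiv_normSqPoly (ε : Fin n → ℝ) (i : Fin n) :
    pderiv i (normSqPoly ε) = C (2 * (ε i : ℂ)) * X i := by
  rw [normSqPoly, map_sum, Finset.sum_eq_single i]
  · simp only [Derivation.leibniz, pderiv_C, pderiv_X_self, sq, smul_eq_mul, map_mul, map_ofNat]
    ring
  · intro j _ hj
    simp [Derivation.leibniz, sq, pderiv_X_of_ne hj]
  · simp

lemma isHomogeneous_normSqPoly (ε : Fin n → ℝ) : (normSqPoly ε).IsHomogeneous 2 :=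
  IsHomogeneous.sum _ _ _ fun i _ => by
    simpa using (isHomogeneous_C (Fin n) (ε i : ℂ)).mul ((isHomogeneous_X ℂ i).pow 2)

section Signs

variable {ε : Fin n → ℝ}

lemma sign_mul_self (hε : ∀ i, ε i ^ 2 = 1) (i : Fin n) : (ε i : ℂ) * ε i = 1 := by
  rw [← sq]; exact_mod_cast hε i

lemma boxL_normSqPoly (hε : ∀ i, ε i ^ 2 = 1) : boxL ε (normSqPoly ε) = C (2 * (n : ℂ)) := by
  rw [boxL_apply]
  simp only [pderiv_normSqPoly, Derivation.leibniz, pderiv_C, pderiv_X_self, smul_eq_mul, mul_one,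
    mul_zero, add_zero]
  have : ∀ i, (ε i : ℂ) • (C (2 * (ε i : ℂ)) : MvPolynomial (Fin n) ℂ) = C 2 := fun i => by
    rw [smul_eq_C_mul, ← C_mul, ← mul_left_comm, sign_mul_self hε, mul_one]
  simp only [this, Finset.sum_const, Finset.card_univ, Fintype.card_fin, nsmul_eq_mul]
  rw [mul_comm, C_mul]
  simp

/-- In the product rule the cross term is four times the Euler operator, because `ε_i² = 1`; it
contributes `4e`, and `□|X|² = 2n`. -/
lemma boxL_normSqPoly_mul (hε : ∀ i, ε i ^ 2 = 1) {Q : MvPolynomial (Fin n) ℂ} {e : ℕ}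
    (hQ : Q.IsHomogeneous e) :
    boxL ε (normSqPoly ε * Q) =
      normSqPoly ε * boxL ε Q + (2 * (n : ℂ) + 4 * (e : ℂ)) • Q := by
  rw [boxL_mul, boxL_normSqPoly hε]
  have h1 : ∑ i, (ε i : ℂ) • (pderiv i (normSqPoly ε) * pderiv i Q) =
      (2 : ℂ) • ∑ i, X i * pderiv i Q := by
    rw [Finset.smul_sum]
    refine Finset.sum_congr rfl fun i _ => ?_
    rw [pderiv_normSqPoly, smul_eq_C_mul, smul_eq_C_mul, mul_assoc, ← mul_assoc, ← C_mul,
      mul_left_comm _ (2 : ℂ), sign_mul_self hε, mul_one]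
  rw [h1, hQ.sum_X_mul_pderiv]
  simp only [smul_eq_C_mul, nsmul_eq_mul, map_add, map_mul, map_natCast, map_ofNat]
  ring

/-- Each further factor `|X|²` adds `2n + 4(e + 2l)`; summing over `l = 0, …, k` gives the constant.
-/
lemma boxL_normSqPoly_pow_mul (hε : ∀ i, ε i ^ 2 = 1) {Q : MvPolynomial (Fin n) ℂ} {e : ℕ}
    (hQ : Q.IsHomogeneous e) (k : ℕ) :
    boxL ε (normSqPoly ε ^ (k + 1) * Q) = normSqPoly ε ^ (k + 1) * boxL ε Q +
      (2 * ((k : ℂ) + 1) * (n + 2 * e + 2 * k)) • (normSqPoly ε ^ k * Q) := by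
  induction k with
  | zero =>
    rw [zero_add, pow_one, pow_zero, one_mul, boxL_normSqPoly_mul hε hQ]
    congr 2
    simp; ring
  | succ k ih =>
    have hh : (normSqPoly ε ^ (k + 1) * Q).IsHomogeneous (2 * (k + 1) + e) :=
      ((isHomogeneous_normSqPoly ε).pow (k + 1)).mul hQ
    rw [pow_succ', mul_assoc, boxL_normSqPoly_mul hε hh, ih]
    simp only [smul_eq_C_mul, map_add, map_mul, map_natCast, map_ofNat, C_1]
    push_cast
    ring

end Signs

lemma pderiv_eq_zero_of_isHomogeneous_zero {P : MvPolynomial (Fin n) ℂ} (hP : P.IsHomogeneous 0)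
    (i : Fin n) : pderiv i P = 0 := by
  have : P = C (coeff 0 P) := totalDegree_eq_zero_iff_eq_C.1 (Nat.le_zero.1 hP.totalDegree_le)
  rw [this, pderiv_C]

lemma boxL_eq_zero_of_lt_two (ε : Fin n → ℝ) {P : MvPolynomial (Fin n) ℂ} {j : ℕ}
    (hP : P.IsHomogeneous j) (hj : j < 2) : boxL ε P = 0 := by
  rw [boxL_apply]
  refine Finset.sum_eq_zero fun i _ => ?_
  have h1 : (pderiv i P).IsHomogeneous 0 := by
    have := hP.pderiv (i := i)
    rwa [show j - 1 = 0 by omega] at this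
  rw [pderiv_eq_zero_of_isHomogeneous_zero h1, smul_zero]

lemma isHomogeneous_boxL (ε : Fin n → ℝ) {P : MvPolynomial (Fin n) ℂ} {j : ℕ}
    (hP : P.IsHomogeneous j) : (boxL ε P).IsHomogeneous (j - 2) :=
  IsHomogeneous.sum _ _ _ fun i _ =>
    (homogeneousSubmodule (Fin n) ℂ _).smul_mem _ (by
      have := (hP.pderiv (i := i)).pderiv (i := i)
      rwa [Nat.sub_sub] at this)

/-- The degree `j - 2k` is truncated at `0`, so the vanishing of the iterates beyond degree `j` is
recorded separately. -/
lemma isHomogeneous_boxL_iterate (ε : Fin n → ℝ) {P : MvPolynomial (Fin n) ℂ} {j : ℕ}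
    (hP : P.IsHomogeneous j) (k : ℕ) :
    ((boxL ε)^[k] P).IsHomogeneous (j - 2 * k) ∧ (j < 2 * k → (boxL ε)^[k] P = 0) := by
  induction k with
  | zero => simpa using hP
  | succ k ih =>
    rw [Function.iterate_succ_apply']
    refine ⟨?_, fun h => ?_⟩
    · have := isHomogeneous_boxL ε ih.1
      rwa [Nat.sub_sub] at this
    · by_cases hk : j < 2 * k
      · rw [ih.2 hk, map_zero]
      · exact boxL_eq_zero_of_lt_two ε ih.1 (by omega)

/-! ## The trace-free part -/

/-- The coefficients of the projection to harmonic polynomials of degree `j`. -/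
def harmCoef (n j : ℕ) : ℕ → ℂ
  | 0 => 1
  -- The denominator is the constant of `boxL_normSqPoly_pow_mul` for `e = j - 2(k + 1)`, where `n +
  -- 2e + 2k = n + 2j - 2k - 4`.
  | k + 1 => -harmCoef n j k / (2 * ((k : ℂ) + 1) * (n + 2 * j - 2 * k - 4))

/-- The projection of homogeneous polynomials of degree `j` to harmonic polynomials. -/
def harmProj (ε : Fin n → ℝ) (j : ℕ) : MvPolynomial (Fin n) ℂ →ₗ[ℂ] MvPolynomial (Fin n) ℂ :=
  ∑ k ∈ Finset.range (j + 1),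
    harmCoef n j k • (LinearMap.mulLeft ℂ (normSqPoly ε ^ k)).comp (boxL ε ^ k)

lemma harmProj_apply (ε : Fin n → ℝ) (j : ℕ) (S : MvPolynomial (Fin n) ℂ) :
    harmProj ε j S = ∑ k ∈ Finset.range (j + 1),
      harmCoef n j k • (normSqPoly ε ^ k * (boxL ε)^[k] S) := by
  simp [harmProj, LinearMap.sum_apply, Module.End.pow_apply]

/-- Applied to the `(k+1)`-st term, the Laplacian yields two pieces, one of which cancels a piece of
the preceding term by the choice of `harmCoef`. The sum telescopes, and its end vanishes for reasons
of degree. -/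
lemma harmProj_mem {ε : Fin n → ℝ} (hε : ∀ i, ε i ^ 2 = 1) (hn : 2 ≤ n) {j : ℕ}
    {S : MvPolynomial (Fin n) ℂ} (hS : S.IsHomogeneous j) : harmProj ε j S ∈ Harm ε j := by
  have hit := isHomogeneous_boxL_iterate ε hS
  refine ⟨?_, ?_⟩
  · rw [harmProj_apply]
    refine IsHomogeneous.sum _ _ _ fun k _ => (homogeneousSubmodule (Fin n) ℂ _).smul_mem _ ?_
    rw [mem_homogeneousSubmodule]
    by_cases hk : j < 2 * k
    · rw [(hit k).2 hk, mul_zero]; exact isHomogeneous_zero _ _ _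
    · have := ((isHomogeneous_normSqPoly ε).pow k).mul (hit k).1
      rwa [show 2 * k + (j - 2 * k) = j by omega] at this
  · change boxL ε (harmProj ε j S) = 0
    rw [harmProj_apply, map_sum, Finset.sum_range_succ']
    have hstep : ∀ k ∈ Finset.range j, boxL ε (harmCoef n j (k + 1) •
        (normSqPoly ε ^ (k + 1) * (boxL ε)^[k + 1] S)) =
        harmCoef n j (k + 1) • (normSqPoly ε ^ (k + 1) * (boxL ε)^[k + 2] S) -
          harmCoef n j k • (normSqPoly ε ^ k * (boxL ε)^[k + 1] S) := by
      intro k _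
      rw [map_smul, boxL_normSqPoly_pow_mul hε (hit (k + 1)).1, smul_add, smul_smul,
        ← Function.iterate_succ_apply' (boxL ε), sub_eq_add_neg, ← neg_smul]
      congr 1
      by_cases hk : j < 2 * (k + 1)
      · rw [(hit (k + 1)).2 hk]; simp
      · congr 1
        have h2 : ((j - 2 * (k + 1) : ℕ) : ℂ) = (j : ℂ) - 2 * (k + 1) := by
          push_cast [Nat.cast_sub (show 2 * (k + 1) ≤ j by omega)]; ring
        -- In the remaining range `2(k + 1) ≤ j`, so this number is at least `n + 2k`.
        have h3 : (n : ℂ) + 2 * j - 2 * k - 4 ≠ 0 := by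
          have : (n : ℂ) + 2 * j - 2 * k - 4 = ((n + 2 * j - 2 * k - 4 : ℕ) : ℂ) := by
            rw [Nat.cast_sub (by omega), Nat.cast_sub (by omega)]; push_cast; ring
          rw [this]
          exact Nat.cast_ne_zero.2 (by omega)
        have h4 : (k : ℂ) + 1 ≠ 0 := Nat.cast_add_one_ne_zero k
        rw [harmCoef, h2]
        field_simp
        ring
    rw [Finset.sum_congr rfl hstep, Finset.sum_sub_distrib]
    have ht : ∑ k ∈ Finset.range j, harmCoef n j (k + 1) •
          (normSqPoly ε ^ (k + 1) * (boxL ε)^[k + 2] S) +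
        harmCoef n j 0 • (normSqPoly ε ^ 0 * (boxL ε)^[1] S) =
        ∑ k ∈ Finset.range j, harmCoef n j k • (normSqPoly ε ^ k * (boxL ε)^[k + 1] S) := by
      rw [← Finset.sum_range_succ' fun k => harmCoef n j k •
        (normSqPoly ε ^ k * (boxL ε)^[k + 1] S), Finset.sum_range_succ,
        (hit (j + 1)).2 (by omega)]
      simp
    have hb : boxL ε (harmCoef n j 0 • (normSqPoly ε ^ 0 * (boxL ε)^[0] S)) =
        harmCoef n j 0 • (normSqPoly ε ^ 0 * (boxL ε)^[1] S) := by simp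
    rw [hb, sub_add_eq_add_sub, ht, sub_self]

lemma exists_eq_harmProj_add (ε : Fin n → ℝ) (j : ℕ) (S : MvPolynomial (Fin n) ℂ) :
    ∃ Q, S = harmProj ε j S + normSqPoly ε * Q := by
  refine ⟨-∑ k ∈ Finset.range j,
    harmCoef n j (k + 1) • (normSqPoly ε ^ k * (boxL ε)^[k + 1] S), ?_⟩
  rw [harmProj_apply, Finset.sum_range_succ', mul_neg, Finset.mul_sum]
  have : ∀ k, normSqPoly ε * (harmCoef n j (k + 1) • (normSqPoly ε ^ k * (boxL ε)^[k + 1] S)) =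
      harmCoef n j (k + 1) • (normSqPoly ε ^ (k + 1) * (boxL ε)^[k + 1] S) := fun k => by
    rw [mul_smul_comm, pow_succ', mul_assoc]
  simp only [this]
  simp [harmCoef]

/-! ## The pairing of polynomials -/

lemma pairPoly_eq_sum {h : MvPolynomial (Fin n) ℂ} (T : MvPolynomial (Fin n) ℂ)
    {s : Finset (Fin n →₀ ℕ)} (hs : h.support ⊆ s) :
    pairPoly h T = ∑ α ∈ s, ((∏ i, (α i).factorial : ℕ) : ℂ) * coeff α h * coeff α T := by
  refine Finset.sum_subset hs fun α _ hα => ?_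
  rw [notMem_support_iff.1 hα]; simp

lemma pairPoly_comm (h T : MvPolynomial (Fin n) ℂ) : pairPoly h T = pairPoly T h := by
  classical
  rw [pairPoly_eq_sum T (Finset.subset_union_left (s₂ := T.support)),
    pairPoly_eq_sum h (Finset.subset_union_right (s₁ := h.support))]
  exact Finset.sum_congr rfl fun α _ => by ring

/-- The pairing as a linear map in the second argument. -/
def pairL (h : MvPolynomial (Fin n) ℂ) : MvPolynomial (Fin n) ℂ →ₗ[ℂ] ℂ where
  toFun := pairPoly h
  map_add' S T := by simp [pairPoly, mul_add, Finset.sum_add_distrib]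
  map_smul' c T := by
    simp only [pairPoly, coeff_smul, smul_eq_mul, Finset.mul_sum, RingHom.id_apply]
    exact Finset.sum_congr rfl fun α _ => by ring

@[simp] lemma pairL_apply (h T : MvPolynomial (Fin n) ℂ) : pairL h T = pairPoly h T := rfl

lemma pairL_comm (h T : MvPolynomial (Fin n) ℂ) : pairL h T = pairL T h := pairPoly_comm h T

lemma pairL_monomial (α : Fin n →₀ ℕ) (a : ℂ) (T : MvPolynomial (Fin n) ℂ) :
    pairL (monomial α a) T = ((∏ i, (α i).factorial : ℕ) : ℂ) * a * coeff α T := by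
  classical
  rw [pairL_apply, pairPoly_eq_sum T support_monomial_subset]
  simp

/-- Multiplication by `X_i` is adjoint to `∂_i`: the weights `α!` absorb the exponent that
differentiation brings down. -/
lemma pairL_X_mul (h : MvPolynomial (Fin n) ℂ) (i : Fin n) (T : MvPolynomial (Fin n) ℂ) :
    pairL h (X i * T) = pairL (pderiv i h) T := by
  induction h using MvPolynomial.induction_on' with
  | add p q hp hq =>
    have hadd : ∀ a b S : MvPolynomial (Fin n) ℂ, pairL (a + b) S = pairL a S + pairL b S :=
      fun a b S => by rw [pairL_comm, map_add, pairL_comm a, pairL_comm b]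
    rw [map_add, hadd, hadd, hp, hq]
  | monomial α a =>
    rw [pderiv_monomial, pairL_monomial, pairL_monomial, coeff_X_mul']
    by_cases hi : i ∈ α.support
    · rw [if_pos hi]
      have h1 : α i ≠ 0 := Finsupp.mem_support_iff.1 hi
      have hf : ∏ l, (α l).factorial =
          α i * ∏ l, ((α - Finsupp.single i 1 : Fin n →₀ ℕ) l).factorial := by
        rw [← Finset.mul_prod_erase _ _ (Finset.mem_univ i),
          ← Finset.mul_prod_erase _ (fun l => ((α - Finsupp.single i 1 : Fin n →₀ ℕ) l).factorial)
            (Finset.mem_univ i), ← mul_assoc]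
        congr 1
        · simp [Nat.mul_factorial_pred h1]
        · refine Finset.prod_congr rfl fun l hl => ?_
          have : l ≠ i := Finset.ne_of_mem_erase hl
          simp [this.symm]
      rw [hf]; push_cast; ring
    · rw [if_neg hi, Finsupp.notMem_support_iff.1 hi]; simp

lemma pairL_normSqPoly_mul (ε : Fin n → ℝ) (h Q : MvPolynomial (Fin n) ℂ) :
    pairL h (normSqPoly ε * Q) = pairL (boxL ε h) Q := by
  rw [normSqPoly, Finset.sum_mul, map_sum, boxL_apply, pairL_comm _ Q, map_sum]
  refine Finset.sum_congr rfl fun i _ => ?_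
  rw [mul_assoc, C_mul', map_smul, map_smul, sq, mul_assoc, pairL_X_mul, pairL_X_mul, pairL_comm]

/-- Since `|X|²` is adjoint to `□`, harmonic polynomials are orthogonal to all multiples of `|X|²`,
and the trace part of `S` is invisible to them. -/
lemma pairL_harmProj {ε : Fin n → ℝ} {j : ℕ} {h : MvPolynomial (Fin n) ℂ} (hh : h ∈ Harm ε j)
    (S : MvPolynomial (Fin n) ℂ) : pairL h (harmProj ε j S) = pairL h S := by
  obtain ⟨Q, hQ⟩ := exists_eq_harmProj_add ε j S
  have h0 : boxL ε h = 0 := hh.2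
  conv_rhs => rw [hQ]
  rw [map_add, pairL_normSqPoly_mul, h0, pairL_comm 0, map_zero, add_zero]

/-- The pairing is non-degenerate on harmonic polynomials. -/
lemma eq_zero_of_pairL_harm {ε : Fin n → ℝ} (hε : ∀ i, ε i ^ 2 = 1) (hn : 2 ≤ n) {j : ℕ}
    {T : MvPolynomial (Fin n) ℂ} (hT : T ∈ Harm ε j) (h : ∀ S ∈ Harm ε j, pairL S T = 0) :
    T = 0 := by
  ext α
  by_contra hα
  rw [coeff_zero] at hα
  have hα' : ∑ i, α i = j := sum_eq_of_isHomogeneous hT.1 (mem_support_iff.2 hα)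
  have hm : (monomial α (1 : ℂ)).IsHomogeneous j :=
    isHomogeneous_monomial _ (by rw [Finsupp.degree_eq_sum, hα'])
  -- Testing against the harmonic projection of the monomial `α` detects the coefficient of `T` at
  -- `α`, because `T` is itself harmonic.
  have h1 := h _ (harmProj_mem hε hn hm)
  rw [pairL_comm, pairL_harmProj hT, pairL_comm, pairL_monomial] at h1
  simp [hα] at h1
  exact (Finset.prod_ne_zero_iff.2 fun i _ => Nat.cast_ne_zero.2 (Nat.factorial_ne_zero _)) h1

/-! ## Orthogonal substitutions -/

lemma substPoly_X (A : Matrix (Fin n) (Fin n) ℝ) (i : Fin n) :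
    substPoly A (X i) = ∑ k, C (A i k : ℂ) * X k := by simp [substPoly]

/-- The left inverse `D kᵀ D` of `k` is also a right inverse. The transpose is needed because
symbols and second derivatives transform contragrediently to points. -/
lemma orthSmall_transpose {ε : Fin n → ℝ} (hε : ∀ i, ε i ^ 2 = 1)
    {k : Matrix (Fin n) (Fin n) ℝ} (hk : OrthSmall ε k) : OrthSmall ε kᵀ := by
  have hD : Matrix.diagonal ε * Matrix.diagonal ε = 1 := by
    rw [Matrix.diagonal_mul_diagonal, ← Matrix.diagonal_one]
    congr 1; funext i; rw [← sq, hε]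
  have h1 : (Matrix.diagonal ε * kᵀ * Matrix.diagonal ε) * k = 1 := by
    unfold OrthSmall at hk
    rw [Matrix.mul_assoc, Matrix.mul_assoc, ← Matrix.mul_assoc kᵀ, hk, hD]
  have h2 := mul_eq_one_comm.1 h1
  unfold OrthSmall
  rw [Matrix.transpose_transpose]
  calc k * Matrix.diagonal ε * kᵀ
      = k * (Matrix.diagonal ε * kᵀ * Matrix.diagonal ε) * Matrix.diagonal ε := by
        simp only [Matrix.mul_assoc, hD, Matrix.mul_one]
    _ = _ := by rw [h2, Matrix.one_mul]

lemma orthSmall_apply {ε : Fin n → ℝ} {k : Matrix (Fin n) (Fin n) ℝ} (hk : OrthSmall ε k)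
    (a b : Fin n) : ∑ i, ε i * k i a * k i b = if a = b then ε a else 0 := by
  have := congrFun (congrFun hk a) b
  rw [Matrix.mul_assoc, Matrix.mul_apply, Matrix.diagonal_apply] at this
  rw [← this]
  refine Finset.sum_congr rfl fun i _ => ?_
  rw [Matrix.diagonal_mul, Matrix.transpose_apply]; ring

lemma substPoly_normSqPoly {ε : Fin n → ℝ} {k : Matrix (Fin n) (Fin n) ℝ} (hk : OrthSmall ε k) :
    substPoly k (normSqPoly ε) = normSqPoly ε := by
  have hC : ∀ a : ℂ, substPoly k (C a) = C a := fun a => by simp [substPoly]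
  have e : substPoly k (normSqPoly ε) =
      ∑ a, ∑ b, C ((∑ i, ε i * k i a * k i b : ℝ) : ℂ) * (X a * X b) := by
    simp only [normSqPoly, map_sum, map_mul, hC, substPoly_X, sq, Finset.mul_sum,
      Complex.ofReal_sum, Complex.ofReal_mul, Finset.sum_mul]
    rw [Finset.sum_comm]
    refine Finset.sum_congr rfl fun a _ => ?_
    rw [Finset.sum_comm]
    refine Finset.sum_congr rfl fun b _ => Finset.sum_congr rfl fun i _ => ?_
    ring
  rw [e]
  simp only [orthSmall_apply hk]
  refine Finset.sum_congr rfl fun a _ => ?_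
  rw [Finset.sum_eq_single a]
  · simp [sq]
  · intro b _ hb; simp [hb.symm]
  · simp

lemma pderiv_substPoly (A : Matrix (Fin n) (Fin n) ℝ) (P : MvPolynomial (Fin n) ℂ) (i : Fin n) :
    pderiv i (substPoly A P) = ∑ k, (A k i : ℂ) • substPoly A (pderiv k P) := by
  induction P using MvPolynomial.induction_on with
  | C a => simp [substPoly]
  | add p q hp hq => simp only [map_add, hp, hq, smul_add, Finset.sum_add_distrib]
  | mul_X p j hp =>
    have hX : pderiv i (substPoly A (X j)) = C (A j i : ℂ) := by
      rw [substPoly_X, map_sum, Finset.sum_eq_single i]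
      · simp
      · intro b _ hb; simp [pderiv_X_of_ne hb]
      · simp
    have hk : ∀ k, pderiv k (p * X j) = p * Pi.single (M := fun _ => MvPolynomial (Fin n) ℂ) k 1 j
        + X j * pderiv k p := fun k => by
      rw [Derivation.leibniz, pderiv_X]; simp
    have h1 : ∑ k, (A k i : ℂ) • substPoly A
        (p * Pi.single (M := fun _ => MvPolynomial (Fin n) ℂ) k 1 j) =
        (A j i : ℂ) • substPoly A p := by
      rw [Finset.sum_eq_single j]
      · simp
      · intro b _ hb
        have : j ≠ b := hb.symm
        simp [this]
      · simp
    simp only [hk, map_add, smul_add, Finset.sum_add_distrib, h1]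
    rw [map_mul, Derivation.leibniz, hp, hX]
    simp only [map_mul, smul_eq_mul, smul_eq_C_mul, Finset.mul_sum]
    exact congrArg₂ (· + ·) (mul_comm _ _) (Finset.sum_congr rfl fun k _ => mul_left_comm _ _ _)

/-- By the chain rule the second derivatives are contracted with `k D kᵀ`, which equals `D`. -/
lemma boxL_substPoly {ε : Fin n → ℝ} (hε : ∀ i, ε i ^ 2 = 1) {k : Matrix (Fin n) (Fin n) ℝ}
    (hk : OrthSmall ε k) (P : MvPolynomial (Fin n) ℂ) :
    boxL ε (substPoly k P) = substPoly k (boxL ε P) := by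
  have e : boxL ε (substPoly k P) = ∑ a, ∑ b,
      ((∑ i, ε i * kᵀ i a * kᵀ i b : ℝ) : ℂ) • substPoly k (pderiv b (pderiv a P)) := by
    rw [boxL_apply]
    simp only [pderiv_substPoly, map_sum, Derivation.map_smul, Finset.smul_sum, smul_smul,
      Complex.ofReal_sum, Complex.ofReal_mul, Finset.sum_smul, Matrix.transpose_apply]
    rw [Finset.sum_comm]
    refine Finset.sum_congr rfl fun a _ => ?_
    rw [Finset.sum_comm]
    refine Finset.sum_congr rfl fun b _ => Finset.sum_congr rfl fun i _ => ?_
    rw [mul_assoc]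
  rw [e, boxL_apply, map_sum]
  simp only [orthSmall_apply (orthSmall_transpose hε hk)]
  refine Finset.sum_congr rfl fun a _ => ?_
  rw [Finset.sum_eq_single a]
  · rw [if_pos rfl, map_smul]
  · intro b _ hb; simp [hb.symm]
  · simp

/-! ## Polynomials in `ξ'` and `ξ_n` -/

lemma pderiv_castSucc_rename (i : Fin m) (h : MvPolynomial (Fin m) ℂ) :
    pderiv i.castSucc (rename Fin.castSucc h) = rename Fin.castSucc (pderiv i h) :=
  pderiv_rename (Fin.castSucc_injective m) i h

lemma pderiv_last_rename (h : MvPolynomial (Fin m) ℂ) :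
    pderiv (Fin.last m) (rename Fin.castSucc h) = 0 := by
  induction h using MvPolynomial.induction_on with
  | C a => simp
  | add p q hp hq => rw [map_add, map_add, hp, hq, add_zero]
  | mul_X p i hp =>
    rw [map_mul, Derivation.leibniz, hp, rename_X, pderiv_X_of_ne (Fin.castSucc_lt_last i).ne]
    simp

lemma pderiv_castSucc_rename_mul_pow (i : Fin m) (h : MvPolynomial (Fin m) ℂ) (e : ℕ) :
    pderiv i.castSucc (rename Fin.castSucc h * X (Fin.last m) ^ e) =
      rename Fin.castSucc (pderiv i h) * X (Fin.last m) ^ e := by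
  rw [Derivation.leibniz, Derivation.leibniz_pow, pderiv_castSucc_rename,
    pderiv_X_of_ne (Fin.castSucc_lt_last i).ne']
  simp [mul_comm]

lemma pderiv_last_rename_mul_pow (h : MvPolynomial (Fin m) ℂ) (e : ℕ) :
    pderiv (Fin.last m) (rename Fin.castSucc h * X (Fin.last m) ^ e) =
      (e : ℂ) • (rename Fin.castSucc h * X (Fin.last m) ^ (e - 1)) := by
  rw [Derivation.leibniz, Derivation.leibniz_pow, pderiv_last_rename, pderiv_X_self]
  simp only [smul_eq_mul, mul_zero, add_zero, mul_one, nsmul_eq_mul, smul_eq_C_mul, map_natCast]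
  ring

lemma boxL_rename_mul_pow (ε : Fin (m + 1) → ℝ) (h : MvPolynomial (Fin m) ℂ) (e : ℕ) :
    boxL ε (rename Fin.castSucc h * X (Fin.last m) ^ e) =
      rename Fin.castSucc (boxL (fun i => ε i.castSucc) h) * X (Fin.last m) ^ e +
        ((ε (Fin.last m) : ℂ) * (e * (e - 1))) •
          (rename Fin.castSucc h * X (Fin.last m) ^ (e - 2)) := by
  rw [boxL_apply, Fin.sum_univ_castSucc, boxL_apply, map_sum, Finset.sum_mul]
  congr 1
  · refine Finset.sum_congr rfl fun i _ => ?_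
    rw [pderiv_castSucc_rename_mul_pow, pderiv_castSucc_rename_mul_pow, map_smul, smul_mul_assoc]
  · rw [pderiv_last_rename_mul_pow, Derivation.map_smul, pderiv_last_rename_mul_pow, smul_smul,
      smul_smul, Nat.sub_sub]
    rcases e with _ | e
    · simp
    · congr 1
      push_cast [Nat.add_sub_cancel]
      ring

lemma substPoly_extendOne_rename (k : Matrix (Fin m) (Fin m) ℝ) (h : MvPolynomial (Fin m) ℂ) :
    substPoly (extendOne k) (rename Fin.castSucc h) = rename Fin.castSucc (substPoly k h) := by
  induction h using MvPolynomial.induction_on with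
  | C a => simp [substPoly]
  | add p q hp hq => simp only [map_add, hp, hq]
  | mul_X p i hp =>
    rw [map_mul, map_mul, map_mul, map_mul, hp, rename_X, substPoly_X, substPoly_X, map_sum,
      Fin.sum_univ_castSucc]
    simp [extendOne]

lemma substPoly_extendOne_X_last (k : Matrix (Fin m) (Fin m) ℝ) :
    substPoly (extendOne k) (X (Fin.last m)) = X (Fin.last m) := by
  rw [substPoly_X, Fin.sum_univ_castSucc]
  simp [extendOne]

/-! ## The Gegenbauer polynomials -/

/-- The coefficient of `|ξ'|^{2k} ξ_n^{K-2k}` in `w_{K,-λ}`. -/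
def wCoef (ε : Fin (m + 1) → ℝ) (K : ℕ) (lam : ℂ) (k : ℕ) : ℂ :=
  ((K / 2).factorial : ℂ) / (if K % 2 = 0 then 1 else 2) *
    (gegenCoef K (lam - (m : ℂ) / 2) k * (ε (Fin.last m) : ℂ) ^ k)

lemma wPoly_eq (ε : Fin (m + 1) → ℝ) (K : ℕ) (lam : ℂ) :
    wPoly ε K (-lam) = ∑ k ∈ Finset.range (K / 2 + 1), wCoef ε K lam k •
      (rename Fin.castSucc (normSqPoly (fun i : Fin m => ε i.castSucc) ^ k) *
        X (Fin.last m) ^ (K - 2 * k)) := by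
  rw [wPoly, Finset.mul_sum]
  refine Finset.sum_congr rfl fun k _ => ?_
  rw [neg_neg, mul_pow, ← C_pow, map_pow (rename _), wCoef, smul_eq_C_mul, C_mul, C_mul]
  ring

/-- From `k` to `k + 1` the product loses its top factor `α + K - 1 - k`; the rest is the quotient
of the factorials and of the powers of `2`. Written without division, the relation holds for every
`α`. -/
lemma gegenCoef_succ (K : ℕ) (α : ℂ) {k : ℕ} (hk : k < K / 2) :
    gegenCoef K α (k + 1) * (4 * (k + 1) * (α + K - 1 - k)) =
      gegenCoef K α k * ((K - 2 * k) * (K - 2 * k - 1)) := by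
  obtain ⟨e, he⟩ : ∃ e, K = 2 * k + 2 + e := ⟨K - 2 * k - 2, by omega⟩
  have h1 : K - 2 * k = e + 2 := by omega
  have h2 : K - 2 * (k + 1) = e := by omega
  have h3 : K - k = (K - (k + 1)) + 1 := by omega
  have h4 : ((K - (k + 1) : ℕ) : ℂ) = K - 1 - k := by
    rw [Nat.cast_sub (by omega)]; push_cast; ring
  have h5 : (K : ℂ) = 2 * k + 2 + e := by rw [he]; push_cast; ring
  rw [gegenCoef, gegenCoef, h1, h2, h3, Finset.prod_Ico_succ_top (by omega), h4, Nat.factorial_succ,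
    Nat.factorial_succ (e + 1), Nat.factorial_succ e, h5]
  have f1 : ((k.factorial : ℕ) : ℂ) ≠ 0 := Nat.cast_ne_zero.2 (Nat.factorial_ne_zero _)
  have f2 : ((e.factorial : ℕ) : ℂ) ≠ 0 := Nat.cast_ne_zero.2 (Nat.factorial_ne_zero _)
  have f3 : (k : ℂ) + 1 ≠ 0 := Nat.cast_add_one_ne_zero k
  have f4 : (e : ℂ) + 1 ≠ 0 := Nat.cast_add_one_ne_zero e
  have f5 : (e : ℂ) + 1 + 1 ≠ 0 := by exact_mod_cast Nat.cast_add_one_ne_zero (R := ℂ) (e + 1)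
  push_cast
  field_simp
  ring

/-- With `α = λ - m/2` the Gegenbauer recursion becomes the equation of the F-method on
coefficients: `2(λ + K - 1)` comes from `wGrad`, and `m + 2k` from the Laplacian of `|ξ'|^{2k+2}`.
-/
lemma wCoef_succ (ε : Fin (m + 1) → ℝ) (K : ℕ) (lam : ℂ) {k : ℕ}
    (hk : k < K / 2) :
    wCoef ε K lam (k + 1) * (2 * (k + 1) * (2 * (lam + K - 1) - m - 2 * k)) =
      ε (Fin.last m) * wCoef ε K lam k * ((K - 2 * k) * (K - 2 * k - 1)) := by
  have h := gegenCoef_succ K (lam - (m : ℂ) / 2) hk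
  rw [wCoef, wCoef, pow_succ]
  linear_combination ((K / 2).factorial : ℂ) / (if K % 2 = 0 then 1 else 2) *
    (ε (Fin.last m) : ℂ) ^ k * (ε (Fin.last m) : ℂ) * h

lemma isHomogeneous_wPoly (ε : Fin (m + 1) → ℝ) (K : ℕ) (lam : ℂ) :
    (wPoly ε K (-lam)).IsHomogeneous K := by
  rw [wPoly_eq]
  refine IsHomogeneous.sum _ _ _ fun k hk => (homogeneousSubmodule _ ℂ _).smul_mem _ ?_
  rw [mem_homogeneousSubmodule]
  have h1 := ((isHomogeneous_normSqPoly (fun i : Fin m => ε i.castSucc)).pow k).rename_isHomogeneous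
    (f := Fin.castSucc)
  have h2 := h1.mul ((isHomogeneous_X ℂ (Fin.last m)).pow (K - 2 * k))
  rw [Finset.mem_range] at hk
  rwa [show 2 * k + 1 * (K - 2 * k) = K by omega] at h2

/-- The polynomial `g` with `∂w/∂ξ_i = ε_i ξ_i g` for `i < n`, where `w = w_{K,-λ}`. -/
def wGrad (ε : Fin (m + 1) → ℝ) (K : ℕ) (lam : ℂ) : MvPolynomial (Fin (m + 1)) ℂ :=
  ∑ k ∈ Finset.range (K / 2), (2 * ((k : ℂ) + 1) * wCoef ε K lam (k + 1)) •
    (rename Fin.castSucc (normSqPoly (fun i : Fin m => ε i.castSucc) ^ k) *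
      X (Fin.last m) ^ (K - 2 * (k + 1)))

lemma pderiv_wPoly (ε : Fin (m + 1) → ℝ) (K : ℕ) (lam : ℂ) (i : Fin m) :
    pderiv i.castSucc (wPoly ε K (-lam)) =
      C (ε i.castSucc : ℂ) * X i.castSucc * wGrad ε K lam := by
  rw [wPoly_eq, map_sum, Finset.sum_range_succ', wGrad, Finset.mul_sum]
  have h0 : pderiv i.castSucc (wCoef ε K lam 0 •
      (rename Fin.castSucc (normSqPoly (fun i : Fin m => ε i.castSucc) ^ 0) *
        X (Fin.last m) ^ (K - 2 * 0))) = 0 := by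
    rw [Derivation.map_smul, pderiv_castSucc_rename_mul_pow]; simp
  rw [h0, add_zero]
  refine Finset.sum_congr rfl fun k _ => ?_
  rw [Derivation.map_smul, pderiv_castSucc_rename_mul_pow, Derivation.leibniz_pow,
    pderiv_normSqPoly]
  simp only [Nat.add_sub_cancel, smul_eq_mul, nsmul_eq_mul, map_mul, rename_C, rename_X,
    smul_eq_C_mul, map_add, map_natCast, map_ofNat, map_one]
  push_cast
  ring

/-- The coefficient of `|ξ'|^{2k} ξ_n^{K-2k-2}` receives a contribution of `□'` from the term `k +
1` and one of `ε_n ∂_n²` from the term `k`; their sum is evaluated by `wCoef_succ`. -/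
lemma boxL_wPoly {ε : Fin (m + 1) → ℝ} (hε : ∀ i, ε i ^ 2 = 1) (K : ℕ) (lam : ℂ) :
    boxL ε (wPoly ε K (-lam)) = (2 * (lam + K - 1)) • wGrad ε K lam := by
  set ε' : Fin m → ℝ := fun i => ε i.castSucc with hε'
  have hb0 : boxL ε' (1 : MvPolynomial (Fin m) ℂ) = 0 :=
    boxL_eq_zero_of_lt_two ε' (isHomogeneous_one (Fin m) ℂ) (by norm_num)
  have hbk : ∀ k : ℕ, boxL ε' (normSqPoly ε' ^ (k + 1)) =
      (2 * ((k : ℂ) + 1) * (m + 2 * k)) • normSqPoly ε' ^ k := by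
    intro k
    have := boxL_normSqPoly_pow_mul (ε := ε') (fun i => hε i.castSucc)
      (isHomogeneous_one (Fin m) ℂ) k
    rw [hb0, mul_zero, zero_add, mul_one, mul_one] at this
    simpa using this
  rw [wPoly_eq, map_sum]
  simp only [map_smul, boxL_rename_mul_pow, smul_add, Finset.sum_add_distrib]
  rw [Finset.sum_range_succ', Finset.sum_range_succ (fun k => wCoef ε K lam k •
    ((ε (Fin.last m) : ℂ) * ((K - 2 * k : ℕ) * ((K - 2 * k : ℕ) - 1))) • _)]
  have h0 : wCoef ε K lam 0 • (rename Fin.castSucc (boxL ε' (normSqPoly ε' ^ 0)) *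
      X (Fin.last m) ^ (K - 2 * 0)) = 0 := by rw [pow_zero, hb0]; simp
  -- In the last term the exponent of `ξ_n` is `0` or `1`, so `∂_n²` kills it.
  have hN : ((ε (Fin.last m) : ℂ) * (((K - 2 * (K / 2) : ℕ) : ℂ) *
      (((K - 2 * (K / 2) : ℕ) : ℂ) - 1))) = 0 := by
    rcases (show K - 2 * (K / 2) = 0 ∨ K - 2 * (K / 2) = 1 by omega) with h | h <;> rw [h] <;> simp
  rw [h0, hN, zero_smul, smul_zero, add_zero, add_zero, ← Finset.sum_add_distrib, wGrad,
    Finset.smul_sum]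
  refine Finset.sum_congr rfl fun k hk => ?_
  rw [Finset.mem_range] at hk
  have h1 : ((K - 2 * k : ℕ) : ℂ) = K - 2 * k := by
    rw [Nat.cast_sub (by omega)]; push_cast; ring
  rw [hbk, h1, map_smul, smul_mul_assoc, smul_smul, smul_smul, smul_smul,
    show K - 2 * k - 2 = K - 2 * (k + 1) by omega, ← add_smul]
  congr 1
  linear_combination -wCoef_succ ε K lam hk

/-- For the highest power of `|ξ'|²` the product in the renormalized coefficient is empty. Hence
`D_K(λ)` does not vanish for any `λ`. -/
lemma wCoef_half_ne_zero {ε : Fin (m + 1) → ℝ} (hε : ∀ i, ε i ^ 2 = 1) (K : ℕ) (lam : ℂ) :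
    wCoef ε K lam (K / 2) ≠ 0 := by
  have h1 : ((K / 2).factorial : ℂ) ≠ 0 := Nat.cast_ne_zero.2 (Nat.factorial_ne_zero _)
  have h2 : ((K - 2 * (K / 2)).factorial : ℂ) ≠ 0 := Nat.cast_ne_zero.2 (Nat.factorial_ne_zero _)
  have h3 : (ε (Fin.last m) : ℂ) ≠ 0 := fun h => by simpa [h] using sign_mul_self hε (Fin.last m)
  rw [wCoef, gegenCoef, Finset.Ico_eq_empty (by omega), Finset.prod_empty]
  split_ifs <;> simp [h1, h2, h3]

/-- At a point with `ξ_n = 0` and `|ξ'|² ≠ 0` only the highest power of `|ξ'|²` survives; for odd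
`K` one derivative in `ξ_n` is taken first. -/
lemma wPoly_ne_zero {ε : Fin (m + 1) → ℝ} (hε : ∀ i, ε i ^ 2 = 1) (hm : 0 < m) (K : ℕ) (lam : ℂ) :
    wPoly ε K (-lam) ≠ 0 := by
  intro h
  obtain ⟨i₁⟩ : Nonempty (Fin m) := ⟨⟨0, hm⟩⟩
  let x : Fin (m + 1) → ℂ := Pi.single i₁.castSucc 1
  have hlast : x (Fin.last m) = 0 := by
    simp [x, (Fin.castSucc_lt_last i₁).ne']
  have hR : eval x (rename Fin.castSucc (normSqPoly fun i : Fin m => ε i.castSucc)) =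
      (ε i₁.castSucc : ℂ) := by
    rw [eval_rename, normSqPoly, map_sum, Finset.sum_eq_single i₁]
    · simp [x]
    · intro i _ hi; simp [x, hi]
    · simp
  have hR0 : (ε i₁.castSucc : ℂ) ≠ 0 := fun h => by
    simpa [h] using sign_mul_self hε i₁.castSucc
  have key : wCoef ε K lam (K / 2) * (ε i₁.castSucc : ℂ) ^ (K / 2) = 0 := by
    rcases Nat.even_or_odd' K with ⟨N, hN | hN⟩
    · have h1 := congrArg (eval x) h
      rw [wPoly_eq, map_sum, map_zero, Finset.sum_eq_single (K / 2)] at h1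
      · simpa [smul_eq_C_mul, hR, show K - 2 * (K / 2) = 0 by omega] using h1
      · intro k hk hk'
        rw [Finset.mem_range] at hk
        simp [smul_eq_C_mul, hlast, show K - 2 * k ≠ 0 by omega]
      · simp
    · have h1 := congrArg (fun P => eval x (pderiv (Fin.last m) P)) h
      simp only [wPoly_eq, map_sum, Derivation.map_smul, pderiv_last_rename_mul_pow, map_zero] at h1
      rw [Finset.sum_eq_single (K / 2)] at h1
      · simpa [smul_eq_C_mul, hR, show K - 2 * (K / 2) = 1 by omega] using h1
      · intro k hk hk'
        rw [Finset.mem_range] at hk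
        simp [smul_eq_C_mul, hlast, show K - 2 * k - 1 ≠ 0 by omega]
      · simp
  exact mul_ne_zero (wCoef_half_ne_zero hε K lam) (pow_ne_zero _ hR0) key

lemma substPoly_extendOne_wPoly {ε : Fin (m + 1) → ℝ} {k : Matrix (Fin m) (Fin m) ℝ}
    (hk : OrthSmall (fun i => ε i.castSucc) k) (K : ℕ) (lam : ℂ) :
    substPoly (extendOne k) (wPoly ε K (-lam)) = wPoly ε K (-lam) := by
  rw [wPoly_eq, map_sum]
  refine Finset.sum_congr rfl fun l _ => ?_
  rw [map_smul, map_mul, substPoly_extendOne_rename, map_pow (substPoly k), map_pow (substPoly _),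
    substPoly_extendOne_X_last, substPoly_normSqPoly hk]

/-! ## Harmonic polynomials in the kernel of the composition -/

/-- `h(ξ') w_{K,-λ}(ξ)` is harmonic for `λ + K = 1 - deg h`. -/
lemma rename_mul_wPoly_mem_harm {ε : Fin (m + 1) → ℝ} (hε : ∀ i, ε i ^ 2 = 1) {K j : ℕ} {lam : ℂ}
    (hlam : lam + K = 1 - j) {h : MvPolynomial (Fin m) ℂ}
    (hh : h ∈ Harm (fun i => ε i.castSucc) j) :
    rename Fin.castSucc h * wPoly ε K (-lam) ∈ Harm ε (j + K) := by
  refine ⟨hh.1.rename_isHomogeneous.mul (isHomogeneous_wPoly ε K lam), ?_⟩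
  change boxL ε _ = 0
  have hb : boxL ε (rename Fin.castSucc h) = 0 := by
    have := boxL_rename_mul_pow ε h 0
    rw [show boxL (fun i => ε i.castSucc) h = 0 from hh.2] at this
    simpa using this
  -- Since `∂_i w = ε_i ξ_i g` for `i < n` and `h` does not depend on `ξ_n`, the cross term is the
  -- Euler operator on `h` times `g`.
  have hs : ∑ i, (ε i : ℂ) • (pderiv i (rename Fin.castSucc h) * pderiv i (wPoly ε K (-lam))) =
      (j : ℂ) • (rename Fin.castSucc h * wGrad ε K lam) := by
    have he : ∀ i : Fin m, (ε i.castSucc : ℂ) • (pderiv i.castSucc (rename Fin.castSucc h) *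
        pderiv i.castSucc (wPoly ε K (-lam))) =
        rename Fin.castSucc (X i * pderiv i h) * wGrad ε K lam := fun i => by
      have hs := congrArg (C (σ := Fin (m + 1))) (sign_mul_self hε i.castSucc)
      rw [C_mul, C_1] at hs
      rw [pderiv_castSucc_rename, pderiv_wPoly, smul_eq_C_mul, map_mul, rename_X]
      linear_combination X i.castSucc * rename Fin.castSucc (pderiv i h) * wGrad ε K lam * hs
    rw [Fin.sum_univ_castSucc, pderiv_last_rename, zero_mul, smul_zero, add_zero]
    simp only [he]
    rw [← Finset.sum_mul, ← map_sum, hh.1.sum_X_mul_pderiv]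
    simp [smul_eq_C_mul, nsmul_eq_mul, mul_assoc]
  rw [boxL_mul, hb, boxL_wPoly hε, hs, hlam, mul_zero, add_zero, mul_smul_comm, smul_smul,
    ← add_smul]
  -- The scalar `2(λ + K - 1)` from `□w` is `-2j` and cancels the cross term.
  have : (2 * (1 - (j : ℂ) - 1) + 2 * j) = 0 := by ring
  rw [this, zero_smul]

/-! ## The generators of the infinitesimal action -/

/-- The Euler operator `∑ x_i ∂_i`. -/
def eulerC (f : Cinf n) : Cinf n := ∑ i, xC i * pdC i f

/-- The function `|x|² / 2`. -/
def halfSqC (ε : Fin n → ℝ) : Cinf n := (1 / 2 : ℂ) • ∑ i, (ε i : ℂ) • (xC i * xC i)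

/-- The action of the `k`-th generator of `𝔫_+`. -/
def sctC (ε : Fin n → ℝ) (lam : ℂ) (k : Fin n) (f : Cinf n) : Cinf n :=
  lam • (xC k * f) + xC k * eulerC f - (ε k : ℂ) • (halfSqC ε * pdC k f)

lemma avC_i0 {ε : Fin n → ℝ} {A : Matrix (Idx n) (Idx n) ℂ} (hA : A ∈ lieG ε) :
    avC ε A i0 = A i0 i0 • 1 + ∑ j, A i0 (im j) • xC j := by
  rw [avC, sum_Idx, lieG_i0_i1 hA, zero_smul, add_zero]
  rfl

lemma avC_im {ε : Fin n → ℝ} (hε : ∀ i, ε i ^ 2 = 1) {A : Matrix (Idx n) (Idx n) ℂ}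
    (hA : A ∈ lieG ε) (i : Fin n) :
    avC ε A (im i) = A (im i) i0 • 1 + ∑ j, A (im i) (im j) • xC j +
      (A i0 (im i) * ε i) • halfSqC ε := by
  have h : A (im i) i1 = -(ε i * A i0 (im i)) := by
    rw [lieG_i0_im hA]
    linear_combination -(A (im i) i1) * sign_mul_self hε i
  have hv : vC ε i1 = -halfSqC ε := rfl
  rw [avC, sum_Idx, h, hv, neg_smul_neg, ← add_assoc, mul_comm (ε i : ℂ)]
  rfl

/-- This is the splitting of `𝔤` into the grading element, `𝔫_+`, `𝔫_-` and the rotations. Quadratic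
vector fields enter only through `sctC`. -/
lemma dpiC_eq {ε : Fin n → ℝ} (hε : ∀ i, ε i ^ 2 = 1) (lam : ℂ) {A : Matrix (Idx n) (Idx n) ℂ}
    (hA : A ∈ lieG ε) (f : Cinf n) :
    dpiC ε lam A f = A i0 i0 • (lam • f + eulerC f) + ∑ k, A i0 (im k) • sctC ε lam k f -
      ∑ i, A (im i) i0 • pdC i f - ∑ i, ∑ j, A (im i) (im j) • (xC j * pdC i f) := by
  have h1 : ∑ k, A i0 (im k) • sctC ε lam k f = (∑ k, A i0 (im k) • xC k) * (lam • f + eulerC f) -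
      ∑ k, ((A i0 (im k) * ε k) • halfSqC ε) * pdC k f := by
    rw [Finset.sum_mul, ← Finset.sum_sub_distrib]
    refine Finset.sum_congr rfl fun k _ => ?_
    simp only [sctC, Algebra.smul_def, map_mul]
    ring
  have h2 : fieldC ε A f = avC ε A i0 * eulerC f - ∑ i, avC ε A (im i) * pdC i f := by
    rw [fieldC_apply, eulerC, Finset.mul_sum, ← Finset.sum_sub_distrib]
    exact Finset.sum_congr rfl fun i _ => by ring
  have h3 : ∑ i, avC ε A (im i) * pdC i f = ∑ i, A (im i) i0 • pdC i f +
      ∑ i, ∑ j, A (im i) (im j) • (xC j * pdC i f) +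
      ∑ k, ((A i0 (im k) * ε k) • halfSqC ε) * pdC k f := by
    rw [← Finset.sum_add_distrib, ← Finset.sum_add_distrib]
    refine Finset.sum_congr rfl fun i _ => ?_
    rw [avC_im hε hA, add_mul, add_mul, Finset.sum_mul]
    simp only [smul_mul_assoc, one_mul]
  rw [dpiC_apply, h1, h2, h3, avC_i0 hA]
  simp only [Algebra.smul_def]
  ring

lemma dOp_eulerC {w : MvPolynomial (Fin n) ℂ} {K : ℕ} (hw : w.IsHomogeneous K) (f : Cinf n) :
    dOp w (eulerC f) = eulerC (dOp w f) + (K : ℂ) • dOp w f := by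
  have h : ∑ i, dOp (pderiv i w) (pdC i f) = (K : ℂ) • dOp w f := by
    have := congrArg (fun P => dOp P f) hw.sum_X_mul_pderiv
    simp only [map_sum, LinearMap.sum_apply, map_nsmul, LinearMap.smul_apply] at this
    rw [Nat.cast_smul_eq_nsmul, ← this]
    exact Finset.sum_congr rfl fun i _ => by rw [mul_comm, dOp_mul_X]
  rw [eulerC, map_sum, eulerC, ← h, ← Finset.sum_add_distrib]
  exact Finset.sum_congr rfl fun i _ => by rw [dOp_xC_mul, dOp_pdC]

/-- The second order operator of the F-method, for the `k`-th generator of `𝔫_+`. -/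
def fPoly (ε : Fin n → ℝ) (lam : ℂ) (K : ℕ) (k : Fin n) (w : MvPolynomial (Fin n) ℂ) :
    MvPolynomial (Fin n) ℂ :=
  (lam + K - 1) • pderiv k w - (1 / 2 * ε k : ℂ) • (X k * boxL ε w)

lemma dOp_halfSqC_mul (ε : Fin n → ℝ) (w : MvPolynomial (Fin n) ℂ) (f : Cinf n) :
    dOp w (halfSqC ε * f) = halfSqC ε * dOp w f + ∑ i, (ε i : ℂ) • (xC i * dOp (pderiv i w) f) +
      (1 / 2 : ℂ) • dOp (boxL ε w) f := by
  have h : ∀ i, dOp w (xC i * xC i * f) = xC i * xC i * dOp w f +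
      (2 : ℂ) • (xC i * dOp (pderiv i w) f) + dOp (pderiv i (pderiv i w)) f := by
    intro i
    rw [mul_assoc, dOp_xC_mul, dOp_xC_mul, dOp_xC_mul, two_smul]
    ring
  rw [halfSqC, smul_mul_assoc, Finset.sum_mul, map_smul, map_sum, boxL_apply, map_sum,
    LinearMap.sum_apply, smul_mul_assoc, Finset.sum_mul, Finset.smul_sum, Finset.smul_sum,
    Finset.smul_sum, ← Finset.sum_add_distrib, ← Finset.sum_add_distrib]
  refine Finset.sum_congr rfl fun i _ => ?_
  rw [smul_mul_assoc, map_smul, h, map_smul, LinearMap.smul_apply, smul_mul_assoc]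
  module

/-- Each coordinate moved to the left of `w(∂)` leaves a term with a derivative of the symbol.
Euler's identity shifts `λ` to `λ + K`. Terms that keep one coordinate form the rotations, and those
that keep none form `fPoly`. -/
lemma dOp_sctC (ε : Fin n → ℝ) (lam : ℂ) {w : MvPolynomial (Fin n) ℂ} {K : ℕ}
    (hw : w.IsHomogeneous K) (k : Fin n) (f : Cinf n) :
    dOp w (sctC ε lam k f) = sctC ε (lam + K) k (dOp w f) +
      ∑ i, xC i * dOp (X i * pderiv k w - (ε k * ε i : ℂ) • (X k * pderiv i w)) f +
      dOp (fPoly ε lam K k w) f := by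
  have hk : (pderiv k w).IsHomogeneous (K - 1) := hw.pderiv
  -- The truncated `K - 1` is harmless: for `K = 0` the derivative of `w` vanishes.
  have hK : ((K - 1 : ℕ) : ℂ) • dOp (pderiv k w) f = ((K : ℂ) - 1) • dOp (pderiv k w) f := by
    rcases K with _ | K
    · rw [pderiv_eq_zero_of_isHomogeneous_zero hw]; simp
    · congr 1; simp
  have h1 : dOp w (xC k * eulerC f) = xC k * eulerC (dOp w f) + (K : ℂ) • (xC k * dOp w f) +
      ∑ i, xC i * dOp (X i * pderiv k w) f + ((K : ℂ) - 1) • dOp (pderiv k w) f := by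
    rw [dOp_xC_mul, dOp_eulerC hw, dOp_eulerC hk, hK, eulerC, eulerC, mul_add, mul_smul_comm]
    simp only [dOp_X_mul]
    abel
  have h2 : dOp w (halfSqC ε * pdC k f) = halfSqC ε * pdC k (dOp w f) +
      ∑ i, (ε i : ℂ) • (xC i * dOp (X k * pderiv i w) f) +
      (1 / 2 : ℂ) • dOp (X k * boxL ε w) f := by
    rw [dOp_halfSqC_mul]
    simp only [dOp_pdC, dOp_X_mul]
  have h3 : ∑ i, xC i * dOp (X i * pderiv k w - (ε k * ε i : ℂ) • (X k * pderiv i w)) f =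
      ∑ i, xC i * dOp (X i * pderiv k w) f -
        (ε k : ℂ) • ∑ i, (ε i : ℂ) • (xC i * dOp (X k * pderiv i w) f) := by
    rw [Finset.smul_sum, ← Finset.sum_sub_distrib]
    refine Finset.sum_congr rfl fun i _ => ?_
    rw [map_sub, LinearMap.sub_apply, map_smul, LinearMap.smul_apply, mul_sub, mul_smul_comm,
      smul_smul]
  rw [h3, sctC, map_sub, map_add, map_smul, map_smul, dOp_xC_mul, h1, h2, sctC, fPoly, map_sub,
    map_smul, map_smul, LinearMap.sub_apply, LinearMap.smul_apply, LinearMap.smul_apply]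
  module

lemma mul_zero_apply (i : Fin n) (g : Cinf n) : (xC i * g).1 0 = 0 := by
  change ((0 : ℝ) : ℂ) * g.1 0 = 0
  simp

lemma sctC_zero_apply (ε : Fin n → ℝ) (lam : ℂ) (k : Fin n) (f : Cinf n) :
    (sctC ε lam k f).1 0 = 0 := by
  have h : (halfSqC ε).1 0 = 0 := by
    change (1 / 2 : ℂ) * (∑ i, (ε i : ℂ) • (xC i * xC i) : Cinf n).1 0 = 0
    rw [sum_Cinf_apply, Finset.sum_eq_zero, mul_zero]
    intro i _
    change (ε i : ℂ) * (xC i * xC i : Cinf n).1 0 = 0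
    rw [mul_zero_apply, mul_zero]
  change lam * (xC k * f).1 0 + (xC k * eulerC f).1 0 - ε k * ((halfSqC ε).1 0 * (pdC k f).1 0) = 0
  rw [mul_zero_apply, mul_zero_apply, h]
  ring

lemma dOp_sctC_zero (ε : Fin n → ℝ) (lam : ℂ) {w : MvPolynomial (Fin n) ℂ} {K : ℕ}
    (hw : w.IsHomogeneous K) (k : Fin n) (hP : fPoly ε lam K k w = 0) (f : Cinf n) :
    (dOp w (sctC ε lam k f)).1 0 = 0 := by
  rw [dOp_sctC ε lam hw, hP, map_zero, LinearMap.zero_apply, add_zero]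
  change (sctC ε (lam + K) k (dOp w f)).1 0 + (∑ i, _ : Cinf n).1 0 = 0
  rw [sctC_zero_apply, sum_Cinf_apply, zero_add]
  exact Finset.sum_eq_zero fun i _ => mul_zero_apply i _

/-- For `λ + K = 1` the first order term has coefficient zero, so harmonicity alone suffices, also
for `k = n`. -/
lemma fPoly_harm {ε : Fin n → ℝ} {K : ℕ} {lam : ℂ} (hlam : lam + K = 1)
    {w : MvPolynomial (Fin n) ℂ} (hw : w ∈ Harm ε K) (k : Fin n) : fPoly ε lam K k w = 0 := by
  have h0 : boxL ε w = 0 := hw.2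
  rw [fPoly, h0, hlam]
  simp

lemma nplus_mem {ε : Fin n → ℝ} (hε : ∀ i, ε i ^ 2 = 1) (Z : Fin n → ℂ) : nplus ε Z ∈ lieG ε := by
  rw [mem_lieG_iff]
  simp only [forall_Idx, quadMat_mul_i0, quadMat_mul_i1, quadMat_mul_im]
  have : ∀ i, (ε i : ℂ) * (ε i * Z i) = Z i := fun i => by
    rw [← mul_assoc, sign_mul_self hε, one_mul]
  simp [nplus, this]

lemma dpiC_nplus {ε : Fin n → ℝ} (hε : ∀ i, ε i ^ 2 = 1) (lam : ℂ) (Z : Fin n → ℂ) (f : Cinf n) :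
    dpiC ε lam (nplus ε Z) f = ∑ k, Z k • sctC ε lam k f := by
  rw [dpiC_eq hε lam (nplus_mem hε Z)]
  simp [nplus]

lemma isSingular_of_fPoly {ε : Fin (m + 1) → ℝ} (hε : ∀ i, ε i ^ 2 = 1) {lam : ℂ} {K : ℕ}
    {w : MvPolynomial (Fin (m + 1)) ℂ} (hw : w.IsHomogeneous K)
    (hP : ∀ k : Fin m, fPoly ε lam K k.castSucc w = 0) :
    IsSingular ε (-lam) (symbVec ε lam K w) := by
  refine isSingular_symbVec fun Z hZ f => ?_
  rw [dpiC_nplus hε, Fin.sum_univ_castSucc, hZ, zero_smul, add_zero, map_sum, sum_Cinf_apply]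
  refine Finset.sum_eq_zero fun k _ => ?_
  rw [map_smul]
  change Z k.castSucc * (dOp w (sctC ε lam k.castSucc f)).1 0 = 0
  rw [dOp_sctC_zero ε lam hw _ (hP k), mul_zero]

/-! ## Restriction to the hyperplane -/

lemma contDiff_incl : ContDiff ℝ ∞ (incl : (Fin m → ℝ) → Fin (m + 1) → ℝ) := by
  rw [contDiff_pi]
  intro i
  refine Fin.lastCases ?_ (fun i => ?_) i
  · simp only [incl, Fin.snoc_last]; exact contDiff_const
  · simp only [incl, Fin.snoc_castSucc]; exact contDiff_apply ℝ ℝ i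

/-- Restriction to `x_n = 0` as a homomorphism of algebras. -/
def restrC : Cinf (m + 1) →ₐ[ℂ] Cinf m where
  toFun f := ⟨restr f.1, mem_Cinf.2 ((smooth_Cinf f).comp contDiff_incl)⟩
  map_one' := rfl
  map_mul' _ _ := rfl
  map_zero' := rfl
  map_add' _ _ := rfl
  commutes' _ := rfl

@[simp] lemma restrC_coe (f : Cinf (m + 1)) : (restrC f).1 = restr f.1 := rfl

lemma restrC_xC_castSucc (i : Fin m) : restrC (xC i.castSucc) = xC i := by
  ext x
  change ((incl x i.castSucc : ℝ) : ℂ) = x i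
  simp [incl]

lemma restrC_xC_last : restrC (xC (Fin.last m)) = 0 := by
  ext x
  change ((incl x (Fin.last m) : ℝ) : ℂ) = 0
  simp [incl]

lemma pdC_restrC (i : Fin m) (f : Cinf (m + 1)) :
    pdC i (restrC f) = restrC (pdC i.castSucc f) := by
  ext x
  let Λ : (Fin m → ℝ) →L[ℝ] (Fin (m + 1) → ℝ) := ContinuousLinearMap.pi
    (Fin.snoc (α := fun _ => (Fin m → ℝ) →L[ℝ] ℝ) (fun i => ContinuousLinearMap.proj i) 0)
  have hΛ : ∀ y, Λ y = incl y := by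
    intro y
    ext a
    refine Fin.lastCases ?_ (fun a => ?_) a <;> simp [Λ, incl]
  have h : HasFDerivAt (fun y : Fin m → ℝ => f.1 (incl y)) ((fderiv ℝ f.1 (incl x)).comp Λ) x := by
    have h1 : HasFDerivAt (fun y : Fin m → ℝ => incl y) Λ x := by
      simp only [← hΛ]; exact Λ.hasFDerivAt
    exact (diffAt_Cinf f (incl x)).hasFDerivAt.comp x h1
  change fderiv ℝ (fun y : Fin m → ℝ => f.1 (incl y)) x _ = fderiv ℝ f.1 (incl x) _
  rw [h.fderiv, ContinuousLinearMap.comp_apply, hΛ]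
  congr 1
  ext a
  refine Fin.lastCases ?_ (fun a => ?_) a
  · simp [incl, (Fin.castSucc_lt_last i).ne]
  · simp [incl, Pi.single_apply]

lemma restrC_eulerC (f : Cinf (m + 1)) : restrC (eulerC f) = eulerC (restrC f) := by
  rw [eulerC, Fin.sum_univ_castSucc, map_add, map_mul, restrC_xC_last, zero_mul, add_zero, map_sum,
    eulerC]
  exact Finset.sum_congr rfl fun i _ => by rw [map_mul, restrC_xC_castSucc, pdC_restrC]

lemma restrC_halfSqC (ε : Fin (m + 1) → ℝ) :
    restrC (halfSqC ε) = halfSqC fun i => ε i.castSucc := by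
  rw [halfSqC, Fin.sum_univ_castSucc, map_smul, map_add, map_smul, map_mul, restrC_xC_last,
    zero_mul, smul_zero, add_zero, map_sum, halfSqC]
  congr 1
  exact Finset.sum_congr rfl fun i _ => by rw [map_smul, map_mul, restrC_xC_castSucc]

lemma restrC_sctC (ε : Fin (m + 1) → ℝ) (lam : ℂ) (k : Fin m) (f : Cinf (m + 1)) :
    restrC (sctC ε lam k.castSucc f) = sctC (fun i => ε i.castSucc) lam k (restrC f) := by
  rw [sctC, map_sub, map_add, map_smul, map_smul, map_mul, map_mul, map_mul, restrC_xC_castSucc,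
    restrC_eulerC, restrC_halfSqC, ← pdC_restrC, sctC]

lemma restrC_dOp_rename (h : MvPolynomial (Fin m) ℂ) (f : Cinf (m + 1)) :
    restrC (dOp (rename Fin.castSucc h) f) = dOp h (restrC f) := by
  induction h using MvPolynomial.induction_on generalizing f with
  | C a => rw [rename_C, dOp_C, dOp_C, map_smul]
  | add p q hp hq => simp only [map_add, LinearMap.add_apply, hp, hq]
  | mul_X p i hp => rw [map_mul, rename_X, dOp_mul_X, dOp_mul_X, hp, pdC_restrC]

/-! ## Intertwining property -/

lemma toSmall_mem {ε : Fin (m + 1) → ℝ} {A : Matrix (Idx (m + 1)) (Idx (m + 1)) ℂ}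
    (hA : A ∈ lieG ε) : toSmall A ∈ lieG (fun i => ε i.castSucc) := by
  have h := mem_lieG_iff.1 hA
  rw [mem_lieG_iff]
  simp only [forall_Idx, quadMat_mul_i0, quadMat_mul_i1, quadMat_mul_im] at h ⊢
  obtain ⟨⟨h1, h2, h3⟩, h4, h5, h6, h7⟩ := h
  refine ⟨⟨h1, fun i => h2 i.castSucc, h3⟩, fun i => ?_, h5, fun i => h6 i.castSucc, h7⟩
  obtain ⟨h8, h9, h10⟩ := h4 i.castSucc
  exact ⟨h8, fun j => h9 j.castSucc, h10⟩

section Intertwining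

variable {ε : Fin (m + 1) → ℝ} {lam : ℂ} {K : ℕ} {w g : MvPolynomial (Fin (m + 1)) ℂ}

/-- The gradient of `w` in `ξ'` is radial with respect to the form, so `w` is invariant under the
infinitesimal rotations of `ℝ^{p-1,q-2}`. -/
lemma rotation_eq_zero (hε : ∀ i, ε i ^ 2 = 1)
    (hg : ∀ i : Fin m, pderiv i.castSucc w = C (ε i.castSucc : ℂ) * X i.castSucc * g)
    (i k : Fin m) : X i.castSucc * pderiv k.castSucc w -
      (ε k.castSucc * ε i.castSucc : ℂ) • (X k.castSucc * pderiv i.castSucc w) = 0 := by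
  have hs := congrArg (C (σ := Fin (m + 1))) (sign_mul_self hε i.castSucc)
  rw [C_mul, C_1] at hs
  rw [hg, hg, smul_eq_C_mul, C_mul]
  linear_combination -X i.castSucc * C (ε k.castSucc : ℂ) * X k.castSucc * g * hs

/-- With a radial gradient, the `k`-th equation is `ε_k ξ_k` times one scalar equation, namely `hb`.
-/
lemma fPoly_eq_zero (hg : ∀ i : Fin m, pderiv i.castSucc w = C (ε i.castSucc : ℂ) * X i.castSucc * g)
    (hb : boxL ε w = (2 * (lam + K - 1)) • g) (k : Fin m) :
    fPoly ε lam K k.castSucc w = 0 := by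
  have : (2 * (lam + K - 1)) • g = C 2 * C (lam + K - 1) * g := by rw [smul_eq_C_mul, C_mul]
  have h2 : (C (1 / 2) * C 2 : MvPolynomial (Fin (m + 1)) ℂ) = 1 := by
    rw [← C_mul, ← C_1]; norm_num
  rw [fPoly, hg, hb, this, smul_eq_C_mul, smul_eq_C_mul, C_mul]
  linear_combination -C (lam + K - 1) * C (ε k.castSucc : ℂ) * X k.castSucc * g * h2

lemma sum_rotation_eq_zero (hε : ∀ i, ε i ^ 2 = 1)
    (hg : ∀ i : Fin m, pderiv i.castSucc w = C (ε i.castSucc : ℂ) * X i.castSucc * g)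
    {A : Matrix (Idx (m + 1)) (Idx (m + 1)) ℂ} (hA : A ∈ lieG ε) :
    ∑ i : Fin m, ∑ j : Fin m, A (im i.castSucc) (im j.castSucc) •
      (pderiv j.castSucc w * X i.castSucc) = 0 := by
  have e : ∀ i j : Fin m, A (im i.castSucc) (im j.castSucc) •
      (pderiv j.castSucc w * X i.castSucc) =
      (A (im i.castSucc) (im j.castSucc) * ε j.castSucc) •
        (X i.castSucc * X j.castSucc * g) := fun i j => by
    rw [hg, smul_eq_C_mul, smul_eq_C_mul, C_mul]
    ring
  simp only [e]
  have h2 : ∀ S : MvPolynomial (Fin (m + 1)) ℂ, S = -S → S = 0 := fun S h => by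
    have : S = (1 / 2 : ℂ) • (S + S) := by module
    rw [this]; nth_rewrite 2 [h]; simp
  refine h2 _ ?_
  conv_lhs => rw [Finset.sum_comm]
  rw [← Finset.sum_neg_distrib]
  refine Finset.sum_congr rfl fun i _ => ?_
  rw [← Finset.sum_neg_distrib]
  refine Finset.sum_congr rfl fun j _ => ?_
  rw [← neg_smul, mul_comm (X j.castSucc)]
  congr 1
  have h3 := lieG_im_im hA i.castSucc j.castSucc
  linear_combination (ε i.castSucc * ε j.castSucc * h3 -
    A (im i.castSucc) (im j.castSucc) * ε j.castSucc * sign_mul_self hε i.castSucc -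
    A (im j.castSucc) (im i.castSucc) * ε i.castSucc * sign_mul_self hε j.castSucc)

/-- A homogeneous polynomial `w` that solves the equations of the F-method defines an intertwining
operator. -/
lemma restrC_dOp_dpiC (hε : ∀ i, ε i ^ 2 = 1) (hw : w.IsHomogeneous K)
    (hg : ∀ i : Fin m, pderiv i.castSucc w = C (ε i.castSucc : ℂ) * X i.castSucc * g)
    (hb : boxL ε w = (2 * (lam + K - 1)) • g)
    {A : Matrix (Idx (m + 1)) (Idx (m + 1)) ℂ} (hA : A ∈ lieG ε) (hA' : InG' A)
    (f : Cinf (m + 1)) :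
    restrC (dOp w (dpiC ε lam A f)) =
      dpiC (fun i => ε i.castSucc) (lam + K) (toSmall A) (restrC (dOp w f)) := by
  -- An element of `𝔤` whose `e_n`-column vanishes has vanishing `e_n`-row as well, by skewness.
  have hn0 : A (im (Fin.last m)) i0 = 0 := by
    have h1 := mem_lieG_iff.1 hA (im (Fin.last m)) i0
    rw [quadMat_mul_im, quadMat_mul_i0, hA' i1, neg_zero] at h1
    exact (mul_eq_zero.1 h1).resolve_left fun h => by
      simpa [h] using sign_mul_self hε (Fin.last m)
  have hni : ∀ i, A (im (Fin.last m)) (im i) = 0 := fun i => by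
    have h1 := lieG_im_im hA (Fin.last m) i
    rw [hA' (im i), mul_zero, neg_zero] at h1
    exact (mul_eq_zero.1 h1).resolve_left fun h => by
      simpa [h] using sign_mul_self hε (Fin.last m)
  have hE : restrC (dOp w (lam • f + eulerC f)) =
      (lam + K) • restrC (dOp w f) + eulerC (restrC (dOp w f)) := by
    rw [map_add, map_smul, dOp_eulerC hw, map_add, map_add, map_smul, map_smul, restrC_eulerC]
    module
  have hs : restrC (dOp w (∑ k, A i0 (im k) • sctC ε lam k f)) =
      ∑ k : Fin m, A i0 (im k.castSucc) •
        sctC (fun i => ε i.castSucc) (lam + K) k (restrC (dOp w f)) := by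
    rw [Fin.sum_univ_castSucc, hA' i0, zero_smul, add_zero, map_sum, map_sum]
    refine Finset.sum_congr rfl fun k _ => ?_
    -- Of the rotation terms, those with `i < n` vanish identically, and the one with `i = n`
    -- carries the factor `x_n`, which restricts to zero.
    rw [map_smul, map_smul, dOp_sctC ε lam hw, fPoly_eq_zero hg hb, map_zero,
      LinearMap.zero_apply, add_zero, map_add,
      restrC_sctC, Fin.sum_univ_castSucc, map_add, map_mul, restrC_xC_last, zero_mul, add_zero,
      Finset.sum_eq_zero, map_zero, add_zero]
    intro i _
    rw [rotation_eq_zero hε hg, map_zero, LinearMap.zero_apply, mul_zero]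
  have hd : restrC (dOp w (∑ i, A (im i) i0 • pdC i f)) =
      ∑ i : Fin m, A (im i.castSucc) i0 • pdC i (restrC (dOp w f)) := by
    rw [Fin.sum_univ_castSucc, hn0, zero_smul, add_zero, map_sum, map_sum]
    refine Finset.sum_congr rfl fun i _ => ?_
    rw [map_smul, map_smul, dOp_pdC, pdC_restrC]
  have hr : restrC (dOp w (∑ i, ∑ j, A (im i) (im j) • (xC j * pdC i f))) =
      ∑ i : Fin m, ∑ j : Fin m, A (im i.castSucc) (im j.castSucc) •
        (xC j * pdC i (restrC (dOp w f))) := by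
    have h0 : ∑ j, A (im (Fin.last m)) (im j) • (xC j * pdC (Fin.last m) f) = 0 :=
      Finset.sum_eq_zero fun j _ => by rw [hni, zero_smul]
    have h1 : ∀ i : Fin m, ∑ j, A (im i.castSucc) (im j) • (xC j * pdC i.castSucc f) =
        ∑ j : Fin m, A (im i.castSucc) (im j.castSucc) • (xC j.castSucc * pdC i.castSucc f) :=
      fun i => by rw [Fin.sum_univ_castSucc, hA' (im i.castSucc), zero_smul, add_zero]
    have h2 : ∀ i j : Fin m, dOp w (A (im i.castSucc) (im j.castSucc) •
        (xC j.castSucc * pdC i.castSucc f)) =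
        A (im i.castSucc) (im j.castSucc) • (xC j.castSucc * pdC i.castSucc (dOp w f)) +
        dOp (A (im i.castSucc) (im j.castSucc) • (pderiv j.castSucc w * X i.castSucc)) f := by
      intro i j
      rw [map_smul, dOp_xC_mul, dOp_pdC, smul_add, map_smul, LinearMap.smul_apply, dOp_mul_X]
    rw [Fin.sum_univ_castSucc, h0, add_zero]
    simp only [h1]
    rw [map_sum]
    simp only [map_sum (dOp w), h2, Finset.sum_add_distrib]
    simp only [← LinearMap.sum_apply, ← map_sum dOp]
    rw [sum_rotation_eq_zero hε hg hA, map_zero, LinearMap.zero_apply, add_zero, map_sum]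
    refine Finset.sum_congr rfl fun i _ => ?_
    rw [map_sum]
    refine Finset.sum_congr rfl fun j _ => ?_
    rw [map_smul, map_mul, restrC_xC_castSucc, pdC_restrC]
  rw [dpiC_eq hε lam hA, map_sub, map_sub, map_sub, map_sub, map_add, map_add, hs, hd, hr, map_smul,
    map_smul, hE, dpiC_eq (fun i => hε i.castSucc) _ (toSmall_mem hA)]
  rfl

end Intertwining

/-! ## The operators `D_K(λ)` -/

lemma iterate_pd_coe (i : Fin n) (e : ℕ) (f : Cinf n) : (pd i)^[e] f.1 = (dOp (X i ^ e) f).1 := by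
  induction e with
  | zero => simp
  | succ e ih => rw [Function.iterate_succ_apply', ih, pow_succ', dOp_X_mul]; rfl

lemma box'_coe (ε : Fin (m + 1) → ℝ) (f : Cinf (m + 1)) :
    box' ε f.1 = (dOp (rename Fin.castSucc (normSqPoly fun i : Fin m => ε i.castSucc)) f).1 := by
  funext x
  rw [normSqPoly, map_sum, map_sum, LinearMap.sum_apply, sum_Cinf_apply, box']
  refine Finset.sum_congr rfl fun i _ => ?_
  rw [map_mul, rename_C, dOp_C_mul, map_pow, rename_X, sq, dOp_X_mul, dOp_X]
  rfl

lemma iterate_neg_box'_coe (ε : Fin (m + 1) → ℝ) (j : ℕ) (f : Cinf (m + 1)) :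
    (fun u => -box' ε u)^[j] f.1 = ((-1 : ℂ) ^ j • dOp (rename Fin.castSucc
      (normSqPoly (fun i : Fin m => ε i.castSucc) ^ j)) f).1 := by
  induction j with
  | zero => simp
  | succ j ih =>
    rw [Function.iterate_succ_apply', ih, box'_coe, map_smul, pow_succ' (normSqPoly _), map_mul,
      map_mul dOp, Module.End.mul_apply, pow_succ]
    ext x
    simp

/-- Under `k ↦ 2N - 1 - k` each factor of `a_j(-λ)` becomes `-2(α + i)` with `α = λ - m/2`. The
resulting power of `-2` combines with the given one to `2^{2N-2j}`. -/
lemma aCoef_neg (N : ℕ) {j : ℕ} (hj : j ≤ N) (lam : ℂ) :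
    aCoef (m + 1) N j (-lam) = (N.factorial : ℂ) * gegenCoef (2 * N) (lam - (m : ℂ) / 2) j := by
  have hprod : ∏ k ∈ Finset.Ico j N, (2 * -lam - 4 * N + 2 * k + ((m + 1 : ℕ) : ℂ) + 1) =
      (-2) ^ (N - j) * ∏ i ∈ Finset.Ico N (2 * N - j), (lam - (m : ℂ) / 2 + i) := by
    -- For `N = 0` the truncated `2N - 1` would spoil the reflection.
    rcases Nat.eq_zero_or_pos N with rfl | hN
    · simp
    have h := Finset.prod_Ico_reflect (fun i : ℕ => lam - (m : ℂ) / 2 + i) j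
      (show N ≤ (2 * N - 1) + 1 by omega)
    rw [show 2 * N - 1 + 1 - N = N by omega, show 2 * N - 1 + 1 - j = 2 * N - j by omega] at h
    have hc : ((-2 : ℂ)) ^ (N - j) = ∏ _k ∈ Finset.Ico j N, (-2 : ℂ) := by simp
    rw [← h, hc, ← Finset.prod_mul_distrib]
    refine Finset.prod_congr rfl fun k hk => ?_
    rw [Finset.mem_Ico] at hk
    rw [Nat.cast_sub (by omega), Nat.cast_sub (by omega)]
    push_cast
    ring
  have h2 : (2 : ℂ) ^ (2 * N - 2 * j) = (-2) ^ (N - j) * (-2) ^ (N - j) := by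
    rw [← mul_pow, show 2 * N - 2 * j = 2 * (N - j) by omega, pow_mul]; norm_num
  rw [aCoef, hprod, gegenCoef, h2, show (2 * N + 1) / 2 = N by omega]
  ring

/-- Here the reflection is `k ↦ 2N - k`, and the surplus factor `2` in `2^{2N+1-2j}` explains the
normalization by one half. -/
lemma bCoef_neg (N : ℕ) {j : ℕ} (hj : j ≤ N) (lam : ℂ) :
    bCoef (m + 1) N j (-lam) =
      (N.factorial : ℂ) / 2 * gegenCoef (2 * N + 1) (lam - (m : ℂ) / 2) j := by
  have hprod : ∏ k ∈ Finset.Ico j N, (2 * -lam - 4 * N + 2 * k + ((m + 1 : ℕ) : ℂ) - 1) =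
      (-2) ^ (N - j) * ∏ i ∈ Finset.Ico (N + 1) (2 * N + 1 - j), (lam - (m : ℂ) / 2 + i) := by
    have h := Finset.prod_Ico_reflect (fun i : ℕ => lam - (m : ℂ) / 2 + i) j
      (show N ≤ 2 * N + 1 by omega)
    rw [show 2 * N + 1 - N = N + 1 by omega] at h
    have hc : ((-2 : ℂ)) ^ (N - j) = ∏ _k ∈ Finset.Ico j N, (-2 : ℂ) := by simp
    rw [← h, hc, ← Finset.prod_mul_distrib]
    refine Finset.prod_congr rfl fun k hk => ?_
    rw [Finset.mem_Ico] at hk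
    rw [Nat.cast_sub (by omega)]
    push_cast
    ring
  have h2 : (2 : ℂ) ^ (2 * N + 1 - 2 * j) = 2 * ((-2) ^ (N - j) * (-2) ^ (N - j)) := by
    rw [← mul_pow, show 2 * N + 1 - 2 * j = 2 * (N - j) + 1 by omega, pow_succ, pow_mul]
    norm_num [mul_comm]
  rw [bCoef, hprod, gegenCoef, h2, show (2 * N + 1 + 1) / 2 = N + 1 by omega,
    show 2 * N + 1 - 2 * j = 2 * N - 2 * j + 1 by omega]
  ring

lemma dOp_wPoly_apply (ε : Fin (m + 1) → ℝ) (K : ℕ) (lam : ℂ) (f : Cinf (m + 1))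
    (x : Fin (m + 1) → ℝ) :
    (dOp (wPoly ε K (-lam)) f).1 x = ∑ j ∈ Finset.range (K / 2 + 1), wCoef ε K lam j *
      (dOp (rename Fin.castSucc (normSqPoly (fun i : Fin m => ε i.castSucc) ^ j))
        (dOp (X (Fin.last m) ^ (K - 2 * j)) f)).1 x := by
  rw [wPoly_eq, map_sum, LinearMap.sum_apply, sum_Cinf_apply]
  refine Finset.sum_congr rfl fun j _ => ?_
  rw [map_smul, map_mul, LinearMap.smul_apply, Module.End.mul_apply]
  rfl

lemma smul_Cinf_apply (c : ℂ) (f : Cinf n) (x : Fin n → ℝ) : (c • f).1 x = c * f.1 x := rfl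

/-- The signs of `(-□')^j` are the powers of `ε_n = -1` in `wPoly`. -/
lemma Deven_coe {ε : Fin (m + 1) → ℝ} (hl : ε (Fin.last m) = -1) (N : ℕ) (lam : ℂ)
    (f : Cinf (m + 1)) : Deven ε N lam f.1 = (dOp (wPoly ε (2 * N) (-lam)) f).1 := by
  funext x
  rw [dOp_wPoly_apply, Deven, show 2 * N / 2 = N by omega]
  refine Finset.sum_congr rfl fun j hj => ?_
  rw [Finset.mem_range] at hj
  rw [iterate_pd_coe, iterate_neg_box'_coe, aCoef_neg N (by omega), wCoef, hl]
  rw [smul_Cinf_apply]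
  rw [show 2 * N / 2 = N by omega, if_pos (by omega)]
  push_cast
  ring

lemma Dodd_coe {ε : Fin (m + 1) → ℝ} (hl : ε (Fin.last m) = -1) (N : ℕ) (lam : ℂ)
    (f : Cinf (m + 1)) : Dodd ε N lam f.1 = (dOp (wPoly ε (2 * N + 1) (-lam)) f).1 := by
  funext x
  rw [dOp_wPoly_apply, Dodd, show (2 * N + 1) / 2 = N by omega]
  refine Finset.sum_congr rfl fun j hj => ?_
  rw [Finset.mem_range] at hj
  rw [iterate_pd_coe, iterate_neg_box'_coe, bCoef_neg N (by omega), wCoef, hl,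
    show 2 * N + 1 - 2 * j = 2 * N - 2 * j + 1 by omega]
  rw [smul_Cinf_apply]
  rw [show (2 * N + 1) / 2 = N by omega, if_neg (by omega)]
  push_cast
  ring

lemma juhlD_coe {ε : Fin (m + 1) → ℝ} (hl : ε (Fin.last m) = -1) (K : ℕ) (lam : ℂ)
    (f : Cinf (m + 1)) : juhlD ε K lam f.1 = (dOp (wPoly ε K (-lam)) f).1 := by
  unfold juhlD
  split_ifs with h
  · rw [Deven_coe hl, show 2 * (K / 2) = K by omega]
  · rw [Dodd_coe hl, show 2 * (K / 2) + 1 = K by omega]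

lemma isDiffOpOfOrder_of_coe {ε : Fin (m + 1) → ℝ} (hε : ∀ i, ε i ^ 2 = 1) (hm : 0 < m) (K : ℕ)
    (lam : ℂ) {D : ((Fin (m + 1) → ℝ) → ℂ) → (Fin (m + 1) → ℝ) → ℂ}
    (hD : ∀ f : Cinf (m + 1), D f.1 = (dOp (wPoly ε K (-lam)) f).1) : IsDiffOpOfOrder K D :=
  ⟨wPoly ε K (-lam), wPoly_ne_zero hε hm K lam,
    (isHomogeneous_wPoly ε K lam).totalDegree (wPoly_ne_zero hε hm K lam), fun f hf => by
      rw [hD ⟨f, mem_Cinf.2 hf⟩]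
      exact (polyOp_coe (wPoly ε K (-lam)) ⟨f, mem_Cinf.2 hf⟩).symm⟩

lemma infIntertwines_of_coe {ε : Fin (m + 1) → ℝ} (hε : ∀ i, ε i ^ 2 = 1) (K : ℕ)
    (lam : ℂ) {D : ((Fin (m + 1) → ℝ) → ℂ) → (Fin (m + 1) → ℝ) → ℂ}
    (hD : ∀ f : Cinf (m + 1), D f.1 = (dOp (wPoly ε K (-lam)) f).1) :
    InfIntertwines ε lam (lam + K) fun f => restr (D f) := by
  intro A hA hA' f hf
  have h := restrC_dOp_dpiC hε (isHomogeneous_wPoly ε K lam) (pderiv_wPoly ε K lam)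
    (boxL_wPoly hε K lam) hA hA' ⟨f, mem_Cinf.2 hf⟩
  have h2 := congrArg Subtype.val h
  rw [← dpi_coe, restrC_coe, restrC_coe, ← hD, ← hD, ← dpi_coe] at h2
  exact h2

lemma isSingular_wPoly {ε : Fin (m + 1) → ℝ} (hε : ∀ i, ε i ^ 2 = 1) (K : ℕ) (lam : ℂ) :
    IsSingular ε (-lam) (symbVec ε lam K (wPoly ε K (-lam))) :=
  isSingular_of_fPoly hε (isHomogeneous_wPoly ε K lam) fun k =>
    fPoly_eq_zero (pderiv_wPoly ε K lam) (boxL_wPoly hε K lam) k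

lemma isSingular_harm {ε : Fin (m + 1) → ℝ} (hε : ∀ i, ε i ^ 2 = 1) {d : ℕ} {lam : ℂ}
    (hlam : lam + d = 1) {w : MvPolynomial (Fin (m + 1)) ℂ} (hw : w ∈ Harm ε d) :
    IsSingular ε (-lam) (symbVec ε lam d w) :=
  isSingular_of_fPoly hε hw.1 fun k => fPoly_harm hlam hw k.castSucc

lemma sgn_sq (p n : ℕ) (i : Fin n) : sgn p n i ^ 2 = 1 := by
  unfold sgn; split_ifs <;> norm_num

lemma sgn_last {p q m : ℕ} (hq : 2 ≤ q) (hn : p + q = m + 3) : sgn p (m + 1) (Fin.last m) = -1 := by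
  unfold sgn
  rw [if_neg]
  rw [Fin.val_last]; omega

/-! ## Orthogonal matrices -/

lemma quadMat_mul_self {ε : Fin n → ℝ} (hε : ∀ i, ε i ^ 2 = 1) : quadMat ε * quadMat ε = 1 := by
  ext a b
  rcases a with a | a | a <;> rcases b with b | b | b <;>
    simp [Matrix.mul_apply, quadMat, Fintype.sum_sum_type, Matrix.one_apply]
  by_cases h : a = b
  · subst h
    simp [← sq, hε]
  · simp [h]

lemma mul_quadMat_transpose {ε : Fin n → ℝ} (hε : ∀ i, ε i ^ 2 = 1)
    {M : Matrix (Idx n) (Idx n) ℝ} (h : Mᵀ * quadMat ε * M = quadMat ε) :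
    M * quadMat ε * Mᵀ = quadMat ε := by
  have h1 : (quadMat ε * Mᵀ * quadMat ε) * M = 1 := by
    rw [mul_assoc, mul_assoc, ← mul_assoc Mᵀ, h, quadMat_mul_self hε]
  have h2 := mul_eq_one_comm.1 h1
  calc M * quadMat ε * Mᵀ = M * (quadMat ε * Mᵀ * quadMat ε) * quadMat ε := by
        simp only [mul_assoc]; rw [quadMat_mul_self hε, mul_one]
    _ = quadMat ε := by rw [h2, one_mul]

lemma orth_apply {ε : Fin n → ℝ} {g : GL (Idx n) ℝ} (hg : g ∈ orth ε) :
    (g : Matrix (Idx n) (Idx n) ℝ)ᵀ * quadMat ε * g = quadMat ε := hg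

lemma grpG_le_orth (ε : Fin n → ℝ) : grpG ε ≤ orth ε := by
  rintro _ ⟨g, -, rfl⟩
  exact g.2

lemma transpose_quadMat_mul_apply (ε : Fin n → ℝ) (M : Matrix (Idx n) (Idx n) ℝ) (a b : Idx n) :
    (Mᵀ * quadMat ε * M) a b =
      M i0 a * M i1 b + M i1 a * M i0 b + ∑ i, ε i * (M (im i) a * M (im i) b) := by
  simp only [Matrix.mul_apply, quadMat, Matrix.transpose_apply, Fintype.sum_sum_type]
  simp only [Finset.univ_unique, Finset.sum_singleton, mul_ite, mul_zero, Finset.sum_ite_eq',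
    Finset.mem_univ, if_true, Finset.sum_const_zero, add_zero, zero_add, mul_one]
  have : ∑ x, M (im x) a * ε x * M (im x) b = ∑ i, ε i * (M (im i) a * M (im i) b) :=
    Finset.sum_congr rfl fun i _ => by ring
  change M i1 a * M i0 b + (∑ x, M (im x) a * ε x * M (im x) b + M i0 a * M i1 b) = _
  rw [this]
  ring

lemma mul_nbar_i0 (ε : Fin n → ℝ) (M : Matrix (Idx n) (Idx n) ℝ) (X : Fin n → ℝ) (a : Idx n) :
    (M * nbar ε X) a i0 = M a i0 + ∑ i, M a (im i) * X i - M a i1 * (normSq ε X / 2) := by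
  simp [Matrix.mul_apply, nbar, Fintype.sum_sum_type]
  ring

/-- The vector `u exp(X) e_0` is null. Its `0`-th component is non-zero, so the last component is
determined by the others and only these need to be checked. -/
lemma null_column {ε : Fin n → ℝ} {u : Matrix (Idx n) (Idx n) ℝ}
    (hu : uᵀ * quadMat ε * u = quadMat ε) {X Y : Fin n → ℝ} {c : ℝ}
    (hc : c ≠ 0) (h0 : (u * nbar ε X) i0 i0 = c) (hi : ∀ i, (u * nbar ε X) (im i) i0 = c * Y i)
    (a : Idx n) : (u * nbar ε X) a i0 = c * nbar ε Y a i0 := by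
  have hq : (u * nbar ε X)ᵀ * quadMat ε * (u * nbar ε X) = quadMat ε := by
    rw [Matrix.transpose_mul]
    calc _ = (nbar ε X)ᵀ * (uᵀ * quadMat ε * u) * nbar ε X := by simp only [mul_assoc]
      _ = _ := by rw [hu, nbar_quad]
  have h1 := congrFun (congrFun hq i0) i0
  rw [transpose_quadMat_mul_apply, h0] at h1
  simp only [hi] at h1
  rcases a with a | a | a
  · simpa [nbar] using h0
  · simpa [nbar] using hi a
  · have e : ∑ i, ε i * (c * Y i * (c * Y i)) = c * (c * normSq ε Y) := by
      rw [normSq, Finset.mul_sum, Finset.mul_sum]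
      exact Finset.sum_congr rfl fun i _ => by ring
    have h2 : c * (2 * (u * nbar ε X) i1 i0 + c * normSq ε Y) = 0 := by
      rw [e] at h1
      have : quadMat ε i0 i0 = 0 := rfl
      rw [this] at h1
      linear_combination h1
    have h3 := (mul_eq_zero.1 h2).resolve_left hc
    change (u * nbar ε X) i1 i0 = c * (-(normSq ε Y) / 2)
    linear_combination h3 / 2

/-! ## The unipotent subgroup `N_+` -/

/-- The element of `N_+` with coordinates `Z`. -/
def nupGL (ε Z : Fin n → ℝ) : GL (Idx n) ℝ where
  val := (nbar ε Z)ᵀ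
  inv := (nbar ε (-Z))ᵀ
  val_inv := by rw [← Matrix.transpose_mul, nbar_mul, neg_add_cancel, nbar_zero,
    Matrix.transpose_one]
  inv_val := by rw [← Matrix.transpose_mul, nbar_mul, add_neg_cancel, nbar_zero,
    Matrix.transpose_one]

lemma nupGL_val (ε Z : Fin n → ℝ) : (nupGL ε Z).1 = (nbar ε Z)ᵀ := rfl

lemma nupGL_mul (ε Z W : Fin n → ℝ) : nupGL ε Z * nupGL ε W = nupGL ε (Z + W) := by
  apply Units.ext
  rw [Units.val_mul, nupGL_val, nupGL_val, nupGL_val, ← Matrix.transpose_mul, nbar_mul, add_comm]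

lemma nupGL_zero (ε : Fin n → ℝ) : nupGL ε 0 = 1 := by
  apply Units.ext
  rw [nupGL_val, nbar_zero, Matrix.transpose_one]; rfl

lemma nbarGL_mul (ε Z W : Fin n → ℝ) : nbarGL ε Z * nbarGL ε W = nbarGL ε (Z + W) :=
  Units.ext (nbar_mul ε Z W)

lemma nbarGL_zero (ε : Fin n → ℝ) : nbarGL ε 0 = 1 := Units.ext (nbar_zero ε)

lemma contDiff_nbar {V : Type*} [NormedAddCommGroup V] [NormedSpace ℝ V] (ε : Fin n → ℝ)
    {X : V → Fin n → ℝ} (hX : ContDiff ℝ ∞ X) (a b : Idx n) :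
    ContDiff ℝ ∞ fun t => nbar ε (X t) a b := by
  have hX' : ∀ i, ContDiff ℝ ∞ fun t => X t i := contDiff_pi.1 hX
  rcases a with a | a | a <;> rcases b with b | b | b <;> simp only [nbar, normSq] <;>
    fun_prop

lemma nupGL_mem {ε : Fin n → ℝ} (hε : ∀ i, ε i ^ 2 = 1) (Z : Fin n → ℝ) : nupGL ε Z ∈ grpG ε := by
  have hO : ∀ Y, nupGL ε Y ∈ orth ε := fun Y => by
    change (nbar ε Y)ᵀᵀ * quadMat ε * (nbar ε Y)ᵀ = quadMat ε
    rw [Matrix.transpose_transpose, mul_quadMat_transpose hε (nbar_quad ε Y)]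
  have hc : ∀ Y : ℝ → Fin n → ℝ, ContDiff ℝ ∞ Y → Continuous fun t => (nbar ε (Y t))ᵀ :=
    fun Y hY => continuous_matrix fun a b => (contDiff_nbar ε hY b a).continuous
  have hcont : Continuous fun t : ℝ => (⟨nupGL ε (t • Z), hO _⟩ : orth ε) := by
    refine Continuous.subtype_mk (Units.continuous_iff.2 ⟨?_, ?_⟩) _
    · exact hc (fun t => t • Z) (by fun_prop)
    · exact hc (fun t => -(t • Z)) (by fun_prop)
  refine ⟨⟨nupGL ε Z, hO Z⟩, ?_, rfl⟩
  have h := (isPreconnected_univ.image _ hcont.continuousOn).subset_connectedComponent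
    (x := (1 : orth ε)) ⟨0, trivial, by
      apply Subtype.ext
      simpa using nupGL_zero ε⟩
  exact h ⟨1, trivial, by simp⟩

lemma mem_grpG'_iff {ε : Fin (m + 1) → ℝ} {g : GL (Idx (m + 1)) ℝ} :
    g ∈ grpG' ε ↔ g ∈ grpG ε ∧ (g : Matrix (Idx (m + 1)) (Idx (m + 1)) ℝ) *ᵥ
      Pi.single (im (Fin.last m)) 1 = Pi.single (im (Fin.last m)) 1 := Iff.rfl

lemma nupGL_mem' {ε : Fin (m + 1) → ℝ} (hε : ∀ i, ε i ^ 2 = 1) (z : Fin m → ℝ) :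
    nupGL ε (incl z) ∈ grpG' ε := by
  refine mem_grpG'_iff.2 ⟨nupGL_mem hε _, ?_⟩
  rw [nupGL_val]
  ext a
  rcases a with a | a | a <;>
    simp [nbar, incl, Matrix.col, Pi.single_apply, eq_comm]

/-! ## The parabolic subgroup `P'` -/

section Parabolic

variable {ε : Fin (m + 1) → ℝ} {p : GL (Idx (m + 1)) ℝ}

lemma orth_of_mem_grpG' (hp : p ∈ grpG' ε) : p.1ᵀ * quadMat ε * p.1 = quadMat ε :=
  orth_apply (grpG_le_orth ε (mem_grpG'_iff.1 hp).1)

lemma apply_last_of_mem_grpG' (hp : p ∈ grpG' ε) (a : Idx (m + 1)) :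
    p.1 a (im (Fin.last m)) = if a = im (Fin.last m) then 1 else 0 := by
  have := congrFun (mem_grpG'_iff.1 hp).2 a
  simpa [Matrix.col, Pi.single_apply] using this

/-- An orthogonal matrix that fixes `e_n` preserves `e_n^⊥`. -/
lemma last_apply_of_mem_grpG' (hε : ∀ i, ε i ^ 2 = 1) (hp : p ∈ grpG' ε) (b : Idx (m + 1)) :
    p.1 (im (Fin.last m)) b = if b = im (Fin.last m) then 1 else 0 := by
  have h := congrFun (congrFun (orth_of_mem_grpG' hp) (im (Fin.last m))) b
  rw [transpose_quadMat_mul_apply] at h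
  simp only [apply_last_of_mem_grpG' hp] at h
  have hl : ε (Fin.last m) ≠ 0 := fun h0 => by simpa [h0] using hε (Fin.last m)
  rw [Fin.sum_univ_castSucc, Finset.sum_eq_zero (fun i _ => by
    simp [(Fin.castSucc_lt_last i).ne])] at h
  rcases b with b | b | b
  · simp [quadMat] at h; simpa [hl] using h
  · simp only [quadMat] at h
    by_cases hb : b = Fin.last m
    · subst hb; simpa [hl] using h
    · have hb' : Fin.last m ≠ b := fun h => hb h.symm
      simpa [hb, hb', hl] using h
  · simp [quadMat] at h; simpa [hl] using h

lemma stabLine_ne_zero (hs : StabLine p) : p.1 i0 i0 ≠ 0 := by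
  intro h0
  have h1 : (p⁻¹.1 * p.1) i0 i0 = 1 := by
    rw [← Units.val_mul, inv_mul_cancel]; rfl
  rw [Matrix.mul_apply, Finset.sum_eq_zero] at h1
  · exact zero_ne_one h1
  · intro a _
    by_cases ha : a = i0
    · rw [ha, h0, mul_zero]
    · rw [hs a ha, mul_zero]

/-- Stabilizing the line of `e_0` means stabilizing its orthogonal hyperplane, on which the last
coordinate vanishes. -/
lemma stabLine_i1 (ho : p.1ᵀ * quadMat ε * p.1 = quadMat ε) (hs : StabLine p) (b : Idx (m + 1))
    (hb : b ≠ i1) : p.1 i1 b = 0 := by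
  have h := congrFun (congrFun ho i0) b
  rw [transpose_quadMat_mul_apply, hs i1 (by simp), Finset.sum_eq_zero (fun i _ => by
    rw [hs (im i) (by simp)]; ring)] at h
  have hq : quadMat ε i0 b = 0 := by
    rcases b with b | b | b
    · rfl
    · rfl
    · exact absurd rfl hb
  rw [hq, zero_mul, add_zero, add_zero] at h
  exact (mul_eq_zero.1 h).resolve_left (stabLine_ne_zero hs)

lemma orthSmall_blockM' (hε : ∀ i, ε i ^ 2 = 1) (hp : p ∈ grpG' ε) (hs : StabLine p) :
    OrthSmall (fun i => ε i.castSucc) (blockM' p) := by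
  have ho := orth_of_mem_grpG' hp
  have hl := last_apply_of_mem_grpG' hε hp
  ext i j
  have h := congrFun (congrFun ho (im i.castSucc)) (im j.castSucc)
  rw [transpose_quadMat_mul_apply, stabLine_i1 ho hs _ (by simp), stabLine_i1 ho hs _ (by simp),
    Fin.sum_univ_castSucc, hl, if_neg (by simp [(Fin.castSucc_lt_last i).ne]), mul_zero] at h
  simp only [zero_mul, mul_zero, add_zero, zero_add] at h
  have hr : Matrix.diagonal (fun i : Fin m => ε i.castSucc) i j =
      quadMat ε (im i.castSucc) (im j.castSucc) := by
    simp [Matrix.diagonal_apply, quadMat]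
  rw [hr, ← h, Matrix.mul_assoc, Matrix.mul_apply]
  refine Finset.sum_congr rfl fun a _ => ?_
  rw [Matrix.diagonal_mul, Matrix.transpose_apply, blockM', blockM']
  ring

lemma mul_nupGL_i0 (g : GL (Idx n) ℝ) (ε Z : Fin n → ℝ) (a : Idx n) :
    (g * nupGL ε Z).1 a i0 = g.1 a i0 := by
  rw [Units.val_mul, nupGL_val]
  simp [Matrix.mul_apply, nbar, Fintype.sum_sum_type]

lemma mul_nupGL_im (g : GL (Idx n) ℝ) (ε Z : Fin n → ℝ) (a : Idx n) (j : Fin n) :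
    (g * nupGL ε Z).1 a (im j) = g.1 a i0 * Z j + g.1 a (im j) := by
  rw [Units.val_mul, nupGL_val]
  simp [Matrix.mul_apply, nbar, Fintype.sum_sum_type]

lemma extendOne_mulVec (M : Matrix (Fin m) (Fin m) ℝ) (X : Fin (m + 1) → ℝ) :
    extendOne M *ᵥ X =
      Fin.snoc (α := fun _ => ℝ) (M *ᵥ fun j => X j.castSucc) (X (Fin.last m)) := by
  ext i
  refine Fin.lastCases ?_ (fun i => ?_) i
  · simp [Matrix.mulVec, dotProduct, Fin.sum_univ_castSucc, extendOne]
  · simp [Matrix.mulVec, dotProduct, Fin.sum_univ_castSucc, extendOne]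

/-- The Langlands decomposition of an element of `P'`. -/
lemma exists_levi_mul_nupGL (hε : ∀ i, ε i ^ 2 = 1) (hp : p ∈ grpG' ε) (hs : StabLine p) :
    ∃ (l : GL (Idx (m + 1)) ℝ) (z : Fin m → ℝ), l ∈ grpG' ε ∧ p = l * nupGL ε (incl z) ∧
      ∀ X, (l.1 * nbar ε X) i0 i0 = p.1 i0 i0 ∧
        ∀ i, (l.1 * nbar ε X) (im i) i0 = (extendOne (blockM' p) *ᵥ X) i := by
  have hc := stabLine_ne_zero hs
  obtain ⟨z, hz⟩ : ∃ z : Fin m → ℝ, ∀ j, p.1 i0 (im j) = p.1 i0 i0 * incl z j := by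
    -- Dividing the first row by `c = p_{00}` gives the `N_+` factor. It lies in `N'_+` because `p`
    -- fixes `e_n`.
    refine ⟨fun j => p.1 i0 (im j.castSucc) / p.1 i0 i0, fun j => ?_⟩
    refine Fin.lastCases ?_ (fun j => ?_) j
    · rw [apply_last_of_mem_grpG' hp]; simp [incl]
    · simp only [incl, Fin.snoc_castSucc]; field_simp
  obtain ⟨l, hl⟩ : ∃ l, l = p * nupGL ε (-incl z) := ⟨_, rfl⟩
  have hpl : p = l * nupGL ε (incl z) := by
    rw [hl, mul_assoc, nupGL_mul, neg_add_cancel, nupGL_zero, mul_one]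
  have hn : nupGL ε (-incl z) ∈ grpG' ε := by
    have : -incl z = incl (-z) := by
      ext i
      refine Fin.lastCases ?_ (fun i => ?_) i <;> simp [incl]
    rw [this]; exact nupGL_mem' hε _
  have hlG : l ∈ grpG' ε := hl ▸ mul_mem hp hn
  have hl0 : ∀ a, l.1 a i0 = p.1 a i0 := fun a => by rw [hl, mul_nupGL_i0]
  have hr : ∀ j, l.1 i0 (im j) = 0 := fun j => by
    rw [hl, mul_nupGL_im, hz, Pi.neg_apply]; ring
  have hlm : ∀ i j, l.1 (im i) (im j) = p.1 (im i) (im j) := fun i j => by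
    rw [hl, mul_nupGL_im, hs _ (by simp), zero_mul, zero_add]
  -- The rows of `l` satisfy the orthogonality relations too. Its row `0` has zero middle block:
  -- being null, it also has zero last entry, and its products with the other rows clear the last
  -- column.
  have ho : l.1ᵀᵀ * quadMat ε * l.1ᵀ = quadMat ε :=
    mul_quadMat_transpose hε (orth_of_mem_grpG' hlG)
  have h01 : l.1 i0 i1 = 0 := by
    have h := congrFun (congrFun ho i0) i0
    rw [transpose_quadMat_mul_apply] at h
    simp only [Matrix.transpose_apply, hr, hl0, mul_zero, Finset.sum_const_zero, add_zero] at h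
    have hq : quadMat ε i0 i0 = 0 := rfl
    rw [hq] at h
    have h2 : p.1 i0 i0 * (2 * l.1 i0 i1) = 0 := by linear_combination h
    linarith [(mul_eq_zero.1 h2).resolve_left hc]
  have hi1 : ∀ i, l.1 (im i) i1 = 0 := fun i => by
    have h := congrFun (congrFun ho i0) (im i)
    rw [transpose_quadMat_mul_apply] at h
    simp only [Matrix.transpose_apply, hr, hl0, h01, zero_mul, mul_zero, Finset.sum_const_zero,
      add_zero] at h
    exact (mul_eq_zero.1 (h.trans rfl)).resolve_left hc
  refine ⟨l, z, hlG, hpl, fun X => ⟨?_, fun i => ?_⟩⟩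
  · rw [mul_nbar_i0, hl0, h01, Finset.sum_eq_zero fun i _ => by rw [hr, zero_mul]]
    ring
  · rw [mul_nbar_i0, hl0, hi1, hs _ (by simp), extendOne_mulVec]
    simp only [hlm, zero_mul, sub_zero, zero_add]
    rw [Fin.sum_univ_castSucc]
    refine Fin.lastCases ?_ (fun i => ?_) i
    · rw [Fin.snoc_last, Finset.sum_eq_zero fun j _ => by
        rw [last_apply_of_mem_grpG' hε hp, if_neg (by simp [(Fin.castSucc_lt_last j).ne]), zero_mul],
        last_apply_of_mem_grpG' hε hp, if_pos rfl, zero_add, one_mul]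
    · rw [Fin.snoc_castSucc, apply_last_of_mem_grpG' hp,
        if_neg (by simp [(Fin.castSucc_lt_last i).ne]), zero_mul, add_zero]
      rfl

end Parabolic

/-! ## Translations and one-parameter families of functions -/

/-- The translate `x ↦ f (x + y)`. -/
def transC (y : Fin n → ℝ) (f : Cinf n) : Cinf n :=
  ⟨fun x => f.1 (x + y), mem_Cinf.2 ((smooth_Cinf f).comp (contDiff_id.add contDiff_const))⟩

lemma transC_apply (y : Fin n → ℝ) (f : Cinf n) (x : Fin n → ℝ) :
    (transC y f).1 x = f.1 (x + y) := rfl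

lemma pdC_transC (y : Fin n → ℝ) (f : Cinf n) (i : Fin n) :
    pdC i (transC y f) = transC y (pdC i f) := by
  ext x
  change fderiv ℝ (fun x => f.1 (x + y)) x _ = fderiv ℝ f.1 (x + y) _
  rw [fderiv_comp_add_right]

lemma dOp_transC (P : MvPolynomial (Fin n) ℂ) (y : Fin n → ℝ) (f : Cinf n) :
    dOp P (transC y f) = transC y (dOp P f) := by
  induction P using MvPolynomial.induction_on generalizing f with
  | C a => rw [dOp_C, dOp_C]; rfl
  | add p q hp hq => simp only [map_add, LinearMap.add_apply, hp, hq]; rfl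
  | mul_X p i hp => rw [dOp_mul_X, dOp_mul_X, pdC_transC, hp]

/-- The function `x ↦ G (x, t)`. -/
def sliceC (t : ℝ) (G : Cinf (n + 1)) : Cinf n := restrC (transC (Pi.single (Fin.last n) t) G)

lemma incl_add_single (x : Fin n → ℝ) (t : ℝ) :
    incl x + Pi.single (Fin.last n) t = (Fin.snoc x t : Fin (n + 1) → ℝ) := by
  ext i
  refine Fin.lastCases ?_ (fun i => ?_) i
  · simp [incl]
  · simp [incl, (Fin.castSucc_lt_last i).ne]

lemma sliceC_apply (t : ℝ) (G : Cinf (n + 1)) (x : Fin n → ℝ) :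
    (sliceC t G).1 x = G.1 (Fin.snoc x t) := by
  rw [← incl_add_single]; rfl

lemma dOp_sliceC (P : MvPolynomial (Fin n) ℂ) (t : ℝ) (G : Cinf (n + 1)) :
    dOp P (sliceC t G) = sliceC t (dOp (rename Fin.castSucc P) G) := by
  rw [sliceC, ← restrC_dOp_rename, dOp_transC, sliceC]

lemma hasDerivAt_sliceC (G : Cinf (n + 1)) (x : Fin n → ℝ) (t : ℝ) :
    HasDerivAt (fun t => (sliceC t G).1 x) ((sliceC t (pdC (Fin.last n) G)).1 x) t := by
  have h1 : HasDerivAt (fun t : ℝ => incl x + Pi.single (Fin.last n) t)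
      (Pi.single (Fin.last n) 1) t := by
    rw [hasDerivAt_pi]
    intro i
    refine Fin.lastCases ?_ (fun i => ?_) i
    · simpa using (hasDerivAt_id t).const_add (incl x (Fin.last n))
    · simpa [(Fin.castSucc_lt_last i).ne] using hasDerivAt_const t (incl x i.castSucc)
  exact (diffAt_Cinf G _).hasFDerivAt.comp_hasDerivAt t h1

lemma hasDerivAt_dOp_sliceC (P : MvPolynomial (Fin n) ℂ) (G : Cinf (n + 1)) (x : Fin n → ℝ)
    (t : ℝ) : HasDerivAt (fun t => (dOp P (sliceC t G)).1 x)
      ((dOp P (sliceC t (pdC (Fin.last n) G))).1 x) t := by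
  simp only [dOp_sliceC, dOp_pdC]
  exact hasDerivAt_sliceC _ x t

/-! ## Smooth dependence on parameters -/

/-- Derivatives in `x` of a slice `Ψ(M, ·)` are derivatives of `Ψ` in the directions `(0, e_i)`,
hence smooth in `M` as well. The function `Θ` is uniform in `M`, as smoothness on the group in terms
of matrix entries requires. -/
lemma exists_contDiffOn_dOp {V : Type*} [NormedAddCommGroup V] [NormedSpace ℝ V]
    {O : Set (V × (Fin n → ℝ))} (hO : IsOpen O) (P : MvPolynomial (Fin n) ℂ)
    {Ψ : V × (Fin n → ℝ) → ℂ} (hΨ : ContDiffOn ℝ ∞ Ψ O) :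
    ∃ Θ : V × (Fin n → ℝ) → ℂ, ContDiffOn ℝ ∞ Θ O ∧
      ∀ (M : V) (f : Cinf n), (∀ x, (M, x) ∈ O → f.1 x = Ψ (M, x)) →
        ∀ x, (M, x) ∈ O → (dOp P f).1 x = Θ (M, x) := by
  induction P using MvPolynomial.induction_on generalizing Ψ with
  | C a =>
    refine ⟨fun y => a * Ψ y, contDiffOn_const.mul hΨ, fun M f hf x hx => ?_⟩
    rw [dOp_C, smul_Cinf_apply, hf x hx]
  | add p q hp hq =>
    obtain ⟨Θ, h1, h2⟩ := hp hΨ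
    obtain ⟨Θ', h1', h2'⟩ := hq hΨ
    refine ⟨fun y => Θ y + Θ' y, h1.add h1', fun M f hf x hx => ?_⟩
    rw [map_add, LinearMap.add_apply]
    change _ = Θ (M, x) + Θ' (M, x)
    rw [← h2 M f hf x hx, ← h2' M f hf x hx]
    rfl
  | mul_X p i hp =>
    have hΨ' : ContDiffOn ℝ ∞ (fun y => fderiv ℝ Ψ y ((0 : V), Pi.single i (1 : ℝ))) O :=
      (hΨ.fderiv_of_isOpen hO (by simp)).clm_apply contDiffOn_const
    obtain ⟨Θ, h1, h2⟩ := hp hΨ'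
    refine ⟨Θ, h1, fun M f hf x hx => ?_⟩
    rw [dOp_mul_X]
    refine h2 M (pdC i f) (fun y hy => ?_) x hx
    have hd : DifferentiableAt ℝ Ψ (M, y) :=
      (hΨ.contDiffAt (hO.mem_nhds hy)).differentiableAt (by simp)
    have h3 : HasFDerivAt (fun y : Fin n → ℝ => Ψ (M, y))
        ((fderiv ℝ Ψ (M, y)).comp (ContinuousLinearMap.inr ℝ V (Fin n → ℝ))) y :=
      hd.hasFDerivAt.comp y (hasFDerivAt_prodMk_right M y)
    have h4 : f.1 =ᶠ[nhds y] fun y => Ψ (M, y) := by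
      have : ∀ᶠ z in nhds y, (M, z) ∈ O :=
        (Continuous.prodMk_right M).continuousAt.eventually (hO.mem_nhds hy)
      filter_upwards [this] with z hz using hf z hz
    change fderiv ℝ f.1 y _ = _
    rw [h4.fderiv_eq, h3.fderiv]
    rfl

/-! ## Sections over the big cell and its translates -/

lemma contDiff_comp_of_smoothOnGrp {H : Subgroup (GL (Idx n) ℝ)} {F : H → ℂ}
    (hF : SmoothOnGrp H F) {V : Type*} [NormedAddCommGroup V] [NormedSpace ℝ V] {γ : V → H}
    (hγ : ∀ a b, ContDiff ℝ ∞ fun v => (γ v).1.1 a b) : ContDiff ℝ ∞ fun v => F (γ v) := by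
  rw [contDiff_iff_contDiffAt]
  intro v
  obtain ⟨U, hU, hv, Φ, hΦ, hFΦ⟩ := hF (γ v)
  have hγ' : ContDiff ℝ ∞ fun v a b => (γ v).1.1 a b :=
    contDiff_pi.2 fun a => contDiff_pi.2 fun b => hγ a b
  have h1 : ContDiffAt ℝ ∞ (fun v => Φ fun a b => (γ v).1.1 a b) v :=
    (hΦ.contDiffAt (hU.mem_nhds hv)).comp v hγ'.contDiffAt
  refine h1.congr_of_eventuallyEq ?_
  filter_upwards [hγ'.continuous.continuousAt.eventually (hU.mem_nhds hv)] with w hw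
  exact hFΦ (γ w) hw

lemma incl_smul (t : ℝ) (z : Fin m → ℝ) : (incl (t • z) : Fin (m + 1) → ℝ) = t • incl z := by
  ext i
  refine Fin.lastCases ?_ (fun i => ?_) i <;> simp [incl]

lemma incl_add (y z : Fin m → ℝ) : (incl (y + z) : Fin (m + 1) → ℝ) = incl y + incl z := by
  ext i
  refine Fin.lastCases ?_ (fun i => ?_) i <;> simp [incl]

lemma halfSqC_apply (ε : Fin n → ℝ) (x : Fin n → ℝ) :
    (halfSqC ε).1 x = (normSq ε x / 2 : ℝ) := by
  have : (halfSqC ε).1 x = (1 / 2 : ℂ) * (∑ i, (ε i : ℂ) • (xC i * xC i) : Cinf n).1 x := rfl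
  have h2 : ∑ i, ((ε i : ℂ) • (xC i * xC i) : Cinf n).1 x = ((∑ i, ε i * x i ^ 2 : ℝ) : ℂ) := by
    rw [Complex.ofReal_sum]
    refine Finset.sum_congr rfl fun i _ => ?_
    change (ε i : ℂ) * ((x i : ℂ) * x i) = _
    push_cast
    ring
  rw [this, sum_Cinf_apply, h2, normSq]
  push_cast
  ring

lemma sctC_apply (ε : Fin n → ℝ) (lam : ℂ) (a : Fin n) (f : Cinf n) (x : Fin n → ℝ) :
    (sctC ε lam a f).1 x = lam * x a * f.1 x + x a * ∑ i, (x i : ℂ) * pd i f.1 x -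
      ε a * ((normSq ε x / 2 : ℝ) : ℂ) * pd a f.1 x := by
  have h : (sctC ε lam a f).1 x = lam * (x a * f.1 x) + x a * (eulerC f).1 x -
      ε a * ((halfSqC ε).1 x * pd a f.1 x) := rfl
  rw [h, halfSqC_apply, eulerC, sum_Cinf_apply]
  change lam * (x a * f.1 x) + x a * ∑ i, (x i : ℂ) * pd i f.1 x - _ = _
  ring

/-- A subgroup `H ⊇ G'` together with a linear subspace of the big cell `N_- ≅ ℝⁿ`, given by the
embedding `e`, that is contained in `H` and contains `N'_-`. -/
structure CellData (ε : Fin (m + 1) → ℝ) (k : ℕ) where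
  /-- the group -/
  H : Subgroup (GL (Idx (m + 1)) ℝ)
  le : grpG' ε ≤ H
  /-- the embedding into the big cell -/
  e : (Fin k → ℝ) →L[ℝ] (Fin (m + 1) → ℝ)
  mem : ∀ x, nbarGL ε (e x) ∈ H
  /-- the embedding of `N'_-` -/
  s : (Fin m → ℝ) → Fin k → ℝ
  e_s : ∀ z, e (s z) = incl z
  /-- the signs -/
  η : Fin k → ℝ
  normSq_e : ∀ x, normSq ε (e x) = normSq η x
  dot_e : ∀ z x, ∑ i, incl z i * e x i = ∑ a, s z a * x a
  eps_s : ∀ z, (e fun a => η a * s z a) = fun i => ε i * incl z i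
  /-- the action of `M'` -/
  blk : Matrix (Fin m) (Fin m) ℝ → Matrix (Fin k) (Fin k) ℝ
  e_blk : ∀ M x, e (blk M *ᵥ x) = extendOne M *ᵥ e x

namespace CellData

variable {ε : Fin (m + 1) → ℝ} (S : CellData ε k) {lam : ℂ} {δ : ℕ}

lemma smooth_of_mem (F : IndLine S.H lam δ) : SmoothOnGrp S.H F.1 := F.2.2.1 LinearMap.id

/-- The function `x ↦ F (g exp(x))`. -/
def sec (F : IndLine S.H lam δ) (g : grpG' ε) : Cinf k :=
  ⟨fun x => F.1 ⟨g.1 * nbarGL ε (S.e x), mul_mem (S.le g.2) (S.mem x)⟩, mem_Cinf.2 <|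
    contDiff_comp_of_smoothOnGrp (S.smooth_of_mem F) fun a b => by
      change ContDiff ℝ ∞ fun x => ∑ c, g.1.1 a c * nbar ε (S.e x) c b
      exact ContDiff.sum fun c _ => contDiff_const.mul (contDiff_nbar ε S.e.contDiff c b)⟩

lemma sec_apply (F : IndLine S.H lam δ) (g : grpG' ε) (x : Fin k → ℝ) : (S.sec F g).1 x =
    F.1 ⟨g.1 * nbarGL ε (S.e x), mul_mem (S.le g.2) (S.mem x)⟩ := rfl

lemma sec_add (F F' : IndLine S.H lam δ) (g : grpG' ε) :
    S.sec (F + F') g = S.sec F g + S.sec F' g := rfl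

lemma sec_smul (c : ℂ) (F : IndLine S.H lam δ) (g : grpG' ε) :
    S.sec (c • F) g = c • S.sec F g := rfl

lemma sec_one_apply (F : IndLine S.H lam δ) (x : Fin k → ℝ) :
    (S.sec F 1).1 x = F.1 ⟨nbarGL ε (S.e x), S.mem x⟩ :=
  congrArg F.1 (Subtype.ext (one_mul (nbarGL ε (S.e x))))

lemma sec_inv_mul {F F' : IndLine S.H lam δ} {g : grpG' ε}
    (h : ∀ u, F'.1 u = F.1 (⟨g.1, S.le g.2⟩⁻¹ * u)) (u : grpG' ε) :
    S.sec F' u = S.sec F (g⁻¹ * u) := by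
  ext x
  refine (h _).trans (congrArg F.1 (Subtype.ext ?_))
  change g.1⁻¹ * (u.1 * _) = g.1⁻¹ * u.1 * _
  rw [mul_assoc]

lemma sec_nbar (F : IndLine S.H lam δ) (y : Fin m → ℝ) :
    S.sec F ⟨nbarGL ε (incl y), nbarGL_mem' ε y⟩ = transC (S.s y) (S.sec F 1) := by
  ext x
  rw [transC_apply, sec_apply, sec_apply]
  refine congrArg F.1 (Subtype.ext ?_)
  change nbarGL ε (incl y) * nbarGL ε (S.e x) = 1 * nbarGL ε (S.e (x + S.s y))
  rw [nbarGL_mul, one_mul, map_add, S.e_s, add_comm (S.e x)]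

/-- The transformation law of sections over the big cell. -/
lemma sec_mul_apply (F : IndLine S.H lam δ) (g u : grpG' ε) {x y : Fin k → ℝ} {c : ℝ}
    (hc : c ≠ 0) (h0 : (u.1.1 * nbar ε (S.e x)) i0 i0 = c)
    (hi : ∀ i, (u.1.1 * nbar ε (S.e x)) (im i) i0 = c * S.e y i) :
    (S.sec F (g * u)).1 x = chi lam δ c * (S.sec F g).1 y := by
  -- This element maps `e_0` to `c e_0`, because `u exp(x) e_0 = c exp(y) e_0`; it is the
  -- `P`-component of `u exp(x)`.
  let p : S.H := ⟨nbarGL ε (-S.e y) * (u.1 * nbarGL ε (S.e x)), by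
    rw [← map_neg]
    exact mul_mem (S.mem _) (mul_mem (S.le u.2) (S.mem _))⟩
  have hcol : ∀ a, p.1.1 a i0 = c * (1 : Matrix (Idx (m + 1)) (Idx (m + 1)) ℝ) a i0 := by
    intro a
    have h1 := null_column (orth_of_mem_grpG' u.2) hc h0 hi
    have h2 : (nbar ε (-S.e y) * nbar ε (S.e y)) a i0 =
        (1 : Matrix (Idx (m + 1)) (Idx (m + 1)) ℝ) a i0 := by
      rw [nbar_mul, neg_add_cancel, nbar_zero]
    change (nbar ε (-S.e y) * (u.1.1 * nbar ε (S.e x))) a i0 = _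
    rw [← h2, Matrix.mul_apply, Matrix.mul_apply, Finset.mul_sum]
    exact Finset.sum_congr rfl fun b _ => by rw [h1]; ring
  have hs : StabLine p.1 := fun a ha => by rw [hcol, Matrix.one_apply_ne ha, mul_zero]
  have hp0 : p.1.1 i0 i0 = c := by rw [hcol, Matrix.one_apply_eq, mul_one]
  have hF : F.1 (_ * p) = chi lam δ (p.1.1 i0 i0) * F.1 _ := F.2.2.2 ⟨g.1 * nbarGL ε (S.e y), mul_mem (S.le g.2) (S.mem y)⟩ p hs
  rw [hp0] at hF
  rw [sec_apply, sec_apply]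
  refine Eq.trans ?_ hF
  refine congrArg F.1 (Subtype.ext ?_)
  change g.1 * u.1 * nbarGL ε (S.e x) =
    g.1 * nbarGL ε (S.e y) * (nbarGL ε (-S.e y) * (u.1 * nbarGL ε (S.e x)))
  have : nbarGL ε (S.e y) * (nbarGL ε (-S.e y) * (u.1 * nbarGL ε (S.e x))) =
      u.1 * nbarGL ε (S.e x) := by
    rw [← mul_assoc, nbarGL_mul, add_neg_cancel, nbarGL_zero, one_mul]
  rw [mul_assoc, mul_assoc, this]

/-- The element of `N'_+` with coordinates `z`. -/
def nup (hε : ∀ i, ε i ^ 2 = 1) (z : Fin m → ℝ) : grpG' ε := ⟨nupGL ε (incl z), nupGL_mem' hε z⟩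

lemma nup_mul (hε : ∀ i, ε i ^ 2 = 1) (y z : Fin m → ℝ) : nup hε y * nup hε z = nup hε (y + z) :=
  Subtype.ext <| by
    change nupGL ε (incl y) * nupGL ε (incl z) = nupGL ε (incl (y + z))
    rw [nupGL_mul, incl_add]

lemma nup_zero (hε : ∀ i, ε i ^ 2 = 1) : nup hε 0 = 1 :=
  Subtype.ext <| by
    have : (incl (0 : Fin m → ℝ)) = 0 := by simpa using incl_smul 0 (0 : Fin m → ℝ)
    change nupGL ε (incl 0) = 1
    rw [this, nupGL_zero]

/-- The function `(x, t) ↦ F (g exp(tz) exp(x))`. -/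
def famSec (hε : ∀ i, ε i ^ 2 = 1) (F : IndLine S.H lam δ) (g : grpG' ε) (z : Fin m → ℝ) :
    Cinf (k + 1) :=
  ⟨fun y => F.1 ⟨(g * nup hε (y (Fin.last k) • z)).1 * nbarGL ε (S.e fun a => y a.castSucc),
    mul_mem (S.le (g * nup hε _).2) (S.mem _)⟩, mem_Cinf.2 <|
    contDiff_comp_of_smoothOnGrp (S.smooth_of_mem F) fun a b => by
      change ContDiff ℝ ∞ fun y : Fin (k + 1) → ℝ =>
        ∑ c, (∑ d, g.1.1 a d * nbar ε (incl (y (Fin.last k) • z)) c d) *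
          nbar ε (S.e fun a => y a.castSucc) c b
      have h1 : ContDiff ℝ ∞ fun y : Fin (k + 1) → ℝ => incl (y (Fin.last k) • z) :=
        contDiff_incl.comp (by fun_prop)
      have h2 : ContDiff ℝ ∞ fun y : Fin (k + 1) → ℝ => S.e fun a => y a.castSucc :=
        S.e.contDiff.comp (by fun_prop)
      exact ContDiff.sum fun c _ => (ContDiff.sum fun d _ =>
        contDiff_const.mul (contDiff_nbar ε h1 c d)).mul (contDiff_nbar ε h2 c b)⟩

lemma sliceC_famSec (hε : ∀ i, ε i ^ 2 = 1) (F : IndLine S.H lam δ) (g : grpG' ε) (z : Fin m → ℝ)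
    (t : ℝ) : sliceC t (S.famSec hε F g z) = S.sec F (g * nup hε (t • z)) := by
  ext x
  rw [sliceC_apply, sec_apply]
  simp [famSec]

lemma nup_mul_nbar_i0 (hε : ∀ i, ε i ^ 2 = 1) (z : Fin m → ℝ) (t : ℝ) (x : Fin k → ℝ) :
    ((nup hε (t • z)).1.1 * nbar ε (S.e x)) i0 i0 =
      1 + t * ∑ a, S.s z a * x a + t ^ 2 * (normSq ε (incl z) * normSq S.η x / 4) := by
  have h : ∑ i, (t • (incl z : Fin (m + 1) → ℝ)) i * S.e x i = t * ∑ i, incl z i * S.e x i := by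
    rw [Finset.mul_sum]
    exact Finset.sum_congr rfl fun i _ => by rw [Pi.smul_apply, smul_eq_mul, mul_assoc]
  have h2 : normSq ε (t • incl z) = t ^ 2 * normSq ε (incl z) := by
    rw [normSq, normSq, Finset.mul_sum]
    exact Finset.sum_congr rfl fun i _ => by rw [Pi.smul_apply, smul_eq_mul]; ring
  rw [mul_nbar_i0, S.normSq_e, ← S.dot_e, ← h]
  change nbar ε (incl (t • z)) i0 i0 + ∑ i, nbar ε (incl (t • z)) (im i) i0 * _ -
    nbar ε (incl (t • z)) i1 i0 * _ = _
  rw [incl_smul]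
  change 1 + ∑ i, (t • (incl z : Fin (m + 1) → ℝ)) i * _ - -normSq ε (t • incl z) / 2 * _ = _
  rw [h2]
  ring

lemma nup_mul_nbar_im (hε : ∀ i, ε i ^ 2 = 1) (z : Fin m → ℝ) (t : ℝ) (x : Fin k → ℝ)
    (i : Fin (m + 1)) : ((nup hε (t • z)).1.1 * nbar ε (S.e x)) (im i) i0 =
      S.e (fun a => x a + t * (normSq S.η x / 2) * (S.η a * S.s z a)) i := by
  have h : (fun a => x a + t * (normSq S.η x / 2) * (S.η a * S.s z a)) =
      x + (t * (normSq S.η x / 2)) • fun a => S.η a * S.s z a := rfl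
  rw [h, map_add, map_smul, S.eps_s, mul_nbar_i0, S.normSq_e]
  change nbar ε (incl (t • z)) i0 (im i) + ∑ j, nbar ε (incl (t • z)) (im j) (im i) * _ -
    nbar ε (incl (t • z)) i1 (im i) * _ = _
  rw [incl_smul]
  simp [nbar]
  ring

/-- The infinitesimal action of `N'_+` by right translations. -/
lemma hasDerivAt_sec_mul_nup (hε : ∀ i, ε i ^ 2 = 1) (F : IndLine S.H lam δ) (g : grpG' ε)
    (z : Fin m → ℝ) (x : Fin k → ℝ) :
    HasDerivAt (fun t : ℝ => (S.sec F (g * nup hε (t • z))).1 x)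
      (-(∑ a, (S.s z a : ℂ) • sctC S.η lam a (S.sec F g) : Cinf k).1 x) 0 := by
  set σ := ∑ a, S.s z a * x a with hσ
  set r := normSq S.η x with hr
  -- These are the factor and the point in `n(tz) exp(x) e_0 = c(t) exp(y(t)) e_0`, valid where
  -- `c(t) ≠ 0`, in particular near `t = 0`.
  set c : ℝ → ℝ := fun t => 1 + t * σ + t ^ 2 * (normSq ε (incl z) * r / 4) with hcdef
  set y : ℝ → Fin k → ℝ := fun t a => (x a + t * (r / 2) * (S.η a * S.s z a)) / c t with hydef
  have hc0 : c 0 = 1 := by simp [hcdef]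
  have hc : HasDerivAt c σ 0 := by
    have h1 : HasDerivAt (fun t : ℝ => t) 1 0 := hasDerivAt_id 0
    have := ((h1.mul_const σ).const_add 1).add
      ((h1.pow 2).mul_const (normSq ε (incl z) * r / 4))
    exact this.congr_deriv (by simp)
  have hy0 : y 0 = x := by
    funext a
    simp [hydef, hc0]
  have hy : HasDerivAt y (fun a => r / 2 * (S.η a * S.s z a) - x a * σ) 0 := by
    rw [hasDerivAt_pi]
    intro a
    have h1 : HasDerivAt (fun t : ℝ => t) 1 0 := hasDerivAt_id 0
    have h2 := (((h1.mul_const (r / 2)).mul_const (S.η a * S.s z a)).const_add (x a)).div hc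
      (by rw [hc0]; exact one_ne_zero)
    exact h2.congr_deriv (by simp [hc0])
  have hmain := hasDerivAt_chi_mul lam δ (diffAt_Cinf (S.sec F g) (y 0)) hc hc0 hy
  have hev : ∀ᶠ t in nhds (0 : ℝ), c t ≠ 0 :=
    hc.continuousAt.eventually_ne (by rw [hc0]; exact one_ne_zero)
  refine (hmain.congr_of_eventuallyEq ?_).congr_deriv ?_
  · filter_upwards [hev] with t ht
    refine S.sec_mul_apply F g _ ht (S.nup_mul_nbar_i0 hε z t x) fun i => ?_
    rw [S.nup_mul_nbar_im hε z t x, ← smul_eq_mul (c t), ← Pi.smul_apply, ← map_smul]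
    refine congrFun (congrArg S.e (funext fun a => ?_)) i
    simp only [hydef, hr, Pi.smul_apply, smul_eq_mul]
    field_simp
  · rw [hy0, sum_Cinf_apply]
    simp only [smul_Cinf_apply, sctC_apply]
    have e1 : ∑ a, (S.s z a : ℂ) * (lam * x a * (S.sec F g).1 x +
        x a * ∑ i, (x i : ℂ) * pd i (S.sec F g).1 x -
        S.η a * ((r / 2 : ℝ) : ℂ) * pd a (S.sec F g).1 x) =
        (lam * (S.sec F g).1 x + ∑ i, (x i : ℂ) * pd i (S.sec F g).1 x) * (σ : ℂ) -
        ∑ a, ((r / 2 * (S.η a * S.s z a) : ℝ) : ℂ) * pd a (S.sec F g).1 x := by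
      rw [hσ, Complex.ofReal_sum, Finset.mul_sum, ← Finset.sum_sub_distrib]
      refine Finset.sum_congr rfl fun a _ => ?_
      push_cast
      ring
    have e2 : ∑ a, ((r / 2 * (S.η a * S.s z a) - x a * σ : ℝ) : ℂ) * pd a (S.sec F g).1 x =
        ∑ a, ((r / 2 * (S.η a * S.s z a) : ℝ) : ℂ) * pd a (S.sec F g).1 x -
        (∑ i, (x i : ℂ) * pd i (S.sec F g).1 x) * (σ : ℂ) := by
      rw [Finset.sum_mul, ← Finset.sum_sub_distrib]
      refine Finset.sum_congr rfl fun a _ => ?_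
      push_cast
      ring
    rw [e1, e2]
    ring

lemma sliceC_pdC_famSec (hε : ∀ i, ε i ^ 2 = 1) (F : IndLine S.H lam δ) (g : grpG' ε)
    (z : Fin m → ℝ) : sliceC 0 (pdC (Fin.last k) (S.famSec hε F g z)) =
      -∑ a, (S.s z a : ℂ) • sctC S.η lam a (S.sec F g) := by
  ext x
  have h1 := hasDerivAt_sliceC (S.famSec hε F g z) x 0
  simp only [sliceC_famSec] at h1
  exact h1.unique (S.hasDerivAt_sec_mul_nup hε F g z x)

/-- A constant coefficient operator, evaluated at the origin, that annihilates the infinitesimal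
action of `N'_+` is invariant under `N'_+`. -/
lemma dOp_sec_mul_nup (hε : ∀ i, ε i ^ 2 = 1) {P : MvPolynomial (Fin k) ℂ} {z : Fin m → ℝ}
    (hP : ∀ f : Cinf k, (dOp P (∑ a, (S.s z a : ℂ) • sctC S.η lam a f)).1 0 = 0)
    (F : IndLine S.H lam δ) (g : grpG' ε) :
    (dOp P (S.sec F (g * nup hε z))).1 0 = (dOp P (S.sec F g)).1 0 := by
  -- Replacing `g` by `g n(tz)` moves the parameter `t` to `0`, where the derivative is the
  -- infinitesimal action that `P` annihilates.
  have hd : ∀ t : ℝ, HasDerivAt (fun t : ℝ => (dOp P (S.sec F (g * nup hε (t • z)))).1 0) 0 t := by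
    intro t
    have h1 := hasDerivAt_dOp_sliceC P (S.famSec hε F (g * nup hε (t • z)) z) 0 0
    rw [sliceC_pdC_famSec, map_neg] at h1
    have h2 : (-(dOp P (∑ a, (S.s z a : ℂ) • sctC S.η lam a
        (S.sec F (g * nup hε (t • z)))))).1 0 = 0 := by
      change -((dOp P _).1 0) = 0
      rw [hP, neg_zero]
    rw [h2] at h1
    simp only [sliceC_famSec, mul_assoc, nup_mul, ← add_smul] at h1
    rw [← sub_self t] at h1
    have h3 := h1.comp_sub_const t t
    simpa using h3
  have hc := is_const_of_deriv_eq_zero (fun t => (hd t).differentiableAt) (fun t => (hd t).deriv) 1 0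
  simpa [nup_zero] using hc

/-- The Levi factor of `P'` acts by linear substitutions. -/
lemma exists_sec_mul_eq (hε : ∀ i, ε i ^ 2 = 1) {p : grpG' ε} (hs : StabLine p.1) :
    ∃ (z : Fin m → ℝ) (l : grpG' ε), p = l * nup hε z ∧ ∀ (F : IndLine S.H lam δ) (g : grpG' ε),
      S.sec F (g * l) = chi lam δ (p.1.1 i0 i0) •
        compC ((p.1.1 i0 i0)⁻¹ • S.blk (blockM' p.1)) (S.sec F g) := by
  obtain ⟨l, z, hl, hpl, hX⟩ := exists_levi_mul_nupGL hε p.2 hs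
  refine ⟨z, ⟨l, hl⟩, Subtype.ext hpl, fun F g => ?_⟩
  have hc := stabLine_ne_zero hs
  ext x
  refine S.sec_mul_apply F g ⟨l, hl⟩ hc (hX _).1 fun i => ?_
  rw [(hX _).2, Matrix.smul_mulVec, map_smul, S.e_blk, Pi.smul_apply, smul_eq_mul,
    mul_inv_cancel_left₀ hc]

end CellData

/-! ## Equivariant operators from operators at the base point -/

namespace CellData

variable {ε : Fin (m + 1) → ℝ} (S : CellData ε k) {lam : ℂ} {δ : ℕ}
  {E : Type*} [AddCommGroup E] [Module ℂ E]

lemma smoothOnGrp_dOp_sec (P : MvPolynomial (Fin k) ℂ) (F : IndLine S.H lam δ) :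
    SmoothOnGrp (grpG' ε) fun g => (dOp P (S.sec F g)).1 0 := by
  intro g₀
  obtain ⟨U, hU, hg, Φ, hΦ, hFΦ⟩ := S.smooth_of_mem F ⟨g₀.1, S.le g₀.2⟩
  let μ : (Idx (m + 1) → Idx (m + 1) → ℝ) × (Fin k → ℝ) → Idx (m + 1) → Idx (m + 1) → ℝ :=
    fun y a b => ∑ c, y.1 a c * nbar ε (S.e y.2) c b
  have hμ : ContDiff ℝ ∞ μ := by
    refine contDiff_pi.2 fun a => contDiff_pi.2 fun b => ContDiff.sum fun c _ => ?_
    exact ContDiff.mul (by fun_prop)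
      (contDiff_nbar ε (S.e.contDiff.comp contDiff_snd) c b)
  have hμ0 : ∀ M, μ (M, 0) = M := fun M => by
    funext a b
    have : (Matrix.of M * nbar ε (S.e 0)) a b = M a b := by
      rw [map_zero, nbar_zero, mul_one]; rfl
    exact this
  obtain ⟨Θ, hΘ, h⟩ := exists_contDiffOn_dOp (hU.preimage hμ.continuous) P
    (hΦ.comp hμ.contDiffOn fun y hy => hy)
  refine ⟨{M | (M, (0 : Fin k → ℝ)) ∈ μ ⁻¹' U}, (hU.preimage hμ.continuous).preimage
    (Continuous.prodMk_left _), ?_, fun M => Θ (M, 0), ?_, fun g hgU => ?_⟩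
  · change μ _ ∈ U
    rw [hμ0]; exact hg
  · exact hΘ.comp (contDiff_prodMk_left _).contDiffOn fun M hM => hM
  · exact h _ (S.sec F g) (fun x hx => hFΦ ⟨g.1 * nbarGL ε (S.e x), _⟩ hx) 0 hgU

variable {W : Submodule ℂ E} {r : GL (Idx (m + 1)) ℝ → E →ₗ[ℂ] E}

/-- The equivariant operator defined by an equivariant map from jets at the base point to `W`. -/
def opInd (hε : ∀ i, ε i ^ 2 = 1) (op : Cinf k →ₗ[ℂ] E) (hW : ∀ f, op f ∈ W)
    (hdual : ∀ l : Module.Dual ℂ E, ∃ P, ∀ f, l (op f) = (dOp P f).1 0)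
    (hnil : ∀ z f, op (∑ a, (S.s z a : ℂ) • sctC S.η lam a f) = 0)
    (hlevi : ∀ p ∈ grpG' ε, StabLine p → ∀ f, chi lam δ (p.1 i0 i0) •
      op (compC ((p.1 i0 i0)⁻¹ • S.blk (blockM' p)) f) = r p (op f)) :
    IndLine S.H lam δ →ₗ[ℂ] Ind (grpG' ε) W r where
  toFun F := ⟨fun g => op (S.sec F g), fun g => hW _, fun l => by
      obtain ⟨P, hP⟩ := hdual l
      simp only [hP]
      exact S.smoothOnGrp_dOp_sec P F, fun g p hs => by
      obtain ⟨z, l, hpl, hl⟩ := S.exists_sec_mul_eq (lam := lam) (δ := δ) hε hs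
      -- Linear functionals separate points of `E`, and each turns `op` into a constant coefficient
      -- operator at the origin, so the scalar invariance under `N'_+` applies.
      have h1 : op (S.sec F (g * l * nup hε z)) = op (S.sec F (g * l)) := by
        refine (Module.forall_dual_apply_eq_zero_iff ℂ _).1 (fun l' => ?_) |> sub_eq_zero.1
        obtain ⟨P, hP⟩ := hdual l'
        rw [map_sub, hP, hP, S.dOp_sec_mul_nup hε (fun f => ?_) F (g * l), sub_self]
        rw [← hP, hnil, map_zero]
      rw [← hlevi p.1 p.2 hs, ← map_smul, ← hl F g, ← h1, mul_assoc, ← hpl]⟩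
  map_add' F F' := by
    refine Subtype.ext (funext fun g => ?_)
    change op (S.sec (F + F') g) = op (S.sec F g) + op (S.sec F' g)
    rw [sec_add, map_add]
  map_smul' c F := by
    refine Subtype.ext (funext fun g => ?_)
    change op (S.sec (c • F) g) = c • op (S.sec F g)
    rw [sec_smul, map_smul]

end CellData

/-- The big cell of `G`. -/
def cellG (ε : Fin (m + 1) → ℝ) : CellData ε (m + 1) where
  H := grpG ε
  le := fun _ h => h.1
  e := ContinuousLinearMap.id ℝ _
  mem x := nbarGL_mem ε x
  s := incl
  e_s _ := rfl
  η := ε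
  normSq_e _ := rfl
  dot_e _ _ := rfl
  eps_s _ := rfl
  blk := extendOne
  e_blk _ _ := rfl

/-- The big cell of `G'`. -/
def cellG' (ε : Fin (m + 1) → ℝ) : CellData ε m where
  H := grpG' ε
  le := le_rfl
  e := LinearMap.toContinuousLinearMap
    { toFun := incl, map_add' := incl_add, map_smul' := incl_smul }
  mem x := nbarGL_mem' ε x
  s := id
  e_s _ := rfl
  η := fun i => ε i.castSucc
  normSq_e x := by
    change normSq ε (incl x) = _
    simp [normSq, Fin.sum_univ_castSucc, incl]
  dot_e z x := by
    change ∑ i, incl z i * incl x i = _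
    simp [Fin.sum_univ_castSucc, incl]
  eps_s z := by
    change incl (fun i => ε i.castSucc * z i) = _
    ext i
    refine Fin.lastCases ?_ (fun i => ?_) i <;> simp [incl]
  blk := id
  e_blk M x := by
    change incl (M *ᵥ x) = extendOne M *ᵥ incl x
    rw [extendOne_mulVec]
    simp [incl]

section Equivariance

variable {ε : Fin (m + 1) → ℝ} {lam : ℂ} {δ : ℕ} {E : Type*} [AddCommGroup E] [Module ℂ E]
  {W : Submodule ℂ E} {r : GL (Idx (m + 1)) ℝ → E →ₗ[ℂ] E}

/-- Left translation affects only the group argument of `x ↦ F(g exp x)`, so equivariance is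
automatic. On `N'_-` the value is `op` applied to translates of the section, which is what `hD`
matches with `D`. -/
lemma grpEquivariant_of_op (hε : ∀ i, ε i ^ 2 = 1) (op : Cinf (m + 1) →ₗ[ℂ] E)
    (hW : ∀ f, op f ∈ W)
    (hdual : ∀ l : Module.Dual ℂ E, ∃ P, ∀ f, l (op f) = (dOp P f).1 0)
    (hnil : ∀ (i : Fin m) f, op (sctC ε lam i.castSucc f) = 0)
    (hlevi : ∀ p ∈ grpG' ε, StabLine p → ∀ f, chi lam δ (p.1 i0 i0) •
      op (compC ((p.1 i0 i0)⁻¹ • extendOne (blockM' p)) f) = r p (op f))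
    {D : ((Fin (m + 1) → ℝ) → ℂ) → (Fin m → ℝ) → E}
    (hD : ∀ (f : Cinf (m + 1)) y, D f.1 y = op (transC (incl y) f)) :
    GrpEquivariant ε lam δ W r D := by
  have hn : ∀ z f, op (∑ a, ((cellG ε).s z a : ℂ) • sctC (cellG ε).η lam a f) = 0 := by
    intro z f
    change op (∑ a, (incl z a : ℂ) • sctC ε lam a f) = 0
    rw [Fin.sum_univ_castSucc, map_add, map_sum, Finset.sum_eq_zero fun i _ => by
      rw [map_smul, hnil, smul_zero]]
    simp [incl]
  refine ⟨(cellG ε).opInd hε op hW hdual hn hlevi, fun g F => ?_, fun F => ?_⟩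
  · refine Subtype.ext (funext fun u => ?_)
    exact congrArg op ((cellG ε).sec_inv_mul (fun _ => rfl) u)
  · funext y
    have hb : beta F = ((cellG ε).sec F 1).1 := funext fun x => ((cellG ε).sec_one_apply F x).symm
    rw [hb, hD]
    exact congrArg op ((cellG ε).sec_nbar F y)

lemma grpEquivariant'_of_op (hε : ∀ i, ε i ^ 2 = 1) (op : Cinf m →ₗ[ℂ] E)
    (hW : ∀ f, op f ∈ W)
    (hdual : ∀ l : Module.Dual ℂ E, ∃ P, ∀ f, l (op f) = (dOp P f).1 0)
    (hnil : ∀ (i : Fin m) f, op (sctC (fun i => ε i.castSucc) lam i f) = 0)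
    (hlevi : ∀ p ∈ grpG' ε, StabLine p → ∀ f, chi lam δ (p.1 i0 i0) •
      op (compC ((p.1 i0 i0)⁻¹ • blockM' p) f) = r p (op f))
    {D : ((Fin m → ℝ) → ℂ) → (Fin m → ℝ) → E}
    (hD : ∀ (f : Cinf m) y, D f.1 y = op (transC y f)) :
    GrpEquivariant' ε lam δ W r D := by
  have hn : ∀ z f, op (∑ a, ((cellG' ε).s z a : ℂ) • sctC (cellG' ε).η lam a f) = 0 := by
    intro z f
    rw [map_sum]
    exact Finset.sum_eq_zero fun i _ => by rw [map_smul]; exact (congrArg _ (hnil i f)).trans (smul_zero _)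
  refine ⟨(cellG' ε).opInd hε op hW hdual hn hlevi, fun g F => ?_, fun F => ?_⟩
  · refine Subtype.ext (funext fun u => ?_)
    exact congrArg op ((cellG' ε).sec_inv_mul (fun _ => rfl) u)
  · funext y
    have hb : beta' F = ((cellG' ε).sec F 1).1 := funext fun x => ((cellG' ε).sec_one_apply F x).symm
    rw [hb, hD]
    exact congrArg op ((cellG' ε).sec_nbar F y)

/-- Composition of equivariant operators. -/
lemma GrpEquivariant.comp {ν : ℂ} {δ' : ℕ} {D : ((Fin (m + 1) → ℝ) → ℂ) → (Fin m → ℝ) → ℂ}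
    {B : ((Fin m → ℝ) → ℂ) → (Fin m → ℝ) → E}
    (hB : GrpEquivariant' ε ν δ' W r B)
    (hD : GrpEquivariant ε lam δ (⊤ : Submodule ℂ ℂ)
      (fun p => chi ν δ' (p.1 i0 i0) • LinearMap.id) D) :
    GrpEquivariant ε lam δ W r fun f => B (D f) := by
  obtain ⟨T, hT, hT'⟩ := hD
  obtain ⟨T', hTB, hTB'⟩ := hB
  refine ⟨T'.comp T, fun g F => ?_, fun F => ?_⟩
  · rw [LinearMap.comp_apply, hT, hTB]; rfl
  · rw [LinearMap.comp_apply, hTB', hT']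

end Equivariance

/-! ## Characters -/

/-- Since `c⁻¹ = sgn(c) |c|⁻¹`, each degree of homogeneity shifts both the weight and the sign by
one. -/
lemma chi_mul_pow (lam : ℂ) (δ K : ℕ) {c : ℝ} (hc : c ≠ 0) :
    chi lam δ c * ((c⁻¹ : ℝ) : ℂ) ^ K = chi (lam + K) (δ + K) c := by
  have h1 : ((c⁻¹ : ℝ) : ℂ) = (Real.sign c : ℝ) * ((|c| : ℝ) : ℂ)⁻¹ := by
    rcases lt_or_gt_of_ne hc with h | h
    · rw [Real.sign_of_neg h, abs_of_neg h]; push_cast; rw [inv_neg]; ring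
    · rw [Real.sign_of_pos h, abs_of_pos h]; push_cast; ring
  have h2 : ((|c| : ℝ) : ℂ) ≠ 0 := by exact_mod_cast abs_ne_zero.2 hc
  rw [h1, chi, chi, neg_add, Complex.cpow_add _ _ h2, Complex.cpow_neg _ (K : ℂ),
    Complex.cpow_natCast, mul_pow, pow_add, inv_pow]
  ring

lemma substPoly_smul {M : Matrix (Fin n) (Fin n) ℝ} (c : ℝ) {P : MvPolynomial (Fin n) ℂ} {K : ℕ}
    (hP : P.IsHomogeneous K) : substPoly (c • M) P = ((c : ℂ) ^ K) • substPoly M P := by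
  have h : ∀ i, (∑ j, C (((c • M) i j : ℝ) : ℂ) * X j : MvPolynomial (Fin n) ℂ) =
      C (c : ℂ) * ∑ j, C (M i j : ℂ) * X j := fun i => by
    rw [Finset.mul_sum]
    exact Finset.sum_congr rfl fun j _ => by
      rw [Matrix.smul_apply, smul_eq_mul, Complex.ofReal_mul, C_mul, mul_assoc]
  simp only [substPoly, h]
  rw [smul_eq_C_mul, aeval_def, aeval_def, eval₂_eq', eval₂_eq', Finset.mul_sum]
  refine Finset.sum_congr rfl fun α hα => ?_
  simp only [mul_pow, Finset.prod_mul_distrib]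
  rw [Finset.prod_pow_eq_pow_sum, sum_eq_of_isHomogeneous hP hα, C_pow]
  ring

lemma extendOne_transpose (M : Matrix (Fin m) (Fin m) ℝ) : (extendOne M)ᵀ = extendOne Mᵀ := by
  ext i j
  refine Fin.lastCases ?_ (fun i => ?_) i <;> refine Fin.lastCases ?_ (fun j => ?_) j <;>
    simp [extendOne]

lemma dOp_compC_zero (M : Matrix (Fin n) (Fin n) ℝ) (P : MvPolynomial (Fin n) ℂ) (f : Cinf n) :
    (dOp P (compC M f)).1 0 = (dOp (substPoly Mᵀ P) f).1 0 := by
  rw [dOp_compC]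
  change (dOp (substPoly Mᵀ P) f).1 (M *ᵥ 0) = _
  rw [Matrix.mulVec_zero]

/-- The operators `D_K(λ)` are equivariant. -/
lemma grpEquivariant_of_coe {ε : Fin (m + 1) → ℝ} (hε : ∀ i, ε i ^ 2 = 1) (K : ℕ) (lam : ℂ)
    (δ : ℕ) {D : ((Fin (m + 1) → ℝ) → ℂ) → (Fin (m + 1) → ℝ) → ℂ}
    (hD : ∀ f : Cinf (m + 1), D f.1 = (dOp (wPoly ε K (-lam)) f).1) :
    GrpEquivariant ε lam δ (⊤ : Submodule ℂ ℂ)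
      (fun p => chi (lam + K) (δ + K) (p.1 i0 i0) • LinearMap.id) fun f => restr (D f) := by
  let op : Cinf (m + 1) →ₗ[ℂ] ℂ := (deltaC (m + 1)).comp (dOp (wPoly ε K (-lam)))
  have hop : ∀ f, op f = (dOp (wPoly ε K (-lam)) f).1 0 := fun f => rfl
  refine grpEquivariant_of_op (W := ⊤) hε op (fun f => Submodule.mem_top) (fun l => ?_) (fun i f => ?_)
    (fun p hp hs f => ?_) fun f y => ?_
  · refine ⟨l 1 • wPoly ε K (-lam), fun f => ?_⟩
    rw [map_smul, LinearMap.smul_apply, smul_Cinf_apply, ← hop, mul_comm, ← smul_eq_mul,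
      ← map_smul, smul_eq_mul, mul_one]
  · exact dOp_sctC_zero ε lam (isHomogeneous_wPoly ε K lam) _
      (fPoly_eq_zero (pderiv_wPoly ε K lam) (boxL_wPoly hε K lam) i) f
  · have hM := orthSmall_transpose (fun i => hε i.castSucc) (orthSmall_blockM' hε hp hs)
    rw [hop, dOp_compC_zero, Matrix.transpose_smul, extendOne_transpose,
      substPoly_smul _ (isHomogeneous_wPoly ε K lam), substPoly_extendOne_wPoly hM, map_smul]
    change chi lam δ _ * (_ * (dOp (wPoly ε K (-lam)) f).1 0) = chi (lam + K) (δ + K) _ * op f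
    rw [← chi_mul_pow lam δ K (stabLine_ne_zero hs), hop, mul_assoc]
  · rw [hop, dOp_transC, transC_apply, hD, zero_add]; rfl

/-! ## Gradients and the trace-free part -/

lemma pderiv_comm (i j : Fin n) (P : MvPolynomial (Fin n) ℂ) :
    pderiv i (pderiv j P) = pderiv j (pderiv i P) := by
  have h : ⁅(pderiv i : Derivation ℂ (MvPolynomial (Fin n) ℂ) (MvPolynomial (Fin n) ℂ)),
      (pderiv j : Derivation ℂ (MvPolynomial (Fin n) ℂ) (MvPolynomial (Fin n) ℂ))⁆ = 0 := by
    refine derivation_ext fun l => ?_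
    have : ∀ a b : Fin n, pderiv a (pderiv b (X l : MvPolynomial (Fin n) ℂ)) = 0 := fun a b => by
      rw [pderiv_X, Pi.single_apply]
      split_ifs <;> simp
    rw [Derivation.commutator_apply, this, this, sub_self]; rfl
  have h2 := DFunLike.congr_fun h P
  rw [Derivation.commutator_apply] at h2
  exact sub_eq_zero.1 h2

lemma pderiv_mem_harm {ε : Fin n → ℝ} {d : ℕ} {h : MvPolynomial (Fin n) ℂ}
    (hh : h ∈ Harm ε (d + 1)) (i : Fin n) : pderiv i h ∈ Harm ε d := by
  refine ⟨hh.1.pderiv, ?_⟩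
  have h0 : boxL ε h = 0 := hh.2
  have h1 : boxL ε (pderiv i h) = pderiv i (boxL ε h) := by
    rw [boxL_apply, boxL_apply, map_sum]
    refine Finset.sum_congr rfl fun l _ => ?_
    rw [Derivation.map_smul, pderiv_comm l i h, pderiv_comm l i (pderiv l h)]
  change boxL ε (pderiv i h) = 0
  rw [h1, h0, map_zero]

lemma substPoly_mem_harm {ε : Fin n → ℝ} (hε : ∀ i, ε i ^ 2 = 1) {M : Matrix (Fin n) (Fin n) ℝ}
    (hM : OrthSmall ε M) {d : ℕ} {h : MvPolynomial (Fin n) ℂ} (hh : h ∈ Harm ε d) :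
    substPoly M h ∈ Harm ε d := by
  refine ⟨?_, ?_⟩
  · have := hh.1.aeval (fun i => ∑ l, C (M i l : ℂ) * X l) (n := 1) fun i =>
      IsHomogeneous.sum _ _ _ fun l _ => by
        simpa using (isHomogeneous_C (Fin n) (M i l : ℂ)).mul (isHomogeneous_X ℂ l)
    rwa [one_mul] at this
  · have h0 : boxL ε h = 0 := hh.2
    change boxL ε (substPoly M h) = 0
    rw [boxL_substPoly hε hM, h0, map_zero]

lemma isHomogeneous_prod_X {j : ℕ} (a : Fin j → Fin n) :
    (∏ l, X (a l) : MvPolynomial (Fin n) ℂ).IsHomogeneous j := by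
  simpa using IsHomogeneous.prod Finset.univ (fun l => (X (a l) : MvPolynomial (Fin n) ℂ))
    (fun _ => 1) fun l _ => isHomogeneous_X ℂ (a l)

lemma foldr_pd_ofFn {j : ℕ} (a : Fin j → Fin n) (f : Cinf n) :
    (List.ofFn a).foldr (fun i u => pd i u) f.1 = (dOp (∏ l, X (a l)) f).1 := by
  have h : ∀ l : List (Fin n), l.foldr (fun i u => pd i u) f.1 =
      (dOp (l.map fun i => (X i : MvPolynomial (Fin n) ℂ)).prod f).1 := by
    intro l
    induction l with
    | nil => simp
    | cons i l ih => rw [List.foldr_cons, ih, List.map_cons, List.prod_cons, dOp_X_mul]; rfl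
  rw [h, List.map_ofFn, List.prod_ofFn]
  rfl

lemma gradPoly_coe (j : ℕ) (f : Cinf n) (x : Fin n → ℝ) :
    gradPoly j f.1 x = ∑ a : Fin j → Fin n, (dOp (∏ l, X (a l)) f).1 x • ∏ l, X (a l) := by
  simp only [gradPoly, foldr_pd_ofFn, smul_eq_C_mul]

lemma isHomogeneous_gradPoly (j : ℕ) (f : (Fin n → ℝ) → ℂ) (x : Fin n → ℝ) :
    (gradPoly j f x).IsHomogeneous j :=
  IsHomogeneous.sum _ _ _ fun a _ => by
    simpa using (isHomogeneous_C (Fin n) _).mul (isHomogeneous_prod_X a)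

lemma pairL_C (h : MvPolynomial (Fin n) ℂ) (a : ℂ) : pairL h (C a) = a * coeff 0 h := by
  rw [pairL_comm, C_apply, pairL_monomial]
  simp

/-- Splitting off one index and using that `X_i` is adjoint to `∂_i`, Euler's identity contributes
the degree at each stage; the degrees multiply to `j!`. -/
lemma sum_pairL_prod_X {j : ℕ} {h : MvPolynomial (Fin n) ℂ} (hh : h.IsHomogeneous j) :
    ∑ a : Fin j → Fin n, pairL h (∏ l, X (a l)) • ∏ l, X (a l) = (j.factorial : ℂ) • h := by
  induction j generalizing h with
  | zero =>
    have hC : h = C (coeff 0 h) := totalDegree_eq_zero_iff_eq_C.1 (Nat.le_zero.1 hh.totalDegree_le)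
    have h1 : pairL h 1 = coeff 0 h := by rw [← C_1, pairL_C, one_mul]
    simp only [Finset.univ_eq_empty, Finset.prod_empty, h1, Finset.sum_const]
    conv_rhs => rw [hC]
    simp [smul_eq_C_mul]
  | succ j ih =>
    rw [← (Fin.consEquiv fun _ => Fin n).sum_comp, Fintype.sum_prod_type]
    have e : ∀ i : Fin n, ∑ a : Fin j → Fin n,
        pairL h (∏ l, X ((Fin.consEquiv fun _ => Fin n) (i, a) l)) •
          ∏ l, X ((Fin.consEquiv fun _ => Fin n) (i, a) l) =
        (j.factorial : ℂ) • (X i * pderiv i h) := by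
      intro i
      rw [← mul_smul_comm, ← ih (hh.pderiv (i := i)), Finset.mul_sum]
      refine Finset.sum_congr rfl fun a _ => ?_
      simp only [Fin.consEquiv_apply, Fin.prod_univ_succ, Fin.cons_zero, Fin.cons_succ]
      rw [pairL_X_mul, mul_smul_comm]
    rw [Finset.sum_congr rfl fun i _ => e i, ← Finset.smul_sum, hh.sum_X_mul_pderiv,
      Nat.factorial_succ, ← Nat.cast_smul_eq_nsmul ℂ, smul_smul, Nat.cast_mul, mul_comm]

/-- The gradient is summed over ordered index tuples, whence the factor `j!`. -/
lemma pairL_gradPoly {j : ℕ} {h : MvPolynomial (Fin n) ℂ} (hh : h.IsHomogeneous j) (f : Cinf n)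
    (x : Fin n → ℝ) : pairL h (gradPoly j f.1 x) = (j.factorial : ℂ) * (dOp h f).1 x := by
  have h1 := congrArg (fun P => (dOp P f).1 x) (sum_pairL_prod_X hh)
  simp only [map_sum, map_smul, LinearMap.sum_apply, LinearMap.smul_apply, sum_Cinf_apply,
    smul_Cinf_apply] at h1
  rw [← h1, gradPoly_coe, map_sum]
  exact Finset.sum_congr rfl fun a _ => by rw [map_smul, smul_eq_mul, mul_comm]

/-- It transfers the action of `m'` from the values of `B` to the harmonic test polynomial. -/
lemma pairL_substPoly_transpose (M : Matrix (Fin n) (Fin n) ℝ) (S T : MvPolynomial (Fin n) ℂ) :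
    pairL (substPoly Mᵀ S) T = pairL S (substPoly M T) := by
  induction T using MvPolynomial.induction_on generalizing S with
  | C a =>
    have h1 : substPoly M (C a) = C a := by simp [substPoly]
    have h2 : coeff 0 (substPoly Mᵀ S) = coeff 0 S := by
      rw [← constantCoeff_eq]
      induction S using MvPolynomial.induction_on with
      | C a => simp [substPoly]
      | add p q hp hq => simp only [map_add, hp, hq]
      | mul_X p i hp => rw [map_mul, map_mul, map_mul, substPoly_X]; simp
    rw [h1, pairL_C, pairL_C, h2]
  | add p q hp hq => simp only [map_add, hp, hq]
  | mul_X T i hT =>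
    rw [mul_comm, pairL_X_mul, pderiv_substPoly, pairL_comm, map_sum, map_mul, substPoly_X,
      Finset.sum_mul, map_sum]
    refine Finset.sum_congr rfl fun l _ => ?_
    rw [map_smul, pairL_comm T, hT, mul_assoc, C_mul', map_smul, pairL_X_mul,
      Matrix.transpose_apply]

/-! ## First BGG operators -/

/-- The symmetric trace-free part of the `j`-fold gradient. -/
def bggOp (ε : Fin n → ℝ) (j : ℕ) (f : (Fin n → ℝ) → ℂ) (x : Fin n → ℝ) :
    MvPolynomial (Fin n) ℂ := harmProj ε j (gradPoly j f x)

section BGG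

variable {ε : Fin n → ℝ} {j : ℕ}

lemma bggOp_coe (f : Cinf n) (x : Fin n → ℝ) : bggOp ε j f.1 x =
    ∑ a : Fin j → Fin n, (dOp (∏ l, X (a l)) f).1 x • harmProj ε j (∏ l, X (a l)) := by
  rw [bggOp, gradPoly_coe, map_sum]
  simp only [map_smul]

lemma bggOp_mem (hε : ∀ i, ε i ^ 2 = 1) (hn : 2 ≤ n) (f : (Fin n → ℝ) → ℂ) (x : Fin n → ℝ) :
    bggOp ε j f x ∈ Harm ε j := harmProj_mem hε hn (isHomogeneous_gradPoly j f x)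

lemma pairL_bggOp {h : MvPolynomial (Fin n) ℂ} (hh : h ∈ Harm ε j) (f : Cinf n) (x : Fin n → ℝ) :
    pairL h (bggOp ε j f.1 x) = (j.factorial : ℂ) * (dOp h f).1 x := by
  rw [bggOp, pairL_harmProj hh, pairL_gradPoly hh.1]

/-- By non-degeneracy of the pairing, the values of `B` are controlled by the scalar operators
`h(∂)`, `h` harmonic. -/
lemma bggOp_eq_zero (hε : ∀ i, ε i ^ 2 = 1) (hn : 2 ≤ n) {f : Cinf n} {x : Fin n → ℝ}
    (hf : ∀ h ∈ Harm ε j, (dOp h f).1 x = 0) : bggOp ε j f.1 x = 0 :=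
  eq_zero_of_pairL_harm hε hn (bggOp_mem hε hn f.1 x) fun S hS => by
    rw [pairL_bggOp hS, hf S hS, mul_zero]

/-- The first BGG operator at the origin. -/
def bggZero (ε : Fin n → ℝ) (j : ℕ) : Cinf n →ₗ[ℂ] MvPolynomial (Fin n) ℂ :=
  ∑ a : Fin j → Fin n,
    ((deltaC n).comp (dOp (∏ l, X (a l)))).smulRight (harmProj ε j (∏ l, X (a l)))

lemma bggZero_apply (f : Cinf n) : bggZero ε j f = bggOp ε j f.1 0 := by
  rw [bggOp_coe, bggZero, LinearMap.sum_apply]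
  rfl

/-- Induction on the degree, peeling off one component of `v = exp(x) e_0`. Multiplication by `x_i`
replaces `h` by `∂_i h`, again harmonic and of lower degree. Multiplication by `|x|²/2` produces in
addition `½ □h = 0`. -/
lemma dOp_eq_zero_of_harm {d : ℕ} {P : MvPolynomial (Idx n) ℂ} (hP : P.IsHomogeneous d)
    {h : MvPolynomial (Fin n) ℂ} (hh : h ∈ Harm ε (d + 1)) : dOp h (aeval (vC ε) P) = 0 := by
  -- A homogeneous `g` of positive degree is a multiple of `∑ ξ_i ∂_i g`, so `g(∂)` can be tested on
  -- its partial derivatives.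
  have euler : ∀ {e : ℕ} {g : MvPolynomial (Fin n) ℂ} (_ : g ∈ Harm ε (e + 1)) (f : Cinf n)
      (_ : ∀ i, pdC i (dOp (pderiv i g) f) = 0), dOp g f = 0 := by
    intro e g hg f hf
    have h1 := congrArg (fun P => dOp P f) hg.1.sum_X_mul_pderiv
    simp only [map_sum, LinearMap.sum_apply, dOp_X_mul, hf, Finset.sum_const_zero] at h1
    rw [← Nat.cast_smul_eq_nsmul ℂ, map_smul, LinearMap.smul_apply] at h1
    exact (smul_eq_zero.1 h1.symm).resolve_left (Nat.cast_ne_zero.2 (Nat.succ_ne_zero e))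
  induction d generalizing P h with
  | zero =>
    have hC : P = C (coeff 0 P) := totalDegree_eq_zero_iff_eq_C.1 (Nat.le_zero.1 hP.totalDegree_le)
    refine euler hh _ fun i => ?_
    rw [hC, ← dOp_pdC, aeval_C, Derivation.map_algebraMap, map_zero]
  | succ d ih =>
    have hstep : ∀ (a : Idx n) (Q : MvPolynomial (Idx n) ℂ), Q.IsHomogeneous d →
        dOp h (vC ε a * aeval (vC ε) Q) = 0 := by
      intro a Q hQ
      have hd : ∀ i, dOp (pderiv i h) (aeval (vC ε) Q) = 0 := fun i => ih hQ (pderiv_mem_harm hh i)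
      have h0 : dOp h (aeval (vC ε) Q) = 0 := euler hh _ fun i => by rw [hd, map_zero]
      rcases a with a | i | a
      · change dOp h (1 * _) = 0
        rw [one_mul, h0]
      · change dOp h (xC i * _) = 0
        rw [dOp_xC_mul, h0, hd, mul_zero, add_zero]
      · have hb : boxL ε h = 0 := hh.2
        have hv : vC ε (Sum.inr (Sum.inr a)) = (-1 : ℂ) • halfSqC ε := (neg_one_smul ℂ _).symm
        rw [hv, smul_mul_assoc, map_smul, dOp_halfSqC_mul, h0, hb]
        simp [hd]
    have hE := congrArg (aeval (vC ε)) hP.sum_X_mul_pderiv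
    rw [map_sum, map_nsmul, ← Nat.cast_smul_eq_nsmul ℂ] at hE
    have h1 : ((d + 1 : ℕ) : ℂ) • dOp h (aeval (vC ε) P) = 0 := by
      rw [← map_smul, ← hE, map_sum]
      refine Finset.sum_eq_zero fun a _ => ?_
      rw [map_mul, aeval_X]
      exact hstep a _ hP.pderiv
    exact (smul_eq_zero.1 h1).resolve_left (Nat.cast_ne_zero.2 (Nat.succ_ne_zero d))

lemma aeval_vC_coe (P : MvPolynomial (Idx n) ℂ) :
    (fun x => eval (fun a => (nbar ε x a i0 : ℂ)) P) = (aeval (vC ε) P : Cinf n).1 := by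
  funext x
  induction P using MvPolynomial.induction_on with
  | C a => simp
  | add p q hp hq => rw [map_add, map_add, hp, hq]; rfl
  | mul_X p a hp => rw [map_mul, map_mul, hp, eval_X, aeval_X, ← vC_apply]; rfl

end BGG

/-- The weight `1 - j` is the one for which `λ + K = 1` with `K = j`, so harmonic symbols solve the
F-method equations. Both this and the Levi action are verified after pairing with harmonic
polynomials. -/
lemma grpEquivariant_bggOp {ε : Fin (m + 1) → ℝ} (hε : ∀ i, ε i ^ 2 = 1) (hm : 2 ≤ m) (j δ : ℕ) :
    GrpEquivariant' ε (1 - j) δ (Harm (fun i => ε i.castSucc) j) (actHarm 1 (δ + j))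
      (bggOp (fun i => ε i.castSucc) j) := by
  have hε' : ∀ i : Fin m, ε i.castSucc ^ 2 = 1 := fun i => hε i.castSucc
  have hmem : ∀ f, bggZero (fun i => ε i.castSucc) j f ∈ Harm (fun i => ε i.castSucc) j :=
    fun f => by rw [bggZero_apply]; exact bggOp_mem hε' hm _ _
  refine grpEquivariant'_of_op hε (bggZero (fun i => ε i.castSucc) j) hmem
    (fun l => ?_) (fun i f => ?_) (fun p hp hs f => ?_) fun f y => ?_
  · refine ⟨∑ a : Fin j → Fin m, l (harmProj (fun i => ε i.castSucc) j (∏ l, X (a l))) •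
      ∏ l, X (a l), fun f => ?_⟩
    rw [bggZero_apply, bggOp_coe, map_sum, map_sum, LinearMap.sum_apply, sum_Cinf_apply]
    refine Finset.sum_congr rfl fun a _ => ?_
    rw [map_smul, map_smul, LinearMap.smul_apply, smul_Cinf_apply, smul_eq_mul, mul_comm]
  · rw [bggZero_apply]
    exact bggOp_eq_zero hε' hm fun h hh =>
      dOp_sctC_zero _ _ hh.1 i (fPoly_harm (sub_add_cancel _ _) hh i) f
  · have hM := orthSmall_blockM' hε hp hs
    have hM' := orthSmall_transpose hε' hM
    refine sub_eq_zero.1 (eq_zero_of_pairL_harm hε' hm (sub_mem ((Harm _ j).smul_mem _ (hmem _))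
      ((Harm _ j).smul_mem _ (substPoly_mem_harm hε' hM (hmem f)))) fun S hS => ?_)
    change pairL S (_ - chi 1 (δ + j) (p.1 i0 i0) • substPoly (blockM' p) _) = 0
    rw [map_sub, map_smul, map_smul, bggZero_apply, bggZero_apply, pairL_bggOp hS, dOp_compC_zero,
      Matrix.transpose_smul, substPoly_smul _ hS.1, map_smul, ← pairL_substPoly_transpose,
      pairL_bggOp (substPoly_mem_harm hε' hM' hS), LinearMap.smul_apply, smul_Cinf_apply]
    have h1 := chi_mul_pow (1 - j) δ j (stabLine_ne_zero hs)
    rw [sub_add_cancel] at h1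
    rw [← h1, smul_eq_mul, smul_eq_mul]
    ring
  · rw [bggZero_apply, bggOp_coe, bggOp_coe]
    simp only [dOp_transC, transC_apply, zero_add]

lemma isFirstBGG_bggOp {ε : Fin (m + 1) → ℝ} (hε : ∀ i, ε i ^ 2 = 1) (hm : 2 ≤ m) {j : ℕ}
    (hj : 1 ≤ j) : IsFirstBGG ε j (bggOp (fun i => ε i.castSucc) j) := by
  have hε' : ∀ i : Fin m, ε i.castSucc ^ 2 = 1 := fun i => hε i.castSucc
  refine ⟨fun σ _ x => ⟨bggOp_mem hε' hm σ x, exists_eq_harmProj_add _ _ _⟩, fun σ hσ α => ?_,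
    grpEquivariant_bggOp hε hm j, fun P hP => ?_⟩
  · have h1 : (fun x => coeff α (bggOp (fun i => ε i.castSucc) j σ x)) =
        fun x => ∑ a : Fin j → Fin m, (dOp (∏ l, X (a l)) ⟨σ, mem_Cinf.2 hσ⟩).1 x *
          coeff α (harmProj (fun i => ε i.castSucc) j (∏ l, X (a l))) := by
      funext x
      rw [bggOp_coe ⟨σ, mem_Cinf.2 hσ⟩ x, coeff_sum]
      simp only [coeff_smul, smul_eq_mul]
    rw [h1]
    exact ContDiff.sum fun a _ => (smooth_Cinf _).mul contDiff_const
  · obtain ⟨d, rfl⟩ : ∃ d, j = d + 1 := ⟨j - 1, by omega⟩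
    rw [aeval_vC_coe]
    funext x
    exact bggOp_eq_zero hε' hm fun h hh => by
      rw [dOp_eq_zero_of_harm (by simpa using hP) hh]; rfl

/-! ## The composed operators -/

/-- The summand of `𝓗^{j+K}(ℝ^{p-1,q-1})` that defines the composed operators. -/
def harmEmb {ε : Fin (m + 1) → ℝ} (hε : ∀ i, ε i ^ 2 = 1) {K j d : ℕ} {lam : ℂ}
    (hlam : lam + K = 1 - j) (hd : j + K = d) :
    Harm (fun i => ε i.castSucc) j →ₗ[ℂ] Harm ε d where
  toFun h := ⟨rename Fin.castSucc h.1 * wPoly ε K (-lam),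
    hd ▸ rename_mul_wPoly_mem_harm hε hlam h.2⟩
  map_add' h h' := Subtype.ext <| by
    change rename Fin.castSucc (h.1 + h'.1) * _ = _ * _ + _ * _
    rw [map_add, add_mul]
  map_smul' c h := Subtype.ext <| by
    change rename Fin.castSucc (c • h.1) * _ = c • (_ * _)
    rw [map_smul, smul_mul_assoc]

lemma harmEmb_coe {ε : Fin (m + 1) → ℝ} (hε : ∀ i, ε i ^ 2 = 1) {K j d : ℕ} {lam : ℂ}
    (hlam : lam + K = 1 - j) (hd : j + K = d) (h : Harm (fun i => ε i.castSucc) j) :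
    (harmEmb hε hlam hd h).1 = rename Fin.castSucc h.1 * wPoly ε K (-lam) := rfl

lemma isSummandEmbedding_harmEmb {ε : Fin (m + 1) → ℝ} (hε : ∀ i, ε i ^ 2 = 1) (hm : 0 < m)
    {K j d : ℕ} {lam : ℂ} (hlam : lam + K = 1 - j) (hd : j + K = d) :
    IsSummandEmbedding ε j d (harmEmb hε hlam hd) := by
  refine ⟨fun h h' e => ?_, fun M hM h h' e => ?_⟩
  · have e1 := congrArg Subtype.val e
    rw [harmEmb_coe, harmEmb_coe] at e1
    exact Subtype.ext (rename_injective _ (Fin.castSucc_injective m)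
      (mul_right_cancel₀ (wPoly_ne_zero hε hm K lam) e1))
  · rw [harmEmb_coe, harmEmb_coe, map_mul, substPoly_extendOne_rename,
      substPoly_extendOne_wPoly hM, e]

/-- Since `h(∂')` commutes with restriction to `x_n = 0`, pairing `h` with the composite gives `j!`
times the operator with symbol `h(ξ') w_{K,-λ}(ξ)`, `K = l + 1 - j`, at the origin. Singularity
holds because this symbol is harmonic of degree `l + 1 = 1 - λ`. -/
lemma isBGGMember_bggOp {ε : Fin (m + 1) → ℝ} (hε : ∀ i, ε i ^ 2 = 1)
    (hl : ε (Fin.last m) = -1) (hm : 2 ≤ m) {l j : ℕ} (hj : j ≤ l + 1) {lam : ℂ}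
    (hlam : lam = -(l : ℂ)) :
    IsBGGMember ε lam (vermaPairing ε lam) l j (bggOp (fun i => ε i.castSucc) j) := by
  -- The target weight of `𝓓_{l+1-j}(λ)` is the source weight of `B_j`.
  have hK : lam + ((l + 1 - j : ℕ) : ℂ) = 1 - j := by
    rw [hlam, Nat.cast_sub hj]; push_cast; ring
  have hd : j + (l + 1 - j) = l + 1 := by omega
  refine ⟨fun δ => ?_, harmEmb hε hK hd, isSummandEmbedding_harmEmb hε (by omega) hK hd,
    fun h => ⟨symbVec ε lam (l + 1) (harmEmb hε hK hd h).1,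
      isSingular_harm hε (by rw [hlam]; push_cast; ring) (harmEmb hε hK hd h).2,
      hasSymbol_symbVec ε lam (l + 1) (harmEmb hε hK hd h).2.1, fun f hf => ?_⟩⟩
  · have hD := grpEquivariant_of_coe hε (l + 1 - j) lam δ (juhlD_coe hl (l + 1 - j) lam)
    rw [hK] at hD
    have hB := grpEquivariant_bggOp hε hm j (δ + (l + 1 - j))
    rw [show δ + (l + 1 - j) + j = δ + l + 1 by omega] at hB
    exact GrpEquivariant.comp hB hD
  · have h1 := vermaPairing_symbVec ε lam (l + 1) (harmEmb hε hK hd h).1 ⟨f, mem_Cinf.2 hf⟩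
    have h2 := juhlD_coe hl (l + 1 - j) lam ⟨f, mem_Cinf.2 hf⟩
    have h3 := pairL_bggOp h.2
      (restrC (dOp (wPoly ε (l + 1 - j) (-lam)) ⟨f, mem_Cinf.2 hf⟩)) 0
    have h4 : (incl (0 : Fin m → ℝ)) = 0 := by
      simpa using incl_smul 0 (0 : Fin m → ℝ)
    rw [restrC_coe, ← h2, ← restrC_dOp_rename, ← Module.End.mul_apply, ← map_mul,
      ← harmEmb_coe hε hK hd, restrC_coe, restr, h4, h1, ← mul_assoc] at h3
    exact h3

/-- The operators `D_K(λ)` form a covariant family. -/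
lemma isCovariantFamilyMember_of_coe {ε : Fin (m + 1) → ℝ} (hε : ∀ i, ε i ^ 2 = 1) (hm : 0 < m)
    (K : ℕ) (lam : ℂ) {D : ((Fin (m + 1) → ℝ) → ℂ) → (Fin (m + 1) → ℝ) → ℂ}
    (hD : ∀ f : Cinf (m + 1), D f.1 = (dOp (wPoly ε K (-lam)) f).1) :
    IsCovariantFamilyMember ε lam (vermaPairing ε lam) K D := by
  refine ⟨isDiffOpOfOrder_of_coe hε hm K lam hD, fun f hf => ?_,
    ⟨_, isSingular_wPoly hε K lam, hasSymbol_symbVec ε lam K (isHomogeneous_wPoly ε K lam),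
      fun f hf => ?_⟩, fun δ => grpEquivariant_of_coe hε K lam δ hD, infIntertwines_of_coe hε K lam hD⟩
  · rw [hD ⟨f, mem_Cinf.2 hf⟩]
    exact smooth_Cinf (restrC (dOp (wPoly ε K (-lam)) ⟨f, mem_Cinf.2 hf⟩))
  · have h4 : (incl (0 : Fin m → ℝ)) = 0 := by
      simpa using incl_smul 0 (0 : Fin m → ℝ)
    have h1 := vermaPairing_symbVec ε lam K (wPoly ε K (-lam)) ⟨f, mem_Cinf.2 hf⟩
    rw [← hD] at h1
    rw [restr, h4]
    exact h1

end ConfCov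

end

theorem mainTheorem3 (p q m : ℕ) (hp : 1 ≤ p) (hq : 2 ≤ q) (hn : p + q = m + 3) (hm : 2 < m + 1)
    (lam : ℂ) :
    ∃ φ : ConfCov.Verma (ConfCov.sgn p (m + 1)) (-lam) →ₗ[ℂ] (((Fin (m + 1) → ℝ) → ℂ) → ℂ),
      ConfCov.IsVermaPairing (ConfCov.sgn p (m + 1)) lam φ ∧
      (∀ N : ℕ,
        ConfCov.IsCovariantFamilyMember (ConfCov.sgn p (m + 1)) lam φ (2 * N)
          (ConfCov.Deven (ConfCov.sgn p (m + 1)) N lam) ∧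
        ConfCov.IsCovariantFamilyMember (ConfCov.sgn p (m + 1)) lam φ (2 * N + 1)
          (ConfCov.Dodd (ConfCov.sgn p (m + 1)) N lam)) ∧
      ∀ l : ℕ, lam = -(l : ℂ) → ∀ j : ℕ, 1 ≤ j → j ≤ l + 1 →
        ∃ B : ((Fin m → ℝ) → ℂ) → (Fin m → ℝ) → MvPolynomial (Fin m) ℂ,
          ConfCov.IsFirstBGG (ConfCov.sgn p (m + 1)) j B ∧
          ConfCov.IsBGGMember (ConfCov.sgn p (m + 1)) lam φ l j B := by
  have hε := ConfCov.sgn_sq p (m + 1)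
  -- Because `q ≥ 2`, the direction `x_n` that is restricted away is negative.
  have hl := ConfCov.sgn_last (m := m) hq hn
  refine ⟨ConfCov.vermaPairing (ConfCov.sgn p (m + 1)) lam,
    ConfCov.isVermaPairing_vermaPairing _ lam, fun N => ⟨?_, ?_⟩, fun l hlam j hj hjl => ?_⟩
  · exact ConfCov.isCovariantFamilyMember_of_coe hε (by omega) (2 * N) lam
      (ConfCov.Deven_coe hl N lam)
  · exact ConfCov.isCovariantFamilyMember_of_coe hε (by omega) (2 * N + 1) lam
      (ConfCov.Dodd_coe hl N lam)
  · exact ⟨_, ConfCov.isFirstBGG_bggOp hε (by omega) hj,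
      ConfCov.isBGGMember_bggOp hε hl (by omega) hjl hlam⟩
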